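/- Let $n\ge 2$, $R>0$, and let $g=(g_{ij})$ be a smooth Riemannian metric on the half ball $\{x\in\mathbb R^n:\ |x|<R,\ x_n\ge 0\}$, smooth up to the flat boundary $\{x_n=0\}$ (i.e. the restriction of a smooth function on the ball), in Fermi coordinates at a boundary point: $g_{nn}=1$, $g_{in}=0$ for $i<n$, and $g_{ij}(0)=\delta_{ij}$. Write $\triangle=\triangle_g$ for the Laplace–Beltrami operator, acting on each component of a vector function. Let $r$ be one of the following radial functions: (a) $r(x)$ is the Riemannian distance in the half ball from the origin to $x$ (the infimum of the $g$-lengths of the $C^1$ curves in the half ball from $0$ to $x$), and polar geodesic coordinates describe the half ball over a half sphere: $r^2$ is the restriction of a smooth function on $\{|x|<R\}$ and $\partial (r^2)/\partial x_n=0$ on $\{x_n=0\}$ (the radial geodesics that start tangentially to the flat boundary stay in it); (b) $r(x)=|x|$, the radius in the Fermi coordinates, with no further condition on $g$. Put $\phi(t)=t+\ln t^2$, $\psi(x)=-\phi(\ln r(x))$, $\mathbb B^+_s=\{x: |x|<R,\ x_n>0,\ r(x)<s\}$ and $\widehat{\mathbb B}{}^+_s=\{x: |x|<R,\ x_n\ge0,\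 r(x)<s\}$. Let $\|\cdot\|$ be the $L^2$ norm on $\mathbb B^+_{r_0}$ with respect to the Riemannian volume, $|V|^2=\sum_kV_k^2$ and $|\nabla V|^2=\sum_k g^{ij}\partial_iV_k\partial_jV_k$. For a scalar function $f$ let $\|f\|_{C^1}=\sup|f|+\sup|\nabla f|\in[0,\infty]$ over $\widehat{\mathbb B}{}^+_{r_0}$, with the Euclidean gradient. Then there exist constants $C_1,C_0>0$ and $0<r_0<1$, depending only on $n$, $R$, $g$ and the choice of $r$, such that the following holds. Let $E,h$ be real functions of class $C^1$ on $\widehat{\mathbb B}{}^+_{r_0}$, let $V=(V_1,\dots,V_n)$ be the restriction to $\{x_n\ge0\}$ of a smooth function $\mathbb R^n\to\mathbb R^n$, with support (in $\{x_n\ge0\}$) a compact subset of $\widehat{\mathbb B}{}^+_{r_0}\setminus\{0\}$, and let $$\triangle V+E(x)V=F(x)\quad\text{in }\mathbb B^+_{r_0},$$ $$V_1=\dots=V_{n-1}=0,\qquad \frac{\partial V_n}{\partial x_n}=h(x)V_n\quad\text{on }\widehat{\mathbb B}{}^+_{r_0}\cap\{x_n=0\}.$$ If $\beta>C_0\bigl(1+\sqrt{\|E\|_{C^1}}+\|h\|_{C^1}\bigr)$,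 then $$\beta^{3/2}\|e^{\beta\psi}(\log r)^{-1}V\|+\beta^{1/2}\|r e^{\beta\psi}(\log r)^{-1}\nabla V\|\le C_1\|r^2e^{\beta\psi}F\|.$$ If, in addition, $\rho>0$ and $r\ge\rho$ on the support of $V$, then $$\beta^{3/2}\|e^{\beta\psi}(\log r)^{-1}V\|+\beta\rho^{1/2}\|r^{-1/2}e^{\beta\psi}V\|+\beta^{1/2}\|r e^{\beta\psi}(\log r)^{-1}\nabla V\|\le C_1\|r^2e^{\beta\psi}F\|.$$ -/

import Mathlib

open MeasureTheory Set
open scoped ENNReal ContDiff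

namespace HalfBallCarleman

noncomputable section

/-- Euclidean space `ℝⁿ` with `n = m + 1`; the last coordinate `x (Fin.last m)` is `xₙ`. -/
abbrev Space (m : ℕ) : Type := EuclideanSpace ℝ (Fin (m + 1))

/-- The coordinate half ball `{|x| < R, xₙ ≥ 0}`, with its flat boundary. -/
def chart (m : ℕ) (R : ℝ) : Set (Space m) :=
  {x | ‖x‖ < R ∧ 0 ≤ x (Fin.last m)}

/-- The partial derivative `∂ᵢ f (x)`. -/
def pd {m : ℕ} (i : Fin (m + 1)) (f : Space m → ℝ) (x : Space m) : ℝ :=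
  fderiv ℝ f x (EuclideanSpace.single i 1)

/-- A smooth Riemannian metric on the half ball of radius `R`, smooth up to the flat boundary
(that is, the restriction of a smooth function on the ball), written in Fermi coordinates
centred at a boundary point: `g_{nn} = 1`, `g_{in} = 0` for `i < n`, `g_{ij}(0) = δ_{ij}`. -/
structure IsFermiMetric {m : ℕ} (R : ℝ)
    (g : Space m → Matrix (Fin (m + 1)) (Fin (m + 1)) ℝ) : Prop where
  smooth : ∀ i j, ContDiffOn ℝ ∞ (fun x => g x i j) (Metric.ball 0 R)
  posDef : ∀ x ∈ chart m R, (g x).PosDef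
  normal_normal : ∀ x ∈ chart m R, g x (Fin.last m) (Fin.last m) = 1
  normal_tangent : ∀ x ∈ chart m R, ∀ i, i ≠ Fin.last m → g x i (Fin.last m) = 0
  at_origin : g 0 = 1

/-- The Laplace-Beltrami operator
`Δ_g u = det(g)^{-1/2} ∑_{i,j} ∂ᵢ (det(g)^{1/2} g^{ij} ∂ⱼ u)`. -/
def laplaceBeltrami {m : ℕ} (g : Space m → Matrix (Fin (m + 1)) (Fin (m + 1)) ℝ)
    (u : Space m → ℝ) (x : Space m) : ℝ :=
  (Real.sqrt (g x).det)⁻¹ *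
    ∑ i, ∑ j, pd i (fun y => Real.sqrt (g y).det * (g y)⁻¹ i j * pd j u y) x

/-- `|∇V|_g`, where `|∇V|_g² = ∑ₖ ∑_{i,j} g^{ij} ∂ᵢVₖ ∂ⱼVₖ`. -/
def gradNorm {m : ℕ} (g : Space m → Matrix (Fin (m + 1)) (Fin (m + 1)) ℝ)
    (V : Space m → Space m) (x : Space m) : ℝ :=
  Real.sqrt (∑ k, ∑ i, ∑ j,
    (g x)⁻¹ i j * pd i (fun y => V y k) x * pd j (fun y => V y k) x)

/-- The `g`-length of a curve parametrized by `[0, 1]`. -/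
def curveLength {m : ℕ} (g : Space m → Matrix (Fin (m + 1)) (Fin (m + 1)) ℝ)
    (γ : ℝ → Space m) : ℝ :=
  ∫ t in (0 : ℝ)..1,
    Real.sqrt (∑ i, ∑ j, g (γ t) i j * (deriv γ t) i * (deriv γ t) j)

/-- The Riemannian distance from the origin to `x` in the half ball of radius `R`: the infimum of
the lengths of the `C¹` curves from `0` to `x` that stay in the half ball. -/
def riemDist {m : ℕ} (g : Space m → Matrix (Fin (m + 1)) (Fin (m + 1)) ℝ) (R : ℝ)
    (x : Space m) : ℝ :=
  sInf {l | ∃ γ : ℝ → Space m, ContDiff ℝ 1 γ ∧ γ 0 = 0 ∧ γ 1 = x ∧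
    (∀ t ∈ Icc (0 : ℝ) 1, γ t ∈ chart m R) ∧ l = curveLength g γ}

/-- The half ball is described by polar geodesic coordinates over a half sphere: the square of
the Riemannian distance `r` from the origin is smooth up to the flat boundary (so the half ball
lies within the injectivity radius), and `∂r/∂xₙ = 0` on `{xₙ = 0}`, so that the radial geodesics
issued tangentially to the flat boundary stay in it. -/
def HasPolarHalfBall {m : ℕ} (g : Space m → Matrix (Fin (m + 1)) (Fin (m + 1)) ℝ)
    (R : ℝ) : Prop :=
  ∃ σ : Space m → ℝ, ContDiffOn ℝ ∞ σ (Metric.ball 0 R) ∧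
    (∀ x ∈ chart m R, riemDist g R x ^ 2 = σ x) ∧
    ∀ x ∈ chart m R, x (Fin.last m) = 0 → pd (Fin.last m) σ x = 0

/-- The half ball `B⁺_s = {r < s, xₙ > 0}` of the radial function `r`. -/
def halfBall {m : ℕ} (R : ℝ) (r : Space m → ℝ) (s : ℝ) : Set (Space m) :=
  {x | x ∈ chart m R ∧ 0 < x (Fin.last m) ∧ r x < s}

/-- The half ball together with its flat boundary, `{r < s, xₙ ≥ 0}`. -/
def halfBallFlat {m : ℕ} (R : ℝ) (r : Space m → ℝ) (s : ℝ) : Set (Space m) :=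
  {x | x ∈ chart m R ∧ r x < s}

/-- The support of `V`, as a function on the closed half space `{xₙ ≥ 0}`. -/
def halfSupport {m : ℕ} (V : Space m → Space m) : Set (Space m) :=
  closure {x | 0 ≤ x (Fin.last m) ∧ V x ≠ 0}

/-- The `C¹` norm `sup |f| + sup |∇f|` over `s`, possibly infinite. -/
def cOneNorm {m : ℕ} (s : Set (Space m)) (f : Space m → ℝ) : ℝ≥0∞ :=
  (⨆ x ∈ s, ‖f x‖ₑ) + ⨆ x ∈ s, ‖fderivWithin ℝ f s x‖ₑ

/-- The `L²` norm over `s` with respect to the Riemannian volume `det(g)^{1/2} dx`. -/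
def l2Norm {m : ℕ} {G : Type*} [NormedAddCommGroup G]
    (g : Space m → Matrix (Fin (m + 1)) (Fin (m + 1)) ℝ)
    (s : Set (Space m)) (f : Space m → G) : ℝ≥0∞ :=
  eLpNorm f 2 ((volume.restrict s).withDensity
    fun x => ENNReal.ofReal (Real.sqrt (g x).det))

/-- `φ(t) = t + ln t²`. -/
def phi (t : ℝ) : ℝ := t + Real.log (t ^ 2)

/-- The Carleman weight `e^{βψ}`, with `ψ = -φ(ln r)`. -/
def weight {m : ℕ} (r : Space m → ℝ) (β : ℝ) (x : Space m) : ℝ :=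
  Real.exp (β * (-phi (Real.log (r x))))

end

end HalfBallCarleman

open HalfBallCarleman

namespace HalfBallCarleman

/-! ### Calculus of coordinate partial derivatives. -/

section PartialDerivatives

variable {m : ℕ} {i j : Fin (m + 1)} {f g : Space m → ℝ} {x : Space m} {U : Set (Space m)}

/-! Write n = m + 1, τ = ln r, σ = r² and X = ½ g⁻¹∇σ. Only two facts about r matter: σ has a smooth
extension with the Taylor expansion of |x|² up to second order at the origin, and ∂ₙσ = 0 on the
flat boundary. The eikonal equation |∇r| = 1 is not needed. It follows that X, its divergence, its
deformation form and the speed q = |∇r|² agree with those of the Euclidean dilation field up to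
relative errors O(r); this is `IsCarlemanGeometry`, supplied by `exists_carlemanGeometry`. For r =
|x| the two facts are immediate. For the Riemannian distance, comparing lengths of curves gives |r²
- |x|²| ≤ C|x|³ in the half ball, and this already fixes the second order Taylor polynomial of the
smooth extension (`taylor_of_half_ball`).

For one component v put u = r^{n/2} e^{βψ} v, P = β(1 + 2/τ) - 1 and k = (n - 2)/2. Then r^{n/2}
e^{βψ} r² (Δv + Ev) = Λ + 2P Xu + (B + e₁)u, where Λ = r²Δu - (n - 2)Xu, B = (P² - k²)q + r²E and e₁
= O(β/τ²) (`conjFun_operator`). For the cylindrical measure r^{-n} dx, u ↦ Λ + Bu is symmetric and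
2PX is antisymmetric, up to lower order terms. In the square, the cross term 4P(Λ + Bu)Xu is a
divergence plus explicit terms, by the Rellich identity (`divField_rellichField`). These contain a
positive multiple of β³τ⁻²u², and a gradient term of the wrong sign, because P' = -2β/τ² is
negative. The additional multiplier -su with s = 3β/τ², which costs nothing since (Λ + Bu + su)² ≥
0, repairs the gradient term and uses up only part of the u² term. The remaining 4P²(Xu)² absorbs
the cross terms. It also pays for the term with ρ, which comes from one more divergence, that of a
multiple of (ρ/r) u² X, and needs ρ ≤ r on the support.

The assumption on β gives ‖E‖ ≤ β² and ‖h‖ ≤ β in C¹, and r is much smaller than 1/τ² near the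
origin. All errors are therefore absorbed once r₀ is small, and the result is a pointwise inequality
with a divergence (`carleman_quadratic_inequality`, `carleman_pointwise`).

On the flat boundary X is tangential, so the flux of the field is J ∂ₙu (2f₁Xu - f₃u), with f₁, f₃
the coefficients of the Rellich field and of u a∇u. It vanishes under the Dirichlet condition. Under
the Robin condition the field 2ζu(∂ₙu X - Xu eₙ) + ηu² eₙ, with ζ = f₁Jh and η = f₃Jh, is added. It
turns the flux into a multiple of ∂ₙu - hu, which is zero. Its divergence contains no second
derivatives of u and no quadratic gradient term, so it is one more error of relative size O(r)
(`divField_carlemanField`, `abs_boundaryTerm_le`). The divergence theorem in the half space, the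
return from u to v and summation over the components give the estimate
(`integral_carlemanDensity_le`, `carleman_l2Norm_le`). -/

theorem HasFDerivAt.pd_eq {f' : Space m →L[ℝ] ℝ} (h : HasFDerivAt f f' x) :
    pd i f x = f' (EuclideanSpace.single i 1) := by
  rw [pd, h.fderiv]

theorem pd_congr (h : f =ᶠ[nhds x] g) : pd i f x = pd i g x := by
  rw [pd, pd, h.fderiv_eq]

@[simp] theorem pd_const (c : ℝ) : pd i (fun _ => c) x = 0 := by
  simp [pd]

theorem pd_add (hf : DifferentiableAt ℝ f x) (hg : DifferentiableAt ℝ g x) :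
    pd i (fun y => f y + g y) x = pd i f x + pd i g x := by
  exact (HasFDerivAt.pd_eq (hf.hasFDerivAt.add hg.hasFDerivAt)).trans rfl

theorem pd_sub (hf : DifferentiableAt ℝ f x) (hg : DifferentiableAt ℝ g x) :
    pd i (fun y => f y - g y) x = pd i f x - pd i g x := by
  exact (HasFDerivAt.pd_eq (hf.hasFDerivAt.sub hg.hasFDerivAt)).trans rfl

theorem pd_neg : pd i (fun y => - f y) x = - pd i f x := by
  rw [pd, fderiv_fun_neg]; rfl

theorem pd_mul (hf : DifferentiableAt ℝ f x) (hg : DifferentiableAt ℝ g x) :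
    pd i (fun y => f y * g y) x = pd i f x * g x + f x * pd i g x := by
  refine (HasFDerivAt.pd_eq (hf.hasFDerivAt.mul hg.hasFDerivAt)).trans ?_
  simp [pd]; ring

theorem pd_const_mul (c : ℝ) (hf : DifferentiableAt ℝ f x) :
    pd i (fun y => c * f y) x = c * pd i f x := by
  rw [pd_mul (by fun_prop) hf]; simp

theorem pd_sq (hf : DifferentiableAt ℝ f x) :
    pd i (fun y => f y ^ 2) x = 2 * f x * pd i f x := by
  simp only [pow_two]; rw [pd_mul hf hf]; ring

theorem pd_sum {ι : Type*} (s : Finset ι) {F : ι → Space m → ℝ}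
    (hF : ∀ k ∈ s, DifferentiableAt ℝ (F k) x) :
    pd i (fun y => ∑ k ∈ s, F k y) x = ∑ k ∈ s, pd i (F k) x := by
  rw [pd, fderiv_fun_sum hF]; simp [pd]

theorem pd_comp {φ : ℝ → ℝ} {φ' : ℝ} (hφ : HasDerivAt φ φ' (f x)) (hf : DifferentiableAt ℝ f x) :
    pd i (fun y => φ (f y)) x = φ' * pd i f x := by
  exact (HasFDerivAt.pd_eq (hφ.comp_hasFDerivAt x hf.hasFDerivAt)).trans (by simp [pd])

theorem contDiffOn_pd (hf : ContDiffOn ℝ ∞ f U) (hU : IsOpen U) (i : Fin (m + 1)) :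
    ContDiffOn ℝ ∞ (pd i f) U := by
  have h := hf.fderiv_of_isOpen (m := ∞) hU (by simp)
  exact h.clm_apply contDiffOn_const

theorem pd_comm (hf : ContDiffAt ℝ 2 f x) (i j : Fin (m + 1)) :
    pd i (pd j f) x = pd j (pd i f) x := by
  have hs := hf.isSymmSndFDerivAt (by simp)
  have hd : DifferentiableAt ℝ (fderiv ℝ f) x :=
    (hf.fderiv_right (m := 1) (by norm_num)).differentiableAt (by simp)
  have key : ∀ i j : Fin (m + 1), pd i (pd j f) x =
      fderiv ℝ (fderiv ℝ f) x (EuclideanSpace.single i 1) (EuclideanSpace.single j 1) := by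
    intro i j
    have := (hd.hasFDerivAt.clm_apply (hasFDerivAt_const (EuclideanSpace.single j (1:ℝ)) x))
    rw [show pd j f = fun y => fderiv ℝ f y (EuclideanSpace.single j 1) from rfl,
      HasFDerivAt.pd_eq this]
    simp
  rw [key, key]; exact hs _ _

theorem pd_coord (i j : Fin (m + 1)) : pd i (fun y : Space m => y j) x = if i = j then 1 else 0 := by
  have h : HasFDerivAt (fun y : Space m => y j) (EuclideanSpace.proj j : Space m →L[ℝ] ℝ) x :=
    (EuclideanSpace.proj j : Space m →L[ℝ] ℝ).hasFDerivAt
  rw [HasFDerivAt.pd_eq h]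
  simp [eq_comm]

theorem sum_single_smul (v : Space m) : ∑ i, v i • EuclideanSpace.single i (1 : ℝ) = v := by
  ext j; simp [Finset.sum_apply, Pi.single_apply]

theorem fderiv_apply_eq_sum_pd (v : Space m) : fderiv ℝ f x v = ∑ i, v i * pd i f x := by
  conv_lhs => rw [← sum_single_smul v]
  simp [pd]

theorem norm_pd_le : |pd i f x| ≤ ‖fderiv ℝ f x‖ := by
  have := (fderiv ℝ f x).le_opNorm (EuclideanSpace.single i 1)
  simpa [pd] using this

end PartialDerivatives

/-! ### The divergence theorem in a half space. -/

section Divergence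

variable {m : ℕ}

/-- The closed half space `{xₙ ≥ 0}`. -/
def halfSpace (m : ℕ) : Set (Space m) := {x | 0 ≤ x (Fin.last m)}

/-- The open half space `{xₙ > 0}`. -/
def openHalfSpace (m : ℕ) : Set (Space m) := {x | 0 < x (Fin.last m)}

theorem isOpen_openHalfSpace : IsOpen (openHalfSpace m) :=
  isOpen_lt continuous_const (by fun_prop)

theorem openHalfSpace_subset : openHalfSpace m ⊆ halfSpace m := by
  intro x hx
  have h : 0 < x (Fin.last m) := hx
  exact h.le

theorem convex_halfSpace : Convex ℝ (halfSpace m) := by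
  have := convex_halfSpace_ge (𝕜 := ℝ) (f := fun x : Space m => x (Fin.last m))
    ⟨fun _ _ => rfl, fun _ _ => rfl⟩ 0
  exact this

theorem uniqueDiffOn_halfSpace : UniqueDiffOn ℝ (halfSpace m) := by
  apply uniqueDiffOn_convex convex_halfSpace
  refine ⟨EuclideanSpace.single (Fin.last m) 1, ?_⟩
  rw [mem_interior]
  exact ⟨_, openHalfSpace_subset, isOpen_openHalfSpace, by simp [openHalfSpace]⟩

theorem halfSpace_subset_closure : halfSpace m ⊆ closure (openHalfSpace m) := by
  intro x hx
  have hx' : 0 ≤ x (Fin.last m) := hx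
  have hc : Continuous fun s : ℝ => x + s • EuclideanSpace.single (Fin.last m) (1 : ℝ) := by fun_prop
  have h2 := (hc.tendsto 0).mono_left (nhdsWithin_le_nhds (s := Ioi 0))
  simp only [zero_smul, add_zero] at h2
  refine mem_closure_of_tendsto h2 ?_
  filter_upwards [self_mem_nhdsWithin] with s hs
  have hs' : 0 < s := hs
  simp [openHalfSpace]; linarith

/-- A function continuous up to the flat boundary that vanishes in the interior of the half space
off a closed set vanishes up to the boundary off that set. -/
theorem eq_zero_of_interior {O K : Set (Space m)} (hO : IsOpen O) (hK : IsClosed K)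
    {f : Space m → ℝ} (hf : ContinuousOn f (O ∩ halfSpace m))
    (h0 : ∀ x ∈ O, 0 < x (Fin.last m) → x ∉ K → f x = 0) :
    ∀ x ∈ O ∩ halfSpace m, x ∉ K → f x = 0 := by
  intro x hx hxK
  have hO' : IsOpen (O ∩ Kᶜ) := hO.inter hK.isOpen_compl
  have hxc : x ∈ closure (openHalfSpace m ∩ (O ∩ Kᶜ)) := by
    have := hO'.inter_closure (t := openHalfSpace m) ⟨⟨hx.1, hxK⟩, halfSpace_subset_closure hx.2⟩
    rwa [inter_comm] at this
  have hc : ContinuousWithinAt f (openHalfSpace m ∩ (O ∩ Kᶜ)) x :=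
    (hf x hx).mono fun y hy => ⟨hy.2.1, openHalfSpace_subset hy.1⟩
  have := hc.mem_closure_image hxc
  have h1 : f '' (openHalfSpace m ∩ (O ∩ Kᶜ)) ⊆ {0} := by
    rintro _ ⟨y, hy, rfl⟩
    exact h0 y hy.2.1 hy.1 hy.2.2
  have h2 := closure_mono h1 this
  simpa using h2

/-- Extension by zero keeps the regularity because a point outside `O` is outside the closed set `K
⊆ O`, and near such a point the function already vanishes. Vanishing is assumed only for xₙ > 0,
since nothing is known about `V` below the boundary; continuity carries it to xₙ = 0. -/
theorem contDiffOn_indicator_halfSpace {O K : Set (Space m)} (hO : IsOpen O) (hK : IsClosed K)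
    (hKO : K ⊆ O) {f : Space m → ℝ} {n : WithTop ℕ∞} (hf : ContDiffOn ℝ n f (O ∩ halfSpace m))
    (h0 : ∀ x ∈ O, 0 < x (Fin.last m) → x ∉ K → f x = 0) :
    ContDiffOn ℝ n (O.indicator f) (halfSpace m) := by
  have h0' := eq_zero_of_interior hO hK hf.continuousOn h0
  intro x hx
  by_cases hxO : x ∈ O
  · have h1 : ContDiffWithinAt ℝ n f (O ∩ halfSpace m) x := hf x ⟨hxO, hx⟩
    have h2 : ContDiffWithinAt ℝ n f (halfSpace m) x := by
      rwa [inter_comm, contDiffWithinAt_inter (hO.mem_nhds hxO)] at h1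
    refine h2.congr_of_eventuallyEq ?_ (by simp [hxO])
    filter_upwards [nhdsWithin_le_nhds (hO.mem_nhds hxO)] with y hy
    simp [hy]
  · have hxK : x ∉ K := fun h => hxO (hKO h)
    refine (contDiffWithinAt_const (c := (0 : ℝ))).congr_of_eventuallyEq ?_ (by simp [hxO])
    filter_upwards [nhdsWithin_le_nhds (hK.isOpen_compl.mem_nhds hxK), self_mem_nhdsWithin]
      with y hy hyH
    by_cases hyO : y ∈ O
    · simp [hyO, h0' y ⟨hyO, hyH⟩ hy]
    · simp [hyO]

/-- The divergence theorem on a box whose bottom face lies in {xₙ = 0}: the field vanishes on the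
other faces because they miss `K`, and its normal component vanishes on the bottom. Derivatives
within the half space keep the divergence continuous up to the boundary, hence integrable. -/
theorem integral_fderivWithin_halfSpace {K : Set (Space m)} (hK : IsCompact K)
    (W : Fin (m + 1) → Space m → ℝ) (hW : ∀ i, ContDiffOn ℝ 1 (W i) (halfSpace m))
    (h0 : ∀ i, ∀ x ∈ halfSpace m, x ∉ K → W i x = 0)
    (hb : ∀ x : Space m, x (Fin.last m) = 0 → W (Fin.last m) x = 0) :
    IntegrableOn (fun x => ∑ i, fderivWithin ℝ (W i) (halfSpace m) x (EuclideanSpace.single i 1))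
        (openHalfSpace m) ∧
      ∫ x in openHalfSpace m,
        ∑ i, fderivWithin ℝ (W i) (halfSpace m) x (EuclideanSpace.single i 1) = 0 := by
  set D : Space m → ℝ :=
    fun x => ∑ i, fderivWithin ℝ (W i) (halfSpace m) x (EuclideanSpace.single i 1) with hD
  have hDc : ContinuousOn D (halfSpace m) := by
    apply continuousOn_finsetSum
    intro i _
    exact ((hW i).continuousOn_fderivWithin uniqueDiffOn_halfSpace le_rfl).clm_apply
      continuousOn_const
  have hD0 : ∀ x ∈ openHalfSpace m, x ∉ K → D x = 0 := by
    intro x hx hxK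
    apply Finset.sum_eq_zero
    intro i _
    have : W i =ᶠ[nhdsWithin x (halfSpace m)] fun _ => 0 := by
      filter_upwards [nhdsWithin_le_nhds (hK.isClosed.isOpen_compl.mem_nhds hxK),
        self_mem_nhdsWithin] with y hy hyH using h0 i y hyH hy
    rw [this.fderivWithin_eq (h0 i x (openHalfSpace_subset hx) hxK)]
    simp
  obtain ⟨M, hM0, hM⟩ := hK.isBounded.exists_pos_norm_lt
  -- The box is [-M, M] in the tangential directions and [0, M] in the normal one, where `K` lies in
  -- the open ball of radius M.
  set a : Fin (m + 1) → ℝ := fun i => if i = Fin.last m then 0 else -M with ha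
  set b : Fin (m + 1) → ℝ := fun _ => M with hb'
  have hab : a ≤ b := by
    intro i; simp only [ha, hb']; split_ifs <;> linarith
  have hcoord : ∀ x : Space m, ∀ i, |x i| ≤ ‖x‖ := fun x i => by
    simpa using PiLp.norm_apply_le x i
  have hIccH : MapsTo (WithLp.toLp 2 : (Fin (m + 1) → ℝ) → Space m) (Icc a b) (halfSpace m) := by
    intro x hx
    have := hx.1 (Fin.last m)
    simpa [ha, halfSpace] using this
  have hcont : Continuous (WithLp.toLp 2 : (Fin (m + 1) → ℝ) → Space m) := by fun_prop
  have hmp := PiLp.volume_preserving_toLp (Fin (m + 1))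
  have hme : MeasurableEmbedding (WithLp.toLp 2 : (Fin (m + 1) → ℝ) → Space m) :=
    (MeasurableEquiv.toLp 2 (Fin (m + 1) → ℝ)).measurableEmbedding
  let L : (Fin (m + 1) → ℝ) →L[ℝ] Space m :=
    ((EuclideanSpace.equiv (Fin (m + 1)) ℝ).symm : (Fin (m + 1) → ℝ) ≃L[ℝ] Space m)
  have hL : ∀ x, L x = WithLp.toLp 2 x := fun x => rfl
  have hint : IntegrableOn (fun x : Fin (m + 1) → ℝ => D (WithLp.toLp 2 x)) (Icc a b) :=
    (hDc.comp hcont.continuousOn hIccH).integrableOn_compact isCompact_Icc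
  have hsingle : ∀ i : Fin (m + 1), L (Pi.single i 1) = EuclideanSpace.single i (1 : ℝ) :=
    fun i => rfl
  have hIoo : ∀ x : Fin (m + 1) → ℝ, x ∈ pi univ (fun i => Ioo (a i) (b i)) →
      WithLp.toLp 2 x ∈ openHalfSpace m := by
    intro x hx
    have := (hx (Fin.last m) (mem_univ _)).1
    simpa [ha, openHalfSpace] using this
  have hdiv := integral_divergence_of_hasFDerivAt_off_countable' a b hab
    (fun i x => W i (WithLp.toLp 2 x))
    (fun i x => (fderivWithin ℝ (W i) (halfSpace m) (WithLp.toLp 2 x)).comp L) ∅ countable_empty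
    (fun i => (hW i).continuousOn.comp hcont.continuousOn hIccH)
    (by
      intro x hx i
      have hx1 := hIoo x hx.1
      have hnh : halfSpace m ∈ nhds (WithLp.toLp 2 x : Space m) :=
        Filter.mem_of_superset (isOpen_openHalfSpace.mem_nhds hx1) openHalfSpace_subset
      have h1 : HasFDerivAt (W i) (fderivWithin ℝ (W i) (halfSpace m) (WithLp.toLp 2 x))
          (WithLp.toLp 2 x) :=
        (((hW i).differentiableOn (by simp)) _
          (openHalfSpace_subset hx1)).hasFDerivWithinAt.hasFDerivAt hnh
      exact h1.comp x L.hasFDerivAt)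
    (by simpa only [ContinuousLinearMap.comp_apply, hsingle] using hint)
  have hfaces : (∫ x in Icc a b, D (WithLp.toLp 2 x)) = 0 := by
    have h1 : (fun x : Fin (m + 1) → ℝ => D (WithLp.toLp 2 x)) = fun x => ∑ i,
      ((fderivWithin ℝ (W i) (halfSpace m) (WithLp.toLp 2 x)).comp L) (Pi.single i 1) := by
      funext x; simp only [hD, ContinuousLinearMap.comp_apply, hsingle]
    rw [h1, hdiv]
    apply Finset.sum_eq_zero
    intro i _
    have hface : ∀ c : ℝ, (c = M ∨ c = -M ∧ i ≠ Fin.last m ∨ c = 0 ∧ i = Fin.last m) →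
        ∀ y ∈ Icc (a ∘ i.succAbove) (b ∘ i.succAbove),
          W i (WithLp.toLp 2 (i.insertNth c y) : Space m) = 0 := by
      intro c hc y hy
      have hci : (WithLp.toLp 2 (i.insertNth c y) : Space m) i = c := by simp
      have hbig : |c| = M → WithLp.toLp 2 (i.insertNth c y) ∈ halfSpace m →
          W i (WithLp.toLp 2 (i.insertNth c y) : Space m) = 0 := by
        intro hcM hH
        apply h0 i _ hH
        intro hKx
        have h1 := hM _ hKx
        have h2 := hcoord (WithLp.toLp 2 (i.insertNth c y)) i
        rw [hci, hcM] at h2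
        linarith
      have hHoff : i ≠ Fin.last m → WithLp.toLp 2 (i.insertNth c y) ∈ halfSpace m := by
        intro hi
        obtain ⟨j, hj⟩ := Fin.exists_succAbove_eq (Ne.symm hi)
        have h1 := hy.1 j
        simp only [Function.comp, hj, ha, if_true] at h1
        simp only [halfSpace, mem_ofPred_eq, ← hj, Fin.insertNth_apply_succAbove]
        exact h1
      rcases hc with rfl | ⟨rfl, hi⟩ | ⟨rfl, hi⟩
      · apply hbig (abs_of_pos hM0)
        by_cases hi : i = Fin.last m
        · subst hi; simp [halfSpace]; exact hM0.le
        · exact hHoff hi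
      · exact hbig (by rw [abs_neg, abs_of_pos hM0]) (hHoff hi)
      · subst hi
        exact hb _ (by simp)
    have e1 : ∫ y in Icc (a ∘ i.succAbove) (b ∘ i.succAbove),
        W i (WithLp.toLp 2 (i.insertNth (b i) y) : Space m) = 0 := by
      apply setIntegral_eq_zero_of_forall_eq_zero
      exact hface _ (Or.inl rfl)
    have e2 : ∫ y in Icc (a ∘ i.succAbove) (b ∘ i.succAbove),
        W i (WithLp.toLp 2 (i.insertNth (a i) y) : Space m) = 0 := by
      apply setIntegral_eq_zero_of_forall_eq_zero
      apply hface
      by_cases hi : i = Fin.last m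
      · right; right; simp [ha, hi]
      · right; left; simp [ha, hi]
    rw [e1, e2, sub_zero]
  set Q : Set (Space m) := WithLp.toLp 2 '' (pi univ fun i => Ioo (a i) (b i)) with hQ
  have hQsub : Q ⊆ openHalfSpace m := by
    rintro _ ⟨x, hx, rfl⟩; exact hIoo x hx
  have hQ0 : ∀ x ∈ openHalfSpace m \ Q, D x = 0 := by
    intro x hx
    apply hD0 x hx.1
    intro hxK
    apply hx.2
    refine ⟨WithLp.ofLp x, ?_, rfl⟩
    intro i _
    have h1 := hM x hxK
    have h2 := abs_le.1 (hcoord x i)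
    constructor
    · simp only [ha]; split_ifs with hi
      · rw [hi]; exact hx.1
      · linarith
    · simp only [hb']; linarith
  have hQm : MeasurableSet Q := hme.measurableSet_image.2
    (MeasurableSet.univ_pi fun i => measurableSet_Ioo)
  have hIooint : IntegrableOn (fun x : Fin (m + 1) → ℝ => D (WithLp.toLp 2 x))
      (pi univ fun i => Ioo (a i) (b i)) :=
    hint.congr_set_ae Measure.univ_pi_Ioo_ae_eq_Icc
  have hpre : (WithLp.toLp 2 : (Fin (m + 1) → ℝ) → Space m) ⁻¹' Q =
      pi univ fun i => Ioo (a i) (b i) := preimage_image_eq _ hme.injective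
  have hQint : IntegrableOn D Q := by
    rw [← hmp.integrableOn_comp_preimage hme, hpre]; exact hIooint
  refine ⟨?_, ?_⟩
  · exact hQint.of_forall_sdiff_eq_zero isOpen_openHalfSpace.measurableSet hQ0
  · rw [setIntegral_eq_of_subset_of_forall_sdiff_eq_zero isOpen_openHalfSpace.measurableSet hQsub hQ0,
      ← hmp.setIntegral_preimage_emb hme, hpre, ← hfaces]
    exact setIntegral_congr_set Measure.univ_pi_Ioo_ae_eq_Icc

/-- The divergence theorem in a half space, for a field that is `C¹` up to the flat boundary, has
compact support and is tangential to the boundary. -/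
theorem integral_divergence_halfSpace {O K : Set (Space m)} (hO : IsOpen O) (hK : IsCompact K)
    (hKO : K ⊆ O) (W : Fin (m + 1) → Space m → ℝ)
    (hW : ∀ i, ContDiffOn ℝ 1 (W i) (O ∩ halfSpace m))
    (h0 : ∀ i, ∀ x ∈ O, 0 < x (Fin.last m) → x ∉ K → W i x = 0)
    (hb : ∀ x ∈ O, x (Fin.last m) = 0 → W (Fin.last m) x = 0) :
    IntegrableOn (fun x => ∑ i, pd i (W i) x) (O ∩ openHalfSpace m) ∧
      ∫ x in O ∩ openHalfSpace m, ∑ i, pd i (W i) x = 0 := by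
  have key := integral_fderivWithin_halfSpace hK (fun i => O.indicator (W i))
    (fun i => contDiffOn_indicator_halfSpace hO hK.isClosed hKO (hW i) (h0 i))
    (by
      intro i x hx hxK
      by_cases hxO : x ∈ O
      · simp only [hxO, indicator_of_mem]
        exact eq_zero_of_interior hO hK.isClosed (hW i).continuousOn (h0 i) x ⟨hxO, hx⟩ hxK
      · simp [hxO])
    (by
      intro x hx
      by_cases hxO : x ∈ O
      · simp [hxO, hb x hxO hx]
      · simp [hxO])
  set D := fun x => ∑ i, fderivWithin ℝ (O.indicator (W i)) (halfSpace m) x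
    (EuclideanSpace.single i 1)
  have hmeas : MeasurableSet (O ∩ openHalfSpace m) :=
    (hO.inter isOpen_openHalfSpace).measurableSet
  have heq : EqOn (fun x => ∑ i, pd i (W i) x) D (O ∩ openHalfSpace m) := by
    intro x hx
    apply Finset.sum_congr rfl
    intro i _
    have hnh : halfSpace m ∈ nhds x :=
      Filter.mem_of_superset (isOpen_openHalfSpace.mem_nhds hx.2) openHalfSpace_subset
    rw [fderivWithin_of_mem_nhds hnh]
    apply pd_congr
    filter_upwards [hO.mem_nhds hx.1] with y hy
    simp [hy]
  have hz : ∀ x ∈ openHalfSpace m \ (O ∩ openHalfSpace m), D x = 0 := by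
    intro x hx
    have hxO : x ∉ O := fun h => hx.2 ⟨h, hx.1⟩
    apply Finset.sum_eq_zero
    intro i _
    have : O.indicator (W i) =ᶠ[nhdsWithin x (halfSpace m)] fun _ => 0 := by
      filter_upwards [nhdsWithin_le_nhds (hK.isClosed.isOpen_compl.mem_nhds
        fun h => hxO (hKO h)), self_mem_nhdsWithin] with y hy hyH
      by_cases hyO : y ∈ O
      · simp only [hyO, indicator_of_mem]
        exact eq_zero_of_interior hO hK.isClosed (hW i).continuousOn (h0 i) y ⟨hyO, hyH⟩ hy
      · simp [hyO]
    rw [this.fderivWithin_eq (by simp [hxO])]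
    simp
  refine ⟨(key.1.mono_set inter_subset_right).congr_fun heq.symm hmeas, ?_⟩
  rw [setIntegral_congr_fun hmeas heq,
    ← setIntegral_eq_of_subset_of_forall_sdiff_eq_zero isOpen_openHalfSpace.measurableSet
      inter_subset_right hz]
  exact key.2

theorem integrableOn_halfSpace {O K : Set (Space m)} (hO : IsOpen O) (hK : IsCompact K)
    (hKO : K ⊆ O) (hKH : K ⊆ halfSpace m) {f : Space m → ℝ}
    (hf : ContinuousOn f (O ∩ halfSpace m))
    (h0 : ∀ x ∈ O, 0 < x (Fin.last m) → x ∉ K → f x = 0) :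
    IntegrableOn f (O ∩ openHalfSpace m) := by
  have h1 : IntegrableOn f K :=
    (hf.mono (subset_inter hKO hKH)).integrableOn_compact hK
  have h2 := h1.mono_set (inter_subset_left (s := K) (t := O ∩ openHalfSpace m))
  have h3 : IntegrableOn f (O ∩ openHalfSpace m) :=
    (h1.of_forall_sdiff_eq_zero (t := K ∪ (O ∩ openHalfSpace m))
      (hK.measurableSet.union (hO.inter isOpen_openHalfSpace).measurableSet) (by
        rintro x ⟨hx | hx, hxK⟩
        · exact absurd hx hxK
        · exact h0 x hx.1 hx.2 hxK)).mono_set subset_union_right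
  exact h3

end Divergence

/-! ### The Rellich identity and the divergence of the corrected field. -/

section Identities

variable {m : ℕ}

/-- The derivative `X u` of a function along a vector field. -/
noncomputable def alongField (X : Fin (m + 1) → Space m → ℝ) (u : Space m → ℝ) (x : Space m) : ℝ :=
  ∑ k, X k x * pd k u x

/-- The Euclidean divergence of a vector field. -/
noncomputable def divField (X : Fin (m + 1) → Space m → ℝ) (x : Space m) : ℝ :=
  ∑ i, pd i (X i) x

/-- The flux field `a ∇u`. -/
noncomputable def fluxField (a : Fin (m + 1) → Fin (m + 1) → Space m → ℝ) (u : Space m → ℝ)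
    (i : Fin (m + 1)) (x : Space m) : ℝ :=
  ∑ j, a i j x * pd j u x

/-- The bilinear form `a(∇f, ∇u)`. -/
noncomputable def gradForm (a : Fin (m + 1) → Fin (m + 1) → Space m → ℝ) (f u : Space m → ℝ)
    (x : Space m) : ℝ :=
  ∑ i, pd i f x * fluxField a u i x

/-- The deformation form appearing in the Rellich identity for the field `X`. -/
noncomputable def deformation (a : Fin (m + 1) → Fin (m + 1) → Space m → ℝ)
    (X : Fin (m + 1) → Space m → ℝ) (j k : Fin (m + 1)) (x : Space m) : ℝ :=
  2 * ∑ i, a i j x * pd i (X k) x - alongField X (a j k) x - divField X x * a j k x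

/-- The Rellich field `2 (Xu) a∇u - a(∇u, ∇u) X`. -/
noncomputable def rellichField (a : Fin (m + 1) → Fin (m + 1) → Space m → ℝ)
    (X : Fin (m + 1) → Space m → ℝ) (u : Space m → ℝ) (i : Fin (m + 1)) (x : Space m) : ℝ :=
  2 * alongField X u x * fluxField a u i x - gradForm a u u x * X i x

theorem divField_smul {f : Space m → ℝ} {Y : Fin (m + 1) → Space m → ℝ} {x : Space m}
    (hf : DifferentiableAt ℝ f x) (hY : ∀ i, DifferentiableAt ℝ (Y i) x) :
    divField (fun i y => f y * Y i y) x = f x * divField Y x + ∑ i, pd i f x * Y i x := by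
  simp only [divField, Finset.mul_sum, ← Finset.sum_add_distrib]
  refine Finset.sum_congr rfl fun i _ => ?_
  rw [pd_mul hf (hY i)]; ring

theorem divField_add {Y Z : Fin (m + 1) → Space m → ℝ} {x : Space m}
    (hY : ∀ i, DifferentiableAt ℝ (Y i) x) (hZ : ∀ i, DifferentiableAt ℝ (Z i) x) :
    divField (fun i y => Y i y + Z i y) x = divField Y x + divField Z x := by
  simp only [divField, ← Finset.sum_add_distrib]
  exact Finset.sum_congr rfl fun i _ => pd_add (hY i) (hZ i)

theorem divField_sub {Y Z : Fin (m + 1) → Space m → ℝ} {x : Space m}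
    (hY : ∀ i, DifferentiableAt ℝ (Y i) x) (hZ : ∀ i, DifferentiableAt ℝ (Z i) x) :
    divField (fun i y => Y i y - Z i y) x = divField Y x - divField Z x := by
  simp only [divField, ← Finset.sum_sub_distrib]
  exact Finset.sum_congr rfl fun i _ => pd_sub (hY i) (hZ i)

theorem divField_normal (G : Space m → ℝ) (l : Fin (m + 1)) (x : Space m) :
    divField (fun i y => if i = l then G y else 0) x = pd l G x := by
  rw [divField, Finset.sum_eq_single l]
  · simp
  · intro i _ hi; simp [hi]
  · simp

section

variable {a : Fin (m + 1) → Fin (m + 1) → Space m → ℝ} {X : Fin (m + 1) → Space m → ℝ}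
  {u : Space m → ℝ} {x : Space m}

theorem differentiableAt_alongField (hX : ∀ i, DifferentiableAt ℝ (X i) x)
    (hu : ∀ i, DifferentiableAt ℝ (pd i u) x) : DifferentiableAt ℝ (alongField X u) x := by
  unfold alongField; fun_prop

theorem differentiableAt_fluxField (ha : ∀ i j, DifferentiableAt ℝ (a i j) x)
    (hu : ∀ i, DifferentiableAt ℝ (pd i u) x) (i : Fin (m + 1)) :
    DifferentiableAt ℝ (fluxField a u i) x := by
  unfold fluxField; fun_prop

theorem differentiableAt_gradForm {f : Space m → ℝ} (ha : ∀ i j, DifferentiableAt ℝ (a i j) x)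
    (hf : ∀ i, DifferentiableAt ℝ (pd i f) x)
    (hu : ∀ i, DifferentiableAt ℝ (pd i u) x) :
    DifferentiableAt ℝ (gradForm a f u) x := by
  have := differentiableAt_fluxField ha hu
  unfold gradForm; fun_prop

theorem pd_alongField (hX : ∀ i, DifferentiableAt ℝ (X i) x)
    (hu : ∀ i, DifferentiableAt ℝ (pd i u) x) (i : Fin (m + 1)) :
    pd i (alongField X u) x = ∑ k, (pd i (X k) x * pd k u x + X k x * pd i (pd k u) x) := by
  unfold alongField
  rw [pd_sum _ fun k _ => (hX k).fun_mul (hu k)]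
  exact Finset.sum_congr rfl fun k _ => pd_mul (hX k) (hu k)

theorem pd_gradForm (ha : ∀ i j, DifferentiableAt ℝ (a i j) x)
    (hu : ∀ i, DifferentiableAt ℝ (pd i u) x) (i : Fin (m + 1)) :
    pd i (gradForm a u u) x = ∑ k, ∑ l, (pd i (a k l) x * pd k u x * pd l u x
      + a k l x * pd i (pd k u) x * pd l u x + a k l x * pd k u x * pd i (pd l u) x) := by
  unfold gradForm
  rw [pd_sum _ fun k _ => (hu k).fun_mul (differentiableAt_fluxField ha hu k)]
  refine Finset.sum_congr rfl fun k _ => ?_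
  rw [pd_mul (hu k) (differentiableAt_fluxField ha hu k)]
  unfold fluxField
  rw [pd_sum _ fun l _ => (ha k l).fun_mul (hu l), Finset.mul_sum, Finset.mul_sum,
    ← Finset.sum_add_distrib]
  refine Finset.sum_congr rfl fun l _ => ?_
  rw [pd_mul (ha k l) (hu l)]; ring

/-- The field is chosen so that, apart from div(a∇u), the Hessian of u cancels: differentiating Xu
against the flux and differentiating a(∇u, ∇u) along X produce the same Hessian sum, by symmetry of
a and of the Hessian. What is left is quadratic in ∇u. -/
theorem divField_rellichField (ha : ∀ i j, DifferentiableAt ℝ (a i j) x)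
    (hsymm : ∀ i j, a i j x = a j i x) (hX : ∀ i, DifferentiableAt ℝ (X i) x)
    (hu : ContDiffAt ℝ 2 u x) (hu' : ∀ i, DifferentiableAt ℝ (pd i u) x) :
    divField (rellichField a X u) x = 2 * alongField X u x * divField (fluxField a u) x
      + ∑ j, ∑ k, deformation a X j k x * pd j u x * pd k u x := by
  have hfl := differentiableAt_fluxField ha hu'
  have hal := differentiableAt_alongField hX hu'
  have h1 : divField (rellichField a X u) x =
      divField (fun i y => (2 * alongField X u y) * fluxField a u i y) x
        - divField (fun i y => gradForm a u u y * X i y) x :=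
    divField_sub (fun i => (hal.const_mul 2).fun_mul (hfl i))
      (fun i => (differentiableAt_gradForm ha hu' hu').fun_mul (hX i))
  rw [h1, divField_smul (hal.const_mul 2) hfl, divField_smul (differentiableAt_gradForm ha hu' hu') hX]
  simp only [pd_const_mul 2 hal, pd_alongField hX hu', pd_gradForm ha hu']
  set H : Fin (m + 1) → Fin (m + 1) → ℝ := fun i j => pd i (pd j u) x with hH
  have hHs : ∀ i j, H i j = H j i := fun i j => pd_comm hu i j
  set U : Fin (m + 1) → ℝ := fun i => pd i u x with hU
  have e1 : ∑ i, 2 * (∑ k, (pd i (X k) x * pd k u x + X k x * pd i (pd k u) x))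
      * fluxField a u i x = (∑ j, ∑ k, 2 * (∑ i, a i j x * pd i (X k) x) * U j * U k)
        + ∑ i, ∑ k, ∑ l, 2 * (X i x * a k l x * H i k * U l) := by
    have c1 : (∑ j, ∑ k, 2 * (∑ i, a i j x * pd i (X k) x) * U j * U k) =
        ∑ i, ∑ k, ∑ j, 2 * (a i j x * pd i (X k) x * U j * U k) := by
      simp only [Finset.mul_sum, Finset.sum_mul]
      rw [Finset.sum_congr rfl fun j _ => Finset.sum_comm, Finset.sum_comm]
      refine Finset.sum_congr rfl fun i _ => ?_
      rw [Finset.sum_comm]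
      refine Finset.sum_congr rfl fun k _ => Finset.sum_congr rfl fun j _ => ?_
      ring
    have c2 : ∑ i, ∑ k, ∑ l, 2 * (X i x * a k l x * H i k * U l) =
        ∑ i, ∑ k, ∑ l, 2 * (X k x * a i l x * H i k * U l) := by
      rw [Finset.sum_comm]
      refine Finset.sum_congr rfl fun i _ => Finset.sum_congr rfl fun k _ =>
        Finset.sum_congr rfl fun l _ => ?_
      rw [hHs]
    rw [c1, c2, ← Finset.sum_add_distrib]
    refine Finset.sum_congr rfl fun i _ => ?_
    rw [← Finset.sum_add_distrib, Finset.mul_sum, Finset.sum_mul]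
    refine Finset.sum_congr rfl fun k _ => ?_
    rw [← Finset.sum_add_distrib, fluxField, Finset.mul_sum]
    refine Finset.sum_congr rfl fun l _ => ?_
    simp only [hH, hU]; ring
  -- The last triple sum is the one in `e1`, so the two cancel in the difference.
  have e2 : ∑ i, (∑ k, ∑ l, (pd i (a k l) x * pd k u x * pd l u x
      + a k l x * pd i (pd k u) x * pd l u x + a k l x * pd k u x * pd i (pd l u) x)) * X i x
      = (∑ j, ∑ k, alongField X (a j k) x * U j * U k)
        + ∑ i, ∑ k, ∑ l, 2 * (X i x * a k l x * H i k * U l) := by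
    have c1 : (∑ j, ∑ k, alongField X (a j k) x * U j * U k) =
        ∑ i, ∑ k, ∑ l, X i x * pd i (a k l) x * U k * U l := by
      simp only [alongField, Finset.sum_mul]
      rw [Finset.sum_congr rfl fun j _ => Finset.sum_comm, Finset.sum_comm]
    have c2 : ∑ i, ∑ k, ∑ l, 2 * (X i x * a k l x * H i k * U l) =
        (∑ i, ∑ k, ∑ l, (X i x * a k l x * H i k * U l)) +
        ∑ i, ∑ k, ∑ l, (X i x * a k l x * H i l * U k) := by
      simp only [← Finset.sum_add_distrib]
      have : ∀ i, ∑ k, ∑ l, (X i x * a k l x * H i l * U k) =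
          ∑ k, ∑ l, (X i x * a k l x * H i k * U l) := by
        intro i
        rw [Finset.sum_comm]
        refine Finset.sum_congr rfl fun k _ => Finset.sum_congr rfl fun l _ => ?_
        rw [hsymm]
      simp only [Finset.sum_add_distrib, this, ← Finset.mul_sum]
      ring
    rw [c1, c2]
    simp only [← Finset.sum_add_distrib]
    refine Finset.sum_congr rfl fun i _ => ?_
    rw [Finset.sum_mul]
    refine Finset.sum_congr rfl fun k _ => ?_
    rw [Finset.sum_mul]
    refine Finset.sum_congr rfl fun l _ => ?_
    simp only [hH, hU]; ring
  have e3 : gradForm a u u x * divField X x = ∑ j, ∑ k, divField X x * a j k x * U j * U k := by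
    rw [gradForm, Finset.sum_mul]
    refine Finset.sum_congr rfl fun j _ => ?_
    rw [fluxField, Finset.mul_sum, Finset.sum_mul]
    refine Finset.sum_congr rfl fun k _ => ?_
    simp only [hU]; ring
  have e4 : ∑ j, ∑ k, deformation a X j k x * pd j u x * pd k u x =
      (∑ j, ∑ k, 2 * (∑ i, a i j x * pd i (X k) x) * U j * U k)
      - (∑ j, ∑ k, alongField X (a j k) x * U j * U k)
      - ∑ j, ∑ k, divField X x * a j k x * U j * U k := by
    simp only [← Finset.sum_sub_distrib]
    refine Finset.sum_congr rfl fun j _ => Finset.sum_congr rfl fun k _ => ?_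
    simp only [deformation, hU]; ring
  rw [e1, e2, e3, e4]; ring

/-- The vector field whose divergence theorem yields the Carleman estimate; the last two terms
correct the flux through the flat boundary. -/
noncomputable def carlemanField (a : Fin (m + 1) → Fin (m + 1) → Space m → ℝ)
    (X : Fin (m + 1) → Space m → ℝ) (J u f₁ f₂ f₃ ζ η : Space m → ℝ) (i : Fin (m + 1))
    (x : Space m) : ℝ :=
  f₁ x * rellichField a X u i x + (f₂ x * u x ^ 2) * (J x * X i x)
    - (f₃ x * u x) * fluxField a u i x
    + (2 * (ζ x * u x * pd (Fin.last m) u x)) * X i x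
    + (if i = Fin.last m then η x * u x ^ 2 - 2 * (ζ x * u x * alongField X u x) else 0)

/-- The point is the ζ part: ∂ₙu X - Xu eₙ is antisymmetric in X and eₙ, so its products with ζu
lose both the second derivatives of u and the term ∂ₙu · Xu. Only terms with a factor u survive,
which makes the boundary correction of lower order. -/
theorem divField_carlemanField {J f₁ f₂ f₃ ζ η : Space m → ℝ}
    (ha : ∀ i j, DifferentiableAt ℝ (a i j) x)
    (hsymm : ∀ i j, a i j x = a j i x) (hX : ∀ i, DifferentiableAt ℝ (X i) x)
    (hu : ContDiffAt ℝ 2 u x) (hu' : ∀ i, DifferentiableAt ℝ (pd i u) x)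
    (hJ : DifferentiableAt ℝ J x) (hf₁ : DifferentiableAt ℝ f₁ x) (hf₂ : DifferentiableAt ℝ f₂ x)
    (hf₃ : DifferentiableAt ℝ f₃ x) (hζ : DifferentiableAt ℝ ζ x) (hη : DifferentiableAt ℝ η x) :
    divField (carlemanField a X J u f₁ f₂ f₃ ζ η) x =
      f₁ x * (2 * alongField X u x * divField (fluxField a u) x
        + ∑ j, ∑ k, deformation a X j k x * pd j u x * pd k u x)
      + (2 * alongField X u x * gradForm a f₁ u x - gradForm a u u x * alongField X f₁ x)
      + f₂ x * u x ^ 2 * divField (fun i y => J y * X i y) x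
      + J x * (alongField X f₂ x * u x ^ 2 + 2 * f₂ x * u x * alongField X u x)
      - (f₃ x * u x * divField (fluxField a u) x + f₃ x * gradForm a u u x
        + u x * gradForm a f₃ u x)
      + 2 * u x * (alongField X ζ x * pd (Fin.last m) u x - pd (Fin.last m) ζ x * alongField X u x
        + ζ x * (divField X x * pd (Fin.last m) u x
          - ∑ k, pd (Fin.last m) (X k) x * pd k u x))
      + (pd (Fin.last m) η x * u x ^ 2 + 2 * η x * u x * pd (Fin.last m) u x) := by
  have hu1 : DifferentiableAt ℝ u x := hu.differentiableAt (by simp)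
  have hfl := differentiableAt_fluxField ha hu'
  have hal := differentiableAt_alongField hX hu'
  have hgf := differentiableAt_gradForm ha hu' hu'
  have hre : ∀ i, DifferentiableAt ℝ (rellichField a X u i) x := fun i => by
    unfold rellichField; exact ((hal.const_mul 2).fun_mul (hfl i)).fun_sub (hgf.fun_mul (hX i))
  have hun := hu' (Fin.last m)
  have hsq : DifferentiableAt ℝ (fun y => u y ^ 2) x := hu1.pow 2
  have hlast : DifferentiableAt ℝ
      (fun y => η y * u y ^ 2 - 2 * (ζ y * u y * alongField X u y)) x := by fun_prop
  have hd1 : ∀ i, DifferentiableAt ℝ (fun y => f₁ y * rellichField a X u i y) x := fun i =>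
    hf₁.fun_mul (hre i)
  have hd2 : ∀ i, DifferentiableAt ℝ (fun y => (f₂ y * u y ^ 2) * (J y * X i y)) x := fun i => by
    fun_prop
  have hd3 : ∀ i, DifferentiableAt ℝ (fun y => (f₃ y * u y) * fluxField a u i y) x := fun i =>
    (hf₃.fun_mul hu1).fun_mul (hfl i)
  have hd4 : ∀ i, DifferentiableAt ℝ
      (fun y => (2 * (ζ y * u y * pd (Fin.last m) u y)) * X i y) x := fun i => by fun_prop
  have hd5 : ∀ i : Fin (m + 1), DifferentiableAt ℝ (fun y => if i = Fin.last m then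
      η y * u y ^ 2 - 2 * (ζ y * u y * alongField X u y) else 0) x := fun i => by
    split_ifs
    · exact hlast
    · fun_prop
  have s0 : divField (carlemanField a X J u f₁ f₂ f₃ ζ η) x =
      divField (fun i y => f₁ y * rellichField a X u i y) x
      + divField (fun i y => (f₂ y * u y ^ 2) * (J y * X i y)) x
      - divField (fun i y => (f₃ y * u y) * fluxField a u i y) x
      + divField (fun i y => (2 * (ζ y * u y * pd (Fin.last m) u y)) * X i y) x
      + pd (Fin.last m) (fun y => η y * u y ^ 2 - 2 * (ζ y * u y * alongField X u y)) x := by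
    rw [← divField_normal, ← divField_add hd1 hd2,
      ← divField_sub (fun i => (hd1 i).fun_add (hd2 i)) hd3,
      ← divField_add (fun i => ((hd1 i).fun_add (hd2 i)).fun_sub (hd3 i)) hd4,
      ← divField_add (fun i => (((hd1 i).fun_add (hd2 i)).fun_sub (hd3 i)).fun_add (hd4 i)) hd5]
    rfl
  have s1 : divField (fun i y => f₁ y * rellichField a X u i y) x =
      f₁ x * (2 * alongField X u x * divField (fluxField a u) x
        + ∑ j, ∑ k, deformation a X j k x * pd j u x * pd k u x)
      + (2 * alongField X u x * gradForm a f₁ u x - gradForm a u u x * alongField X f₁ x) := by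
    rw [divField_smul hf₁ hre, divField_rellichField ha hsymm hX hu hu']
    congr 1
    simp only [rellichField, gradForm, alongField, Finset.mul_sum, ← Finset.sum_sub_distrib]
    refine Finset.sum_congr rfl fun i _ => ?_
    ring
  have s2 : divField (fun i y => (f₂ y * u y ^ 2) * (J y * X i y)) x =
      f₂ x * u x ^ 2 * divField (fun i y => J y * X i y) x
      + J x * (alongField X f₂ x * u x ^ 2 + 2 * f₂ x * u x * alongField X u x) := by
    rw [divField_smul (hf₂.fun_mul hsq) (fun i => hJ.fun_mul (hX i))]
    congr 1
    simp only [alongField, Finset.mul_sum, Finset.sum_mul, ← Finset.sum_add_distrib]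
    refine Finset.sum_congr rfl fun i _ => ?_
    rw [pd_mul hf₂ hsq, pd_sq hu1]; ring
  have s3 : divField (fun i y => (f₃ y * u y) * fluxField a u i y) x =
      f₃ x * u x * divField (fluxField a u) x + f₃ x * gradForm a u u x
        + u x * gradForm a f₃ u x := by
    rw [divField_smul (hf₃.fun_mul hu1) hfl, add_assoc]
    congr 1
    simp only [gradForm, Finset.mul_sum, ← Finset.sum_add_distrib]
    refine Finset.sum_congr rfl fun i _ => ?_
    rw [pd_mul hf₃ hu1]; ring
  have s4 : divField (fun i y => (2 * (ζ y * u y * pd (Fin.last m) u y)) * X i y) x =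
      2 * (ζ x * u x * pd (Fin.last m) u x) * divField X x
      + 2 * (alongField X ζ x * u x * pd (Fin.last m) u x
        + ζ x * alongField X u x * pd (Fin.last m) u x
        + ζ x * u x * ∑ k, X k x * pd k (pd (Fin.last m) u) x) := by
    rw [divField_smul (((hζ.fun_mul hu1).fun_mul hun).const_mul 2) hX]
    congr 1
    simp only [alongField, Finset.mul_sum, Finset.sum_mul, ← Finset.sum_add_distrib]
    refine Finset.sum_congr rfl fun i _ => ?_
    rw [pd_const_mul 2 ((hζ.fun_mul hu1).fun_mul hun), pd_mul (hζ.fun_mul hu1) hun, pd_mul hζ hu1]; ring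
  have s5 : pd (Fin.last m) (fun y => η y * u y ^ 2 - 2 * (ζ y * u y * alongField X u y)) x =
      pd (Fin.last m) η x * u x ^ 2 + 2 * η x * u x * pd (Fin.last m) u x
      - 2 * (pd (Fin.last m) ζ x * u x * alongField X u x
        + ζ x * pd (Fin.last m) u x * alongField X u x
        + ζ x * u x * (∑ k, pd (Fin.last m) (X k) x * pd k u x
          + ∑ k, X k x * pd k (pd (Fin.last m) u) x)) := by
    rw [pd_sub (hη.fun_mul hsq) (((hζ.fun_mul hu1).fun_mul hal).const_mul 2), pd_mul hη hsq, pd_sq hu1,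
      pd_const_mul 2 ((hζ.fun_mul hu1).fun_mul hal), pd_mul (hζ.fun_mul hu1) hal, pd_mul hζ hu1,
      pd_alongField hX hu', Finset.sum_add_distrib]
    -- Commuting the derivatives makes the second order terms of `s4` and `s5` cancel.
    have : ∑ k, X k x * pd (Fin.last m) (pd k u) x = ∑ k, X k x * pd k (pd (Fin.last m) u) x :=
      Finset.sum_congr rfl fun k _ => by rw [pd_comm hu]
    rw [this]; ring
  rw [s0, s1, s2, s3, s4, s5]; ring

end

end Identities

/-! ### The pointwise quadratic inequality; ℓ stands for 1/τ², w for Xu, y for r²|∇u|² and ε for the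
geometric errors. -/

section Pointwise

set_option maxHeartbeats 1000000 in
/-- The pointwise quadratic inequality behind the Carleman estimate. -/
theorem carleman_quadratic_inequality
    {β ℓ ε n k P p P' s s' q d Xq e e' B XPB e₁ Λ u w y T Yb θ : ℝ}
    (hβ : 20 ≤ β) (hℓ0 : 0 < ℓ) (hℓ : ℓ ≤ 1 / 100) (hε0 : 0 ≤ ε) (hε : ε ≤ ℓ / 1000)
    (hk0 : 0 ≤ k) (hk : k ^ 2 ≤ β ^ 2 / 1000) (hkβ : k ≤ β)
    (hP1 : 3 / 4 * β ≤ P) (hP2 : P ≤ β) (hp : p = P - k)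
    (hP' : P' = -2 * β * ℓ) (hs : s = 3 * β * ℓ) (hs' : s' ^ 2 ≤ 36 * β ^ 2 * ℓ ^ 2)
    (hq : |1 - q| ≤ ε) (hnq : |(n - 2) * (1 - q)| ≤ ε) (hd : |d| ≤ ε) (hXq : |Xq| ≤ ε)
    (he : |e| ≤ β ^ 2 * ε) (he' : |e'| ≤ β ^ 2 * ε)
    (hB : B = (P ^ 2 - k ^ 2) * q + e)
    (hXPB : XPB = P' * q * B + P * (2 * P * (P' * q) * q + (P ^ 2 - k ^ 2) * Xq + e'))
    (he₁ : e₁ = P' * q + p * d) (hy : 0 ≤ y) (hT : |T| ≤ ε * y)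
    (hYb : |Yb| ≤ ε * (β ^ 3 * u ^ 2 + β * y)) (hθ0 : 0 ≤ θ) (hθ : θ ≤ 1) :
    2 * (Λ + B * u) * (2 * P * w - s * u) + 2 * s * B * u ^ 2 + 4 * P' * w ^ 2 + 2 * P * T
      + 2 * P * (2 - n) * (1 - q) * y - 2 * P' * q * y + 2 * XPB * u ^ 2 + 2 * P * B * d * u ^ 2
      - 2 * s * y - 2 * s' * u * w + Yb
      + 1 / 2 * β ^ 2 * θ * ((d - q) * u ^ 2 + 2 * u * w)
      + (β ^ 3 * ℓ * u ^ 2 + 1 / 2 * β * ℓ * y + 1 / 5 * β ^ 2 * θ * u ^ 2)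
      ≤ 2 * (Λ + 2 * P * w + (B + e₁) * u) ^ 2 := by
  have hβ0 : 0 < β := by linarith
  have hε' : ε ≤ 1 / 100000 := by linarith
  rw [abs_le] at hq hd hXq he he' hT hYb hnq
  have hP0 : 0 < P := by linarith
  have hβε : 0 ≤ β * ε := by positivity
  have hβℓ : 0 < β * ℓ := by positivity
  have hβ3 : 0 < β ^ 3 * ℓ := by positivity
  have hPP : P ^ 2 ≤ β ^ 2 := by gcongr
  have hPP1 : 9 / 16 * β ^ 2 ≤ P ^ 2 := by
    calc 9 / 16 * β ^ 2 = (3 / 4 * β) ^ 2 := by ring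
      _ ≤ P ^ 2 := by gcongr
  -- error term
  have h_e1 : e₁ ^ 2 ≤ β ^ 3 * ℓ / 100 := by
    have h1 : |e₁| ≤ 3 * β * ℓ := by
      have hpβ : |p| ≤ β := by rw [abs_le]; constructor <;> linarith
      have h2 : |p * d| ≤ β * ε := by
        rw [abs_mul]; exact mul_le_mul hpβ (abs_le.2 hd) (abs_nonneg _) hβ0.le
      have h3 : β * ε ≤ β * ℓ / 1000 := by
        have := mul_le_mul_of_nonneg_left hε hβ0.le; linarith
      have h4 : |P' * q| ≤ 2 * β * ℓ * (11 / 10) := by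
        rw [hP', abs_mul]
        apply mul_le_mul _ _ (abs_nonneg _) (by positivity)
        · rw [abs_le]; constructor <;> linarith
        · rw [abs_le]; constructor <;> linarith
      rw [he₁]
      calc |P' * q + p * d| ≤ |P' * q| + |p * d| := abs_add_le _ _
        _ ≤ _ := by linarith
    have h2 : e₁ ^ 2 ≤ (3 * β * ℓ) ^ 2 := by
      rw [← sq_abs e₁]; gcongr
    have h3 : (3 * β * ℓ) ^ 2 = β ^ 3 * ℓ * (9 * (ℓ / β)) := by field_simp; ring
    have h4 : ℓ / β ≤ 1 / 2000 := by
      rw [div_le_iff₀ hβ0]; linarith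
    have h5 := mul_le_mul_of_nonneg_left h4 hβ3.le
    linarith
  have h_s2 : s ^ 2 ≤ β ^ 3 * ℓ / 100 := by
    have h3 : s ^ 2 = β ^ 3 * ℓ * (9 * (ℓ / β)) := by rw [hs]; field_simp; ring
    have h4 : ℓ / β ≤ 1 / 2000 := by
      rw [div_le_iff₀ hβ0]; linarith
    have h5 := mul_le_mul_of_nonneg_left h4 hβ3.le
    linarith
  have h_s' : s' ^ 2 ≤ β ^ 2 * (β ^ 3 * ℓ / 1000) := by
    have h3 : 36 * β ^ 2 * ℓ ^ 2 = β ^ 2 * (36 * ℓ * ℓ) := by ring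
    have h4 : 36 * ℓ * ℓ ≤ β ^ 3 * ℓ / 1000 := by
      have : 8000 ≤ β ^ 3 := by
        calc (8000:ℝ) = 20 ^ 3 := by norm_num
          _ ≤ β ^ 3 := by gcongr
      have h5 := mul_le_mul_of_nonneg_right this hℓ0.le
      have h6 := mul_le_mul_of_nonneg_right hℓ hℓ0.le
      linarith
    have h5 := mul_le_mul_of_nonneg_left h4 (sq_nonneg β)
    linarith
  -- Young's inequality; the share of β²w² is paid later by 4P²w².
  have h_cross : -2 * s' * u * w ≤ 1 / 4 * β ^ 2 * w ^ 2 + β ^ 3 * ℓ / 200 * u ^ 2 := by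
    have h1 : 0 ≤ (β * w / 2 + 2 * (s' / β) * u) ^ 2 := sq_nonneg _
    have h2 : (β * w / 2 + 2 * (s' / β) * u) ^ 2 =
        1 / 4 * β ^ 2 * w ^ 2 + 2 * s' * u * w + 4 * (s' ^ 2 / β ^ 2) * u ^ 2 := by
      field_simp; ring
    have h3 : s' ^ 2 / β ^ 2 ≤ β ^ 3 * ℓ / 1000 := by
      rw [div_le_iff₀ (by positivity)]; linarith
    have h4 := mul_le_mul_of_nonneg_right h3 (sq_nonneg u)
    have h5 : 0 ≤ β ^ 3 * ℓ * u ^ 2 := by positivity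
    linarith
  -- coefficient of u ^ 2
  have hk2 : 0 ≤ k ^ 2 := sq_nonneg k
  have hβ2 : 0 < β ^ 2 := by positivity
  have hβ2ε : β ^ 2 * ε ≤ β ^ 2 / 100000 := by
    have := mul_le_mul_of_nonneg_left hε' hβ2.le; linarith
  have hP2q : |P ^ 2 * (1 - q)| ≤ β ^ 2 / 100000 := by
    rw [abs_mul, abs_of_nonneg (sq_nonneg P)]
    have : |1 - q| ≤ 1 / 100000 := (abs_le.2 hq).trans hε'
    calc P ^ 2 * |1 - q| ≤ β ^ 2 * (1 / 100000) := by gcongr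
      _ = _ := by ring
  have hk2q : |k ^ 2 * (1 - q)| ≤ β ^ 2 / 100000 := by
    rw [abs_mul, abs_of_nonneg hk2]
    have : |1 - q| ≤ 1 / 100000 := (abs_le.2 hq).trans hε'
    calc k ^ 2 * |1 - q| ≤ β ^ 2 * (1 / 100000) := by
          apply mul_le_mul _ this (abs_nonneg _) hβ2.le; linarith
      _ = _ := by ring
  rw [abs_le] at hP2q hk2q
  have hBe : B = P ^ 2 - P ^ 2 * (1 - q) - k ^ 2 + k ^ 2 * (1 - q) + e := by rw [hB]; ring
  have hB1 : P ^ 2 - β ^ 2 / 500 ≤ B := by rw [hBe]; linarith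
  have hB2 : B ≤ P ^ 2 + β ^ 2 / 500 := by rw [hBe]; linarith
  have hBabs : |B| ≤ 11 / 10 * β ^ 2 := by rw [abs_le]; constructor <;> linarith
  have h_err : |P * ((P ^ 2 - k ^ 2) * Xq + e')| ≤ β ^ 3 * ℓ / 400 := by
    have h1 : |(P ^ 2 - k ^ 2) * Xq| ≤ β ^ 2 * ε := by
      rw [abs_mul]
      apply mul_le_mul _ (abs_le.2 hXq) (abs_nonneg _) hβ2.le
      rw [abs_le]; constructor <;> linarith
    have h2 : |(P ^ 2 - k ^ 2) * Xq + e'| ≤ 2 * (β ^ 2 * ε) :=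
      (abs_add_le _ _).trans (by linarith [abs_le.2 he'])
    rw [abs_mul, abs_of_pos hP0]
    calc P * |(P ^ 2 - k ^ 2) * Xq + e'| ≤ β * (2 * (β ^ 2 * (ℓ / 1000))) := by
          apply mul_le_mul hP2 (h2.trans (by gcongr)) (abs_nonneg _) hβ0.le
      _ = β ^ 3 * ℓ / 500 := by ring
      _ ≤ _ := by linarith
  have h_PBd : |P * B * d| ≤ β ^ 3 * ℓ / 400 := by
    rw [abs_mul, abs_mul, abs_of_pos hP0]
    calc P * |B| * |d| ≤ β * (11 / 10 * β ^ 2) * (ℓ / 1000) := by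
          gcongr; exact (abs_le.2 hd).trans hε
      _ = 11 / 10000 * (β ^ 3 * ℓ) := by ring
      _ ≤ _ := by linarith
  rw [abs_le] at h_err h_PBd
  -- To leading order q = 1 and B = P², so the right side is (12 - 6)βℓP²: the 12 comes from -2(PB)'
  -- and the 6 is the price of the multiplier s. With P ≥ 3β/4 this is at least 27/8 β³ℓ, and 29/10
  -- leaves room for the errors.
  have h_main : 29 / 10 * β ^ 3 * ℓ ≤
      -2 * (P' * q * B + P * (2 * P * (P' * q) * q)) - 2 * s * B := by
    have e0 : -2 * (P' * q * B + P * (2 * P * (P' * q) * q)) - 2 * s * B =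
        β * ℓ * (8 * P ^ 2 * q ^ 2 - B * (6 - 4 * q)) := by rw [hP', hs]; ring
    have e2 : B * (6 - 4 * q) ≤ 21 / 10 * (P ^ 2 + β ^ 2 / 500) := by
      have hB0 : 0 ≤ B := by linarith
      calc B * (6 - 4 * q) ≤ B * (21 / 10) := by
            apply mul_le_mul_of_nonneg_left _ hB0; linarith
        _ ≤ _ := by linarith
    have e3 : 99 / 100 ≤ q ^ 2 := by
      have := sq_nonneg (1 - q)
      linarith only [this, hq, hε', show (1 - q) ^ 2 = 1 - 2 * q + q ^ 2 by ring]
    have e4 : 8 * P ^ 2 * (99 / 100) ≤ 8 * P ^ 2 * q ^ 2 := by gcongr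
    have e5 : 29 / 10 * β ^ 2 ≤ 8 * P ^ 2 * q ^ 2 - B * (6 - 4 * q) := by linarith
    rw [e0]
    calc 29 / 10 * β ^ 3 * ℓ = β * ℓ * (29 / 10 * β ^ 2) := by ring
      _ ≤ _ := by gcongr
  have h_u : 2 * β ^ 3 * ℓ ≤ -2 * XPB - 2 * s * B - 2 * (P * B * d) - s ^ 2 - 2 * e₁ ^ 2
      - β ^ 3 * ℓ / 200 - ε * β ^ 3 := by
    have h1 : ε * β ^ 3 ≤ β ^ 3 * ℓ / 1000 := by
      have : 0 < β ^ 3 := by positivity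
      have := mul_le_mul_of_nonneg_right hε this.le
      linarith
    have h2 : XPB = (P' * q * B + P * (2 * P * (P' * q) * q)) +
      P * ((P ^ 2 - k ^ 2) * Xq + e') := by rw [hXPB]; ring
    rw [h2]
    linarith
  have h_uu := mul_le_mul_of_nonneg_right h_u (sq_nonneg u)
  -- coefficient of y
  have h_y : β * ℓ * y ≤ (2 * s + 2 * P' * q) * y - 2 * P * T - 2 * P * (2 - n) * (1 - q) * y
      - ε * β * y := by
    have h1 : 2 * P * T ≤ 2 * β * ε * y := by
      have : P * T ≤ P * (ε * y) := mul_le_mul_of_nonneg_left hT.2 hP0.le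
      have : P * (ε * y) ≤ β * (ε * y) := by gcongr
      linarith
    have h2 : 2 * P * (2 - n) * (1 - q) * y ≤ 2 * β * ε * y := by
      have : P * (-((n - 2) * (1 - q))) ≤ P * ε := mul_le_mul_of_nonneg_left (by linarith) hP0.le
      have h3 : P * ε ≤ β * ε := by gcongr
      have h4 := mul_le_mul_of_nonneg_right (this.trans h3) hy
      linarith
    -- This is where s = 3βℓ outweighs P' = -2βℓ: the sum is βℓ(6 - 4q), close to 2βℓ.
    have h3 : 19 / 10 * β * ℓ ≤ 2 * s + 2 * P' * q := by
      have : 2 * s + 2 * P' * q = β * ℓ * (6 - 4 * q) := by rw [hs, hP']; ring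
      rw [this]
      have := mul_le_mul_of_nonneg_left (show 19 / 10 ≤ 6 - 4 * q by linarith) hβℓ.le
      linarith
    have h4 := mul_le_mul_of_nonneg_right h3 hy
    have h5 : β * ε * y ≤ β * ℓ / 1000 * y := by
      have : β * ε ≤ β * ℓ / 1000 := by
        have := mul_le_mul_of_nonneg_left hε hβ0.le
        linarith
      gcongr
    have h6 : 0 ≤ β * ℓ * y := by positivity
    linarith
  -- the weight with `θ`
  have h_θ : 1 / 2 * β ^ 2 * θ * ((d - q) * u ^ 2 + 2 * u * w) ≤
      β ^ 2 * w ^ 2 - 1 / 5 * β ^ 2 * θ * u ^ 2 := by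
    have h1 : (d - q) * u ^ 2 + 2 * u * w ≤ 2 * w ^ 2 - 2 / 5 * u ^ 2 := by
      have h0 : (d - q) * u ^ 2 ≤ -(9 / 10) * u ^ 2 := by
        apply mul_le_mul_of_nonneg_right _ (sq_nonneg u); linarith
      linarith [sq_nonneg (u - 2 * w)]
    have h2 : 0 ≤ 1 / 2 * β ^ 2 * θ := by positivity
    have h3 := mul_le_mul_of_nonneg_left h1 h2
    have h4 : β ^ 2 * θ * w ^ 2 ≤ β ^ 2 * w ^ 2 := by
      have : θ * w ^ 2 ≤ 1 * w ^ 2 := by gcongr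
      have := mul_le_mul_of_nonneg_left this hβ2.le
      linarith
    linarith
  have h_w : P' * w ^ 2 ≤ 0 := by
    have : P' ≤ 0 := by rw [hP']; linarith
    exact mul_nonpos_of_nonpos_of_nonneg this (sq_nonneg w)
  -- The budget for w²: of these 9/4, `h_cross` uses 1/4 and `h_θ` uses 1.
  have h_ww : 9 / 4 * β ^ 2 * w ^ 2 ≤ 4 * P ^ 2 * w ^ 2 := by
    have : 9 / 4 * β ^ 2 ≤ 4 * P ^ 2 := by linarith
    gcongr
  -- the square
  have h_G : (Λ + B * u + 2 * P * w) ^ 2 ≤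
      2 * (Λ + 2 * P * w + (B + e₁) * u) ^ 2 + 2 * e₁ ^ 2 * u ^ 2 := by
    linarith [sq_nonneg (Λ + B * u + 2 * P * w + 2 * e₁ * u)]
  -- The difference of the two sides is exactly (Λ + Bu + su)², so the multiplier costs only s²u².
  have h_N : 2 * (Λ + B * u) * (2 * P * w - s * u) + 4 * P ^ 2 * w ^ 2 - s ^ 2 * u ^ 2 ≤
      (Λ + B * u + 2 * P * w) ^ 2 := by
    linarith [sq_nonneg (Λ + B * u + s * u)]
  have h_bw : 0 ≤ β ^ 2 * w ^ 2 := by positivity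
  have h_bu : 0 ≤ β ^ 3 * ℓ * u ^ 2 := by positivity
  have h_by : 0 ≤ β * ℓ * y := by positivity
  linarith [hYb.2]

end Pointwise

/-! ### Quantitative geometry of a squared radius near the origin. -/

section Geometry

open Asymptotics Filter Topology

variable {m : ℕ}

/-- The radial field `½ g⁻¹∇σ` of a squared radius `σ`. -/
noncomputable def radialField (gi : Fin (m + 1) → Fin (m + 1) → Space m → ℝ) (σ : Space m → ℝ)
    (i : Fin (m + 1)) (x : Space m) : ℝ :=
  1 / 2 * fluxField gi σ i x

/-- The logarithm of the radius, `ln r = ½ ln σ`. -/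
noncomputable def logRadius (σ : Space m → ℝ) (x : Space m) : ℝ := 1 / 2 * Real.log (σ x)

/-- The squared length `|∇r|²` of the gradient of the radius. -/
noncomputable def radialSpeed (gi : Fin (m + 1) → Fin (m + 1) → Space m → ℝ) (σ : Space m → ℝ)
    (x : Space m) : ℝ :=
  alongField (radialField gi σ) σ x / (2 * σ x)

/-- The coefficients `det(g)^{1/2} g^{ij}` of the Laplacian in divergence form. -/
def densityCoeff (gi : Fin (m + 1) → Fin (m + 1) → Space m → ℝ) (J : Space m → ℝ)
    (i j : Fin (m + 1)) (x : Space m) : ℝ := J x * gi i j x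

/-- The quantitative data on the inverse metric `gi`, the volume density `J` and the squared radius
`σ` near the origin from which the Carleman estimate follows. -/
structure IsCarlemanGeometry (gi : Fin (m + 1) → Fin (m + 1) → Space m → ℝ) (J σ : Space m → ℝ)
    (δ K : ℝ) : Prop where
  one_le : 1 ≤ K
  smooth_gi : ∀ i j, ContDiffOn ℝ ∞ (gi i j) (Metric.ball 0 δ)
  smooth_J : ContDiffOn ℝ ∞ J (Metric.ball 0 δ)
  smooth_σ : ContDiffOn ℝ ∞ σ (Metric.ball 0 δ)
  symm : ∀ x ∈ Metric.ball 0 δ ∩ halfSpace m, ∀ i j, gi i j x = gi j i x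
  normal : ∀ x ∈ Metric.ball 0 δ ∩ halfSpace m, ∀ i,
    gi i (Fin.last m) x = if i = Fin.last m then 1 else 0
  σ_normal : ∀ x ∈ Metric.ball 0 δ, x (Fin.last m) = 0 → pd (Fin.last m) σ x = 0
  J_lower : ∀ x ∈ Metric.ball 0 δ, 1 / 2 ≤ J x
  J_upper : ∀ x ∈ Metric.ball 0 δ, J x ≤ K
  pd_J : ∀ x ∈ Metric.ball 0 δ, ∀ i, |pd i J x| ≤ K
  σ_pos : ∀ x ∈ Metric.ball 0 δ, x ≠ 0 → 0 < σ x
  elliptic : ∀ x ∈ Metric.ball 0 δ, ∀ ξ : Fin (m + 1) → ℝ,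
    1 / 2 * ∑ i, ξ i ^ 2 ≤ ∑ i, ∑ j, gi i j x * ξ i * ξ j
  pd_σ : ∀ x ∈ Metric.ball 0 δ, x ≠ 0 → ∀ i, |pd i σ x| ≤ K * √(σ x)
  field : ∀ x ∈ Metric.ball 0 δ, x ≠ 0 → ∀ i, |radialField gi σ i x| ≤ K * √(σ x)
  pd_field : ∀ x ∈ Metric.ball 0 δ, ∀ i j, |pd i (radialField gi σ j) x| ≤ K
  speed : ∀ x ∈ Metric.ball 0 δ, x ≠ 0 → |1 - radialSpeed gi σ x| ≤ K * √(σ x)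
  along_speed : ∀ x ∈ Metric.ball 0 δ, x ≠ 0 →
    |alongField (radialField gi σ) (radialSpeed gi σ) x| ≤ K * √(σ x)
  div_field : ∀ x ∈ Metric.ball 0 δ, x ≠ 0 →
    |divField (fun i y => J y * radialField gi σ i y) x - (m + 1) * J x| ≤ K * √(σ x)
  deform : ∀ x ∈ Metric.ball 0 δ, x ≠ 0 → ∀ ξ : Fin (m + 1) → ℝ,
    |∑ j, ∑ k, (deformation (densityCoeff gi J) (radialField gi σ) j k x
      - (1 - m) * densityCoeff gi J j k x) * ξ j * ξ k| ≤ K * √(σ x) * ∑ i, ξ i ^ 2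

theorem abs_coord_le (x : Space m) (i : Fin (m + 1)) : |x i| ≤ ‖x‖ := by
  simpa using PiLp.norm_apply_le x i

theorem norm_fderiv_le_sum_pd (f : Space m → ℝ) (x : Space m) :
    ‖fderiv ℝ f x‖ ≤ ∑ i, |pd i f x| := by
  refine ContinuousLinearMap.opNorm_le_bound _ (Finset.sum_nonneg fun _ _ => abs_nonneg _) fun v => ?_
  rw [fderiv_apply_eq_sum_pd, Finset.sum_mul]
  refine (norm_sum_le _ _).trans (Finset.sum_le_sum fun i _ => ?_)
  rw [norm_mul, mul_comm, Real.norm_eq_abs, Real.norm_eq_abs]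
  exact mul_le_mul_of_nonneg_left (abs_coord_le v i) (abs_nonneg _)

/-- A function vanishing at the origin whose first derivatives are `O(|x|^k)` is `O(|x|^{k+1})`. -/
theorem isBigO_of_pd {f : Space m → ℝ} {k : ℕ} (hf : ∀ᶠ x in 𝓝 (0 : Space m), DifferentiableAt ℝ f x)
    (h0 : f 0 = 0) (hpd : ∀ i, pd i f =O[𝓝 0] fun x => ‖x‖ ^ k) :
    f =O[𝓝 0] fun x => ‖x‖ ^ (k + 1) := by
  have h1 : (fun x => ∑ i, |pd i f x|) =O[𝓝 0] fun x : Space m => ‖x‖ ^ k :=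
    IsBigO.fun_sum fun i _ => (hpd i).abs_left
  obtain ⟨C, hC⟩ := h1.bound
  obtain ⟨ε, hε, hball⟩ := Metric.eventually_nhds_iff_ball.1 (hC.and hf)
  refine IsBigO.of_bound C ?_
  filter_upwards [Metric.ball_mem_nhds _ hε] with x hx
  have hsub : Metric.closedBall (0 : Space m) ‖x‖ ⊆ Metric.ball 0 ε :=
    Metric.closedBall_subset_ball (by simpa using hx)
  have hx0 : (0 : Space m) ∈ Metric.closedBall (0 : Space m) ‖x‖ := by simp
  have := (convex_closedBall (0 : Space m) ‖x‖).norm_image_sub_le_of_norm_fderiv_le (𝕜 := ℝ) (f := f)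
    (C := |C| * ‖x‖ ^ k) (fun y hy => (hball y (hsub hy)).2) (fun y hy => by
      have hy' : ‖y‖ ≤ ‖x‖ := by simpa using hy
      refine (norm_fderiv_le_sum_pd f y).trans ((le_abs_self _).trans ?_)
      have := (hball y (hsub hy)).1
      rw [Real.norm_eq_abs, Real.norm_eq_abs, abs_of_nonneg (by positivity : 0 ≤ ‖y‖ ^ k)] at this
      refine this.trans ?_
      calc C * ‖y‖ ^ k ≤ |C| * ‖y‖ ^ k := by gcongr; exact le_abs_self C
        _ ≤ _ := by gcongr) hx0 (y := x) (by simp)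
  have hC0 : 0 ≤ C ∨ ‖x‖ = 0 := by
    by_contra! h
    have h2 := (hball x hx).1
    rw [Real.norm_eq_abs, Real.norm_eq_abs, abs_of_nonneg (by positivity : 0 ≤ ‖x‖ ^ k)] at h2
    have h3 := abs_nonneg (∑ i, |pd i f x|)
    have h4 : 0 < ‖x‖ ^ k := pow_pos (lt_of_le_of_ne (norm_nonneg _) (Ne.symm h.2)) _
    nlinarith [h.1]
  rw [h0, sub_zero, sub_zero] at this
  rw [norm_pow, norm_norm, pow_succ, ← mul_assoc]
  rcases hC0 with h | h
  · rwa [abs_of_nonneg h] at this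
  · rw [h] at this ⊢; simpa using this

theorem isBigO_norm_of_differentiableAt {f : Space m → ℝ} (hf : DifferentiableAt ℝ f 0)
    (h0 : f 0 = 0) : f =O[𝓝 0] fun x => ‖x‖ ^ 1 := by
  have := hf.isBigO_sub
  simp only [h0, sub_zero] at this
  simpa using this.norm_right

theorem sum_sq_nonneg (ξ : Fin (m + 1) → ℝ) : 0 ≤ ∑ i, ξ i ^ 2 :=
  Finset.sum_nonneg fun _ _ => sq_nonneg _

theorem sq_le_sum_sq (ξ : Fin (m + 1) → ℝ) (i : Fin (m + 1)) : ξ i ^ 2 ≤ ∑ i, ξ i ^ 2 :=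
  Finset.single_le_sum (f := fun i => ξ i ^ 2) (fun _ _ => sq_nonneg _) (Finset.mem_univ i)

theorem abs_quadratic_le (c : Fin (m + 1) → Fin (m + 1) → ℝ) (ξ : Fin (m + 1) → ℝ) :
    |∑ i, ∑ j, c i j * ξ i * ξ j| ≤ (∑ i, ∑ j, |c i j|) * ∑ i, ξ i ^ 2 := by
  rw [Finset.sum_mul]
  refine (Finset.abs_sum_le_sum_abs _ _).trans (Finset.sum_le_sum fun i _ => ?_)
  rw [Finset.sum_mul]
  refine (Finset.abs_sum_le_sum_abs _ _).trans (Finset.sum_le_sum fun j _ => ?_)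
  rw [mul_assoc, abs_mul]
  refine mul_le_mul_of_nonneg_left ?_ (abs_nonneg _)
  have h1 := sq_le_sum_sq ξ i
  have h2 := sq_le_sum_sq ξ j
  rw [abs_le]
  constructor <;> nlinarith [sq_nonneg (ξ i + ξ j), sq_nonneg (ξ i - ξ j)]

/-- The Taylor expansion at the origin of a squared radius. -/
structure IsSquaredRadius (R : ℝ) (σ : Space m → ℝ) : Prop where
  smooth : ContDiffOn ℝ ∞ σ (Metric.ball 0 R)
  zero : σ 0 = 0
  pd_zero : ∀ i, pd i σ 0 = 0
  hessian_zero : ∀ i j, pd i (pd j σ) 0 = if i = j then 2 else 0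
  normal : ∀ x ∈ chart m R, x (Fin.last m) = 0 → pd (Fin.last m) σ x = 0

/-- Every constant above a threshold is admitted, so that finitely many estimates can later share
one constant. -/
theorem exists_bound_of_isBigO {ι : Type*} [Finite ι] {f : ι → Space m → ℝ} {g : Space m → ℝ}
    {l : Filter (Space m)} (h : ∀ i, f i =O[l] g) :
    ∃ K₀ : ℝ, ∀ K ≥ K₀, ∀ᶠ x in l, ∀ i, |f i x| ≤ K * |g x| := by
  cases nonempty_fintype ι
  choose c hc using fun i => (h i).bound
  refine ⟨∑ i, |c i|, fun K hK => ?_⟩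
  rw [eventually_all]
  intro i
  filter_upwards [hc i] with x hx
  refine (hx.trans ?_)
  rw [Real.norm_eq_abs]
  have h1 : |c i| ≤ ∑ i, |c i| :=
    Finset.single_le_sum (f := fun i => |c i|) (fun _ _ => abs_nonneg _) (Finset.mem_univ i)
  gcongr
  exact (le_abs_self _).trans (h1.trans hK)

end Geometry

/-! ### Taylor estimates for the radial field and its defect. -/

section GeometryExistence

open Asymptotics Filter Topology

variable {m : ℕ}

theorem isBigO_pow_mono {f : Space m → ℝ} {j k : ℕ} (hjk : j ≤ k)
    (h : f =O[𝓝 0] fun x => ‖x‖ ^ k) : f =O[𝓝 0] fun x => ‖x‖ ^ j := by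
  refine h.trans (IsBigO.of_bound 1 ?_)
  filter_upwards [Metric.ball_mem_nhds (0 : Space m) one_pos] with x hx
  have hx' : ‖x‖ < 1 := by simpa using hx
  rw [norm_pow, norm_pow, norm_norm, one_mul]
  exact pow_le_pow_of_le_one (norm_nonneg _) hx'.le hjk

theorem isBigO_pow_mul {f g : Space m → ℝ} {j k : ℕ} (hf : f =O[𝓝 0] fun x => ‖x‖ ^ j)
    (hg : g =O[𝓝 0] fun x => ‖x‖ ^ k) : (fun x => f x * g x) =O[𝓝 0] fun x => ‖x‖ ^ (j + k) := by
  simpa only [pow_add] using hf.mul hg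

theorem isBigO_coord (i : Fin (m + 1)) : (fun x : Space m => x i) =O[𝓝 0] fun x => ‖x‖ ^ 1 := by
  refine IsBigO.of_bound 1 (Eventually.of_forall fun x => ?_)
  simpa using abs_coord_le x i

theorem isBigO_one_of_continuousAt {f : Space m → ℝ} (hf : ContinuousAt f 0) :
    f =O[𝓝 0] fun x => ‖x‖ ^ 0 := by
  simpa using hf.isBigO_one ℝ

section

variable {gi : Fin (m + 1) → Fin (m + 1) → Space m → ℝ} {J σ : Space m → ℝ} {δ : ℝ}

theorem contDiffOn_fluxField {U : Set (Space m)} (hU : IsOpen U)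
    (hgi : ∀ i j, ContDiffOn ℝ ∞ (gi i j) U) (hσ : ContDiffOn ℝ ∞ σ U) (i : Fin (m + 1)) :
    ContDiffOn ℝ ∞ (fluxField gi σ i) U := by
  unfold fluxField
  exact ContDiffOn.sum fun j _ => (hgi i j).mul (contDiffOn_pd hσ hU j)

theorem contDiffOn_radialField {U : Set (Space m)} (hU : IsOpen U)
    (hgi : ∀ i j, ContDiffOn ℝ ∞ (gi i j) U) (hσ : ContDiffOn ℝ ∞ σ U) (i : Fin (m + 1)) :
    ContDiffOn ℝ ∞ (radialField gi σ i) U :=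
  contDiffOn_const.mul (contDiffOn_fluxField hU hgi hσ i)

theorem contDiffOn_alongField {U : Set (Space m)} (hU : IsOpen U)
    {X : Fin (m + 1) → Space m → ℝ} (hX : ∀ i, ContDiffOn ℝ ∞ (X i) U)
    (hσ : ContDiffOn ℝ ∞ σ U) : ContDiffOn ℝ ∞ (alongField X σ) U := by
  unfold alongField
  exact ContDiffOn.sum fun j _ => (hX j).mul (contDiffOn_pd hσ hU j)

theorem contDiffOn_divField {U : Set (Space m)} (hU : IsOpen U)
    {X : Fin (m + 1) → Space m → ℝ} (hX : ∀ i, ContDiffOn ℝ ∞ (X i) U) :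
    ContDiffOn ℝ ∞ (divField X) U := by
  unfold divField
  exact ContDiffOn.sum fun j _ => contDiffOn_pd (hX j) hU j

theorem contDiffOn_deformation {U : Set (Space m)} (hU : IsOpen U)
    {a : Fin (m + 1) → Fin (m + 1) → Space m → ℝ} (ha : ∀ i j, ContDiffOn ℝ ∞ (a i j) U)
    {X : Fin (m + 1) → Space m → ℝ} (hX : ∀ i, ContDiffOn ℝ ∞ (X i) U) (j k : Fin (m + 1)) :
    ContDiffOn ℝ ∞ (deformation a X j k) U := by
  unfold deformation
  exact ((contDiffOn_const.mul (ContDiffOn.sum fun i _ => (ha i j).mul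
    (contDiffOn_pd (hX k) hU i))).sub (contDiffOn_alongField hU hX (ha j k))).sub
    ((contDiffOn_divField hU hX).mul (ha j k))

theorem differentiableAt_of_contDiffOn {f : Space m → ℝ} {U : Set (Space m)} {x : Space m}
    (hU : IsOpen U) (hf : ContDiffOn ℝ ∞ f U) (hx : x ∈ U) : DifferentiableAt ℝ f x :=
  (hf.contDiffAt (hU.mem_nhds hx)).differentiableAt (by simp)

variable (hδ : 0 < δ) (hgi : ∀ i j, ContDiffOn ℝ ∞ (gi i j) (Metric.ball 0 δ))
  (hgi0 : ∀ i j, gi i j 0 = if i = j then 1 else 0) (hσ : IsSquaredRadius δ σ)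

include hσ in
theorem radialField_zero (i : Fin (m + 1)) : radialField gi σ i 0 = 0 := by
  simp [radialField, fluxField, hσ.pd_zero]

include hδ hgi hgi0 hσ in
theorem pd_radialField_zero (i j : Fin (m + 1)) :
    pd i (radialField gi σ j) 0 = if i = j then 1 else 0 := by
  have h0 : (0 : Space m) ∈ Metric.ball (0 : Space m) δ := Metric.mem_ball_self hδ
  have hg := fun i j => differentiableAt_of_contDiffOn Metric.isOpen_ball (hgi i j) h0
  have hs := fun i => differentiableAt_of_contDiffOn Metric.isOpen_ball
    (contDiffOn_pd hσ.smooth Metric.isOpen_ball i) h0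
  have e1 : pd i (radialField gi σ j) 0 = 1 / 2 * pd i (fluxField gi σ j) 0 :=
    pd_const_mul _ (differentiableAt_fluxField hg hs j)
  have e2 : pd i (fluxField gi σ j) 0 = ∑ k, (pd i (gi j k) 0 * pd k σ 0
      + gi j k 0 * pd i (pd k σ) 0) := by
    unfold fluxField
    rw [pd_sum _ fun k _ => (hg j k).fun_mul (hs k)]
    exact Finset.sum_congr rfl fun k _ => pd_mul (hg j k) (hs k)
  rw [e1, e2]
  simp only [hσ.pd_zero, hσ.hessian_zero, hgi0, mul_zero, zero_add]
  simp [eq_comm]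

include hδ hgi hgi0 hσ in
theorem isBigO_pd_radialField_sub (i j : Fin (m + 1)) :
    (fun x => pd i (radialField gi σ j) x - if i = j then 1 else 0) =O[𝓝 0]
      fun x => ‖x‖ ^ 1 := by
  have h0 : (0 : Space m) ∈ Metric.ball (0 : Space m) δ := Metric.mem_ball_self hδ
  refine isBigO_norm_of_differentiableAt ?_ ?_
  · exact (differentiableAt_of_contDiffOn Metric.isOpen_ball (contDiffOn_pd
      (contDiffOn_radialField Metric.isOpen_ball hgi hσ.smooth j) Metric.isOpen_ball i) h0).sub_const _
  · rw [pd_radialField_zero hδ hgi hgi0 hσ, sub_self]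

theorem eventually_differentiableAt {f : Space m → ℝ} (hδ : 0 < δ)
    (hf : ContDiffOn ℝ ∞ f (Metric.ball 0 δ)) : ∀ᶠ x in 𝓝 (0 : Space m), DifferentiableAt ℝ f x := by
  filter_upwards [Metric.ball_mem_nhds (0 : Space m) hδ] with x hx
  exact differentiableAt_of_contDiffOn Metric.isOpen_ball hf hx

include hδ hgi hgi0 hσ in
theorem isBigO_radialField_sub (i : Fin (m + 1)) :
    (fun x => radialField gi σ i x - x i) =O[𝓝 0] fun x => ‖x‖ ^ 2 := by
  have hX := contDiffOn_radialField Metric.isOpen_ball hgi hσ.smooth i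
  refine isBigO_of_pd (k := 1) ?_ (by simp [radialField_zero hσ]) fun j => ?_
  · filter_upwards [eventually_differentiableAt hδ hX] with x hx
    exact hx.fun_sub (by fun_prop)
  · refine EventuallyEq.trans_isBigO ?_ (isBigO_pd_radialField_sub hδ hgi hgi0 hσ j i)
    filter_upwards [eventually_differentiableAt hδ hX] with x hx
    rw [pd_sub hx (by fun_prop), pd_coord]

include hδ hσ in
theorem isBigO_hessian_sub (i j : Fin (m + 1)) :
    (fun x => pd i (pd j σ) x - if i = j then 2 else 0) =O[𝓝 0] fun x => ‖x‖ ^ 1 := by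
  have h0 : (0 : Space m) ∈ Metric.ball (0 : Space m) δ := Metric.mem_ball_self hδ
  refine isBigO_norm_of_differentiableAt ?_ ?_
  · exact (differentiableAt_of_contDiffOn Metric.isOpen_ball (contDiffOn_pd
      (contDiffOn_pd hσ.smooth Metric.isOpen_ball j) Metric.isOpen_ball i) h0).sub_const _
  · rw [hσ.hessian_zero, sub_self]

include hδ hσ in
theorem isBigO_pd_sub (i : Fin (m + 1)) :
    (fun x => pd i σ x - 2 * x i) =O[𝓝 0] fun x => ‖x‖ ^ 2 := by
  have hX := contDiffOn_pd hσ.smooth Metric.isOpen_ball i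
  refine isBigO_of_pd (k := 1) ?_ (by simp [hσ.pd_zero]) fun j => ?_
  · filter_upwards [eventually_differentiableAt hδ hX] with x hx
    exact hx.fun_sub (by fun_prop)
  · refine EventuallyEq.trans_isBigO ?_ (isBigO_hessian_sub hδ hσ j i)
    filter_upwards [eventually_differentiableAt hδ hX] with x hx
    rw [pd_sub hx (by fun_prop), pd_const_mul _ (by fun_prop), pd_coord]
    split_ifs <;> simp

theorem norm_sq_eq_sum (x : Space m) : ‖x‖ ^ 2 = ∑ i, x i ^ 2 := by
  rw [EuclideanSpace.norm_sq_eq]; simp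

theorem pd_norm_sq (i : Fin (m + 1)) (x : Space m) : pd i (fun y => ‖y‖ ^ 2) x = 2 * x i := by
  simp only [norm_sq_eq_sum]
  rw [pd_sum _ fun k _ => by fun_prop, Finset.sum_eq_single i]
  · rw [pd_sq (by fun_prop), pd_coord]; simp
  · intro k _ hk
    rw [pd_sq (by fun_prop), pd_coord]; simp [Ne.symm hk]
  · simp

include hδ hσ in
theorem isBigO_sub_norm_sq : (fun x => σ x - ‖x‖ ^ 2) =O[𝓝 0] fun x => ‖x‖ ^ 3 := by
  refine isBigO_of_pd (k := 2) ?_ (by simp [hσ.zero]) fun j => ?_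
  · filter_upwards [eventually_differentiableAt hδ hσ.smooth] with x hx
    exact hx.fun_sub ((contDiff_norm_sq ℝ).differentiable (n := ∞) (by simp)).differentiableAt
  · refine EventuallyEq.trans_isBigO ?_ (isBigO_pd_sub hδ hσ j)
    filter_upwards [eventually_differentiableAt hδ hσ.smooth] with x hx
    rw [pd_sub hx ((contDiff_norm_sq ℝ).differentiable (n := ∞) (by simp)).differentiableAt,
      pd_norm_sq]

/-- The defect `Xσ - 2σ`, which vanishes to third order at the origin. -/
noncomputable def radialDefect (gi : Fin (m + 1) → Fin (m + 1) → Space m → ℝ) (σ : Space m → ℝ)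
    (x : Space m) : ℝ :=
  alongField (radialField gi σ) σ x - 2 * σ x

include hδ hgi hgi0 hσ in
-- In the Euclidean model X is the dilation field and Xσ = 2σ by homogeneity. Subtracting the model
-- values of X, ∂X, ∂σ and ∂²σ one at a time leaves products in which one factor is a difference,
-- and each product is O(|x|²). This derivative bound gives both q - 1 = O(r) and Xq = O(r).
theorem isBigO_pd_radialDefect (i : Fin (m + 1)) :
    pd i (radialDefect gi σ) =O[𝓝 0] fun x => ‖x‖ ^ 2 := by
  have hX := contDiffOn_radialField Metric.isOpen_ball hgi hσ.smooth
  have hs := fun j => contDiffOn_pd hσ.smooth Metric.isOpen_ball j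
  have key : pd i (radialDefect gi σ) =ᶠ[𝓝 0] fun x =>
      (∑ k, ((pd i (radialField gi σ k) x - if i = k then 1 else 0) * pd k σ x
        + ((radialField gi σ k x - x k) * pd i (pd k σ) x
        + x k * (pd i (pd k σ) x - if i = k then 2 else 0)))) - (pd i σ x - 2 * x i) := by
    filter_upwards [Metric.ball_mem_nhds (0 : Space m) hδ] with x hx
    have dX := fun k => differentiableAt_of_contDiffOn Metric.isOpen_ball (hX k) hx
    have ds := fun k => differentiableAt_of_contDiffOn Metric.isOpen_ball (hs k) hx
    have dσ := differentiableAt_of_contDiffOn Metric.isOpen_ball hσ.smooth hx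
    unfold radialDefect
    rw [pd_sub (differentiableAt_alongField dX ds) (dσ.const_mul 2), pd_const_mul 2 dσ,
      pd_alongField dX ds]
    have : ∀ k, (pd i (radialField gi σ k) x - if i = k then 1 else 0) * pd k σ x
        + ((radialField gi σ k x - x k) * pd i (pd k σ) x
        + x k * (pd i (pd k σ) x - if i = k then 2 else 0)) =
        (pd i (radialField gi σ k) x * pd k σ x + radialField gi σ k x * pd i (pd k σ) x)
        - (if i = k then pd k σ x + 2 * x k else 0) := by
      intro k; split_ifs <;> ring
    simp only [this, Finset.sum_sub_distrib, Finset.sum_ite_eq, Finset.mem_univ, if_true]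
    ring
  refine key.trans_isBigO (IsBigO.sub (IsBigO.fun_sum fun k _ => ?_) (isBigO_pd_sub hδ hσ i))
  have hb1 : pd k σ =O[𝓝 0] fun x : Space m => ‖x‖ ^ 1 := by
    have := (isBigO_pow_mono one_le_two (isBigO_pd_sub hδ hσ k)).add
      ((isBigO_coord k).const_mul_left 2)
    simpa using this
  have hb2 : pd i (pd k σ) =O[𝓝 0] fun x : Space m => ‖x‖ ^ 0 :=
    isBigO_one_of_continuousAt (((contDiffOn_pd (hs k) Metric.isOpen_ball i).continuousOn).continuousAt
      (Metric.ball_mem_nhds _ hδ))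
  have e1 := isBigO_pow_mul (isBigO_pd_radialField_sub hδ hgi hgi0 hσ i k) hb1
  have e2 := isBigO_pow_mul (isBigO_radialField_sub hδ hgi hgi0 hσ k) hb2
  have e3 := isBigO_pow_mul (isBigO_coord k) (isBigO_hessian_sub hδ hσ i k)
  exact e1.add (e2.add e3)

include hδ hgi hgi0 hσ in
theorem isBigO_radialDefect : radialDefect gi σ =O[𝓝 0] fun x => ‖x‖ ^ 3 := by
  have hX := contDiffOn_radialField Metric.isOpen_ball hgi hσ.smooth
  refine isBigO_of_pd (k := 2) ?_ ?_ (isBigO_pd_radialDefect hδ hgi hgi0 hσ)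
  · exact eventually_differentiableAt hδ
      ((contDiffOn_alongField Metric.isOpen_ball hX hσ.smooth).sub (contDiffOn_const.mul hσ.smooth))
  · simp [radialDefect, alongField, hσ.pd_zero, hσ.zero]

end

end GeometryExistence

/-! ### One neighbourhood and one constant for all the geometric errors. -/

section GeometryConstants

open Asymptotics Filter Topology

variable {m : ℕ}

/-- Each bounded quantity is smooth, or a smooth function divided by σ, and takes the Euclidean
value at the origin, so Taylor's formula makes the difference O(|x|). Since σ is comparable to |x|²,
the errors can be measured by √σ. -/
theorem exists_carlemanGeometry {gi : Fin (m + 1) → Fin (m + 1) → Space m → ℝ}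
    {J σ : Space m → ℝ} {δ : ℝ} (hδ : 0 < δ)
    (hgi : ∀ i j, ContDiffOn ℝ ∞ (gi i j) (Metric.ball 0 δ))
    (hgi0 : ∀ i j, gi i j 0 = if i = j then 1 else 0) (hσ : IsSquaredRadius δ σ)
    (hJ : ContDiffOn ℝ ∞ J (Metric.ball 0 δ)) (hJ0 : J 0 = 1)
    (hsymm : ∀ x ∈ Metric.ball 0 δ ∩ halfSpace m, ∀ i j, gi i j x = gi j i x)
    (hnormal : ∀ x ∈ Metric.ball 0 δ ∩ halfSpace m, ∀ i,
      gi i (Fin.last m) x = if i = Fin.last m then 1 else 0) :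
    ∃ δ' K, 0 < δ' ∧ δ' ≤ δ ∧ IsCarlemanGeometry gi J σ δ' K := by
  have hX := contDiffOn_radialField Metric.isOpen_ball hgi hσ.smooth
  set X := radialField gi σ with hXdef
  set a := densityCoeff gi J with hadef
  have ha : ∀ i j, ContDiffOn ℝ ∞ (a i j) (Metric.ball 0 δ) := fun i j => hJ.mul (hgi i j)
  have h0 : (0 : Space m) ∈ Metric.ball (0 : Space m) δ := Metric.mem_ball_self hδ
  have hnh : Metric.ball (0 : Space m) δ ∈ 𝓝 0 := Metric.ball_mem_nhds _ hδ
  have hcont : ∀ {f : Space m → ℝ}, ContDiffOn ℝ ∞ f (Metric.ball 0 δ) → ContinuousAt f 0 :=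
    fun hf => hf.continuousOn.continuousAt hnh
  have hdiff : ∀ {f : Space m → ℝ}, ContDiffOn ℝ ∞ f (Metric.ball 0 δ) → DifferentiableAt ℝ f 0 :=
    fun hf => differentiableAt_of_contDiffOn Metric.isOpen_ball hf h0
  have hX0 : ∀ i, X i 0 = 0 := radialField_zero hσ
  have hdX0 := pd_radialField_zero hδ hgi hgi0 hσ
  have hdivX0 : divField X 0 = m + 1 := by simp [divField, hXdef, hdX0]
  -- the individual asymptotics
  have b_gi : (fun x => ∑ i, ∑ j, |gi i j x - if i = j then 1 else 0|) =O[𝓝 0]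
      fun x : Space m => ‖x‖ ^ 1 :=
    IsBigO.fun_sum fun i _ => IsBigO.fun_sum fun j _ =>
      (isBigO_norm_of_differentiableAt ((hdiff (hgi i j)).sub_const _) (by simp [hgi0])).abs_left
  have b_J : (fun x => J x - 1) =O[𝓝 0] fun x : Space m => ‖x‖ ^ 1 :=
    isBigO_norm_of_differentiableAt ((hdiff hJ).sub_const _) (by simp [hJ0])
  have b_dJ : ∀ i, pd i J =O[𝓝 0] fun x : Space m => ‖x‖ ^ 0 := fun i =>
    isBigO_one_of_continuousAt (hcont (contDiffOn_pd hJ Metric.isOpen_ball i))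
  have b_σ := isBigO_sub_norm_sq hδ hσ
  have b_dσ : ∀ i, pd i σ =O[𝓝 0] fun x : Space m => ‖x‖ ^ 1 := fun i => by
    simpa using (isBigO_pow_mono one_le_two (isBigO_pd_sub hδ hσ i)).add
      ((isBigO_coord i).const_mul_left 2)
  have b_X : ∀ i, X i =O[𝓝 0] fun x : Space m => ‖x‖ ^ 1 := fun i =>
    isBigO_norm_of_differentiableAt (hdiff (hX i)) (hX0 i)
  have b_dX : ∀ p : Fin (m + 1) × Fin (m + 1), pd p.1 (X p.2) =O[𝓝 0]
      fun x : Space m => ‖x‖ ^ 0 := fun p =>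
    isBigO_one_of_continuousAt (hcont (contDiffOn_pd (hX p.2) Metric.isOpen_ball p.1))
  have b_y := isBigO_radialDefect hδ hgi hgi0 hσ
  have b_Xy : alongField X (radialDefect gi σ) =O[𝓝 0] fun x : Space m => ‖x‖ ^ 3 := by
    unfold alongField
    refine IsBigO.fun_sum fun i _ => ?_
    have := isBigO_pow_mul (b_X i) (isBigO_pd_radialDefect hδ hgi hgi0 hσ i)
    exact this
  have b_Xσ : alongField X σ =O[𝓝 0] fun x : Space m => ‖x‖ ^ 2 := by
    unfold alongField
    exact IsBigO.fun_sum fun i _ => isBigO_pow_mul (b_X i) (b_dσ i)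
  have b_div : (fun x => divField (fun i y => J y * X i y) x - (m + 1) * J x) =O[𝓝 0]
      fun x : Space m => ‖x‖ ^ 1 := by
    refine isBigO_norm_of_differentiableAt ?_ ?_
    · exact hdiff ((contDiffOn_divField Metric.isOpen_ball fun i => hJ.mul (hX i)).sub
        (contDiffOn_const.mul hJ))
    · rw [divField_smul (hdiff hJ) fun i => hdiff (hX i)]
      simp [hJ0, hdivX0, hX0]
  -- At the origin X vanishes, ∂X is the identity and div X = m + 1, so the deformation form is 2 -
  -- (m + 1) = 1 - m times the identity.
  have b_def : (fun x => ∑ j, ∑ k, |deformation a X j k x - (1 - m) * a j k x|) =O[𝓝 0]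
      fun x : Space m => ‖x‖ ^ 1 := by
    refine IsBigO.fun_sum fun j _ => IsBigO.fun_sum fun k _ => IsBigO.abs_left ?_
    refine isBigO_norm_of_differentiableAt ?_ ?_
    · exact hdiff ((contDiffOn_deformation Metric.isOpen_ball ha hX j k).sub
        (contDiffOn_const.mul (ha j k)))
    · have : ∀ i j, a i j 0 = if i = j then 1 else 0 := fun i j => by
        simp [hadef, densityCoeff, hJ0, hgi0]
      have hdX0' : ∀ i j, pd i (X j) 0 = if i = j then 1 else 0 := hdX0
      simp only [deformation, alongField, hX0, hdivX0, this, hdX0']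
      rcases eq_or_ne j k with rfl | hjk
      · simp; ring
      · simp [hjk, Ne.symm hjk]
  -- uniform constants
  obtain ⟨K₁, e_gi⟩ := exists_bound_of_isBigO fun _ : Unit => b_gi
  obtain ⟨K₂, e_J⟩ := exists_bound_of_isBigO fun _ : Unit => b_J
  obtain ⟨K₃, e_dJ⟩ := exists_bound_of_isBigO b_dJ
  obtain ⟨K₄, e_σ⟩ := exists_bound_of_isBigO fun _ : Unit => b_σ
  obtain ⟨K₅, e_dσ⟩ := exists_bound_of_isBigO b_dσ
  obtain ⟨K₆, e_X⟩ := exists_bound_of_isBigO b_X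
  obtain ⟨K₇, e_dX⟩ := exists_bound_of_isBigO b_dX
  obtain ⟨K₈, e_y⟩ := exists_bound_of_isBigO fun _ : Unit => b_y
  obtain ⟨K₉, e_Xy⟩ := exists_bound_of_isBigO fun _ : Unit => b_Xy
  obtain ⟨K₁₀, e_Xσ⟩ := exists_bound_of_isBigO fun _ : Unit => b_Xσ
  obtain ⟨K₁₁, e_div⟩ := exists_bound_of_isBigO fun _ : Unit => b_div
  obtain ⟨K₁₂, e_def⟩ := exists_bound_of_isBigO fun _ : Unit => b_def
  obtain ⟨L, hL⟩ : ∃ L : ℝ, ∀ c ∈ [1, K₁, K₂, K₃, K₄, K₅, K₆, K₇, K₈, K₉, K₁₀, K₁₁, K₁₂], c ≤ L := by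
    obtain ⟨L, hL⟩ := (List.finite_toSet
      [1, K₁, K₂, K₃, K₄, K₅, K₆, K₇, K₈, K₉, K₁₀, K₁₁, K₁₂]).bddAbove
    exact ⟨L, fun c hc => hL hc⟩
  simp only [List.mem_cons, List.not_mem_nil, or_false, forall_eq_or_imp, forall_eq] at hL
  obtain ⟨l1, k1, k2, k3, k4, k5, k6, k7, k8, k9, k10, k11, k12⟩ := hL
  have hL0 : 0 < L := by linarith
  have hsmall : ∀ᶠ x in 𝓝 (0 : Space m), L * ‖x‖ < 1 / 2 := by
    have : Tendsto (fun x : Space m => L * ‖x‖) (𝓝 0) (𝓝 (L * ‖(0 : Space m)‖)) :=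
      (by fun_prop : Continuous fun x : Space m => L * ‖x‖).tendsto 0
    rw [norm_zero, mul_zero] at this
    exact this.eventually (gt_mem_nhds (by norm_num))
  have hall := (e_gi L k1).and <| (e_J L k2).and <| (e_dJ L k3).and <| (e_σ L k4).and <|
    (e_dσ L k5).and <| (e_X L k6).and <| (e_dX L k7).and <| (e_y L k8).and <| (e_Xy L k9).and <|
    (e_Xσ L k10).and <| (e_div L k11).and <| (e_def L k12).and hsmall
  obtain ⟨ε, hε, hball⟩ := Metric.eventually_nhds_iff_ball.1 hall
  simp only [abs_pow, abs_norm, pow_one, pow_zero, abs_one, mul_one, forall_const] at hball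
  have hsub : Metric.ball (0 : Space m) (min ε δ) ⊆ Metric.ball 0 δ :=
    Metric.ball_subset_ball (min_le_right _ _)
  have hsub' : Metric.ball (0 : Space m) (min ε δ) ⊆ Metric.ball 0 ε :=
    Metric.ball_subset_ball (min_le_left _ _)
  -- the squared radius is comparable to `‖x‖ ^ 2`
  have hσlow : ∀ x ∈ Metric.ball (0 : Space m) ε, 1 / 4 * ‖x‖ ^ 2 ≤ σ x := by
    intro x hx
    obtain ⟨-, -, -, h4, -, -, -, -, -, -, -, -, hs⟩ := hball x hx
    have h5 := (abs_le.1 h4).1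
    have : L * ‖x‖ ^ 3 ≤ 1 / 2 * ‖x‖ ^ 2 := by
      calc L * ‖x‖ ^ 3 = (L * ‖x‖) * ‖x‖ ^ 2 := by ring
        _ ≤ _ := by gcongr
    linarith [sq_nonneg ‖x‖]
  have hnr : ∀ x ∈ Metric.ball (0 : Space m) ε, ‖x‖ ≤ 2 * √(σ x) := by
    intro x hx
    have h1 := Real.sqrt_le_sqrt (hσlow x hx)
    rw [show 1 / 4 * ‖x‖ ^ 2 = (‖x‖ / 2) ^ 2 by ring, Real.sqrt_sq (by positivity)] at h1
    linarith
  have hσpos : ∀ x ∈ Metric.ball (0 : Space m) ε, x ≠ 0 → 0 < σ x := by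
    intro x hx hx0
    have : 0 < ‖x‖ := norm_pos_iff.2 hx0
    have := hσlow x hx
    have : 0 < ‖x‖ ^ 2 := by positivity
    linarith
  -- Large enough for every field; the quadratic term comes from Xq, which needs 4L + 16L², because
  -- differentiating 1/σ multiplies two O(|x|) bounds.
  set K : ℝ := 24 * L + 16 * L ^ 2 + 1 with hK
  have hLK : 2 * L ≤ K := by linarith [sq_nonneg L, hK]
  have hscale : ∀ x ∈ Metric.ball (0 : Space m) ε, L * ‖x‖ ≤ K * √(σ x) := by
    intro x hx
    calc L * ‖x‖ ≤ L * (2 * √(σ x)) := by gcongr; exact hnr x hx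
      _ = 2 * L * √(σ x) := by ring
      _ ≤ _ := by gcongr
  refine ⟨min ε δ, K, lt_min hε hδ, min_le_right _ _, ?_⟩
  constructor
  case one_le => linarith [sq_nonneg L, hK]
  case smooth_gi => exact fun i j => (hgi i j).mono hsub
  case smooth_J => exact hJ.mono hsub
  case smooth_σ => exact hσ.smooth.mono hsub
  case symm => exact fun x hx => hsymm x ⟨hsub hx.1, hx.2⟩
  case normal => exact fun x hx => hnormal x ⟨hsub hx.1, hx.2⟩
  case σ_normal =>
    intro x hx hx0
    exact hσ.normal x ⟨by simpa using hsub hx, hx0.ge⟩ hx0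
  case J_lower =>
    intro x hx
    obtain ⟨-, h2, -, -, -, -, -, -, -, -, -, -, hs⟩ := hball x (hsub' hx)
    have := (abs_le.1 h2).1
    linarith
  case J_upper =>
    intro x hx
    obtain ⟨-, h2, -, -, -, -, -, -, -, -, -, -, hs⟩ := hball x (hsub' hx)
    have := (abs_le.1 h2).2
    linarith
  case pd_J =>
    intro x hx i
    obtain ⟨-, -, h, -⟩ := hball x (hsub' hx)
    exact (h i).trans (by linarith)
  case σ_pos => exact fun x hx => hσpos x (hsub' hx)
  case elliptic =>
    intro x hx ξ
    obtain ⟨h1, -, -, -, -, -, -, -, -, -, -, -, hs⟩ := hball x (hsub' hx)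
    have h2 := abs_quadratic_le (fun i j => gi i j x - if i = j then 1 else 0) ξ
    have h3 : ∑ i, ∑ j, (gi i j x - if i = j then 1 else 0) * ξ i * ξ j =
        (∑ i, ∑ j, gi i j x * ξ i * ξ j) - ∑ i, ξ i ^ 2 := by
      simp only [sub_mul, Finset.sum_sub_distrib, ite_mul, one_mul, zero_mul, Finset.sum_ite_eq,
        Finset.mem_univ, if_true, pow_two]
    rw [h3] at h2
    have h4 := (abs_le.1 h2).1
    have h5 : (∑ i, ∑ j, |gi i j x - if i = j then 1 else 0|) ≤ 1 / 2 :=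
      (le_abs_self _).trans (h1.trans hs.le)
    have h6 := mul_le_mul_of_nonneg_right h5 (sum_sq_nonneg ξ)
    linarith
  case pd_σ =>
    intro x hx _ i
    obtain ⟨-, -, -, -, h, -⟩ := hball x (hsub' hx)
    exact (h i).trans (hscale x (hsub' hx))
  case field =>
    intro x hx _ i
    obtain ⟨-, -, -, -, -, h, -⟩ := hball x (hsub' hx)
    exact (h i).trans (hscale x (hsub' hx))
  case pd_field =>
    intro x hx i j
    obtain ⟨-, -, -, -, -, -, h, -⟩ := hball x (hsub' hx)
    exact (h (i, j)).trans (by linarith)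
  case speed =>
    intro x hx hx0
    obtain ⟨-, -, -, -, -, -, -, h, -⟩ := hball x (hsub' hx)
    have hp := hσpos x (hsub' hx) hx0
    have e : 1 - radialSpeed gi σ x = -(radialDefect gi σ x / (2 * σ x)) := by
      simp only [radialSpeed, radialDefect]; field_simp; ring
    rw [e, abs_neg, abs_div, abs_of_pos (by linarith : 0 < 2 * σ x), div_le_iff₀ (by linarith)]
    calc |radialDefect gi σ x| ≤ L * ‖x‖ ^ 3 := h
      _ = L * ‖x‖ * ‖x‖ ^ 2 := by ring
      _ ≤ L * (2 * √(σ x)) * (4 * σ x) := by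
          gcongr
          · exact hnr x (hsub' hx)
          · linarith [hσlow x (hsub' hx)]
      _ = 4 * L * √(σ x) * (2 * σ x) := by ring
      _ ≤ _ := by
          gcongr
          linarith [sq_nonneg L, hK]
  case along_speed =>
    intro x hx hx0
    obtain ⟨-, -, -, -, -, -, -, h8, h9, h10, -⟩ := hball x (hsub' hx)
    have hp := hσpos x (hsub' hx) hx0
    have hxU := hsub hx
    have dσ := differentiableAt_of_contDiffOn Metric.isOpen_ball hσ.smooth hxU
    have dy : DifferentiableAt ℝ (radialDefect gi σ) x :=
      differentiableAt_of_contDiffOn Metric.isOpen_ball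
        ((contDiffOn_alongField Metric.isOpen_ball hX hσ.smooth).sub
          (contDiffOn_const.mul hσ.smooth)) hxU
    have hev : radialSpeed gi σ =ᶠ[𝓝 x]
        fun z => 1 + 1 / 2 * (radialDefect gi σ z * (σ z)⁻¹) := by
      have hc := (hσ.smooth.continuousOn.continuousAt (Metric.isOpen_ball.mem_nhds hxU))
      filter_upwards [hc.eventually (lt_mem_nhds hp)] with z hz
      simp only [radialSpeed, radialDefect]; field_simp; ring
    have dinv : DifferentiableAt ℝ (fun z => (σ z)⁻¹) x := dσ.inv hp.ne'
    have e : alongField X (radialSpeed gi σ) x = 1 / 2 * (alongField X (radialDefect gi σ) x * (σ x)⁻¹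
        - radialDefect gi σ x * alongField X σ x * ((σ x)⁻¹) ^ 2) := by
      have : ∀ i, pd i (radialSpeed gi σ) x = 1 / 2 * (pd i (radialDefect gi σ) x * (σ x)⁻¹
          - radialDefect gi σ x * ((σ x)⁻¹) ^ 2 * pd i σ x) := by
        intro i
        rw [pd_congr hev, pd_add (by fun_prop) ((dy.fun_mul dinv).const_mul _), pd_const,
          pd_const_mul _ (dy.fun_mul dinv), pd_mul dy dinv,
          pd_comp (hasDerivAt_inv hp.ne') dσ]
        field_simp; ring
      simp only [alongField, this, Finset.mul_sum, Finset.sum_mul, ← Finset.sum_sub_distrib]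
      exact Finset.sum_congr rfl fun i _ => by ring
    have hσl := hσlow x (hsub' hx)
    have hn := hnr x (hsub' hx)
    have i1 : |alongField X (radialDefect gi σ) x * (σ x)⁻¹| ≤ 8 * L * √(σ x) := by
      rw [abs_mul, abs_of_pos (inv_pos.2 hp), ← div_eq_mul_inv, div_le_iff₀ hp]
      calc _ ≤ L * ‖x‖ ^ 3 := h9
        _ = L * ‖x‖ * ‖x‖ ^ 2 := by ring
        _ ≤ L * (2 * √(σ x)) * (4 * σ x) := by
            gcongr
            linarith
        _ = _ := by ring
    have i2 : |radialDefect gi σ x * alongField X σ x * ((σ x)⁻¹) ^ 2| ≤ 32 * L ^ 2 * √(σ x) := by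
      rw [abs_mul, abs_of_pos (pow_pos (inv_pos.2 hp) 2), inv_pow, ← div_eq_mul_inv,
        div_le_iff₀ (by positivity), abs_mul]
      calc _ ≤ (L * ‖x‖ ^ 3) * (L * ‖x‖ ^ 2) := by gcongr
        _ = L ^ 2 * (‖x‖ * ‖x‖ ^ 2 * ‖x‖ ^ 2) := by ring
        _ ≤ L ^ 2 * ((2 * √(σ x)) * (4 * σ x) * (4 * σ x)) := by
            gcongr <;> linarith
        _ = _ := by ring
    rw [e, abs_mul, abs_of_pos (by norm_num : (0 : ℝ) < 1 / 2)]
    have i3 := abs_sub (alongField X (radialDefect gi σ) x * (σ x)⁻¹)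
      (radialDefect gi σ x * alongField X σ x * ((σ x)⁻¹) ^ 2)
    have hr := Real.sqrt_nonneg (σ x)
    have i4 : 0 ≤ L * √(σ x) := by positivity
    have i5 : K * √(σ x) = 24 * (L * √(σ x)) + 16 * L ^ 2 * √(σ x) + √(σ x) := by rw [hK]; ring
    rw [i5]
    linarith
  case div_field =>
    intro x hx _
    obtain ⟨-, -, -, -, -, -, -, -, -, -, h, -⟩ := hball x (hsub' hx)
    exact h.trans (hscale x (hsub' hx))
  case deform =>
    intro x hx _ ξ
    obtain ⟨-, -, -, -, -, -, -, -, -, -, -, h, -⟩ := hball x (hsub' hx)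
    refine (abs_quadratic_le _ ξ).trans ?_
    gcongr
    exact (le_abs_self _).trans (h.trans (hscale x (hsub' hx)))

end GeometryConstants

/-! ### The inverse metric, and Riemannian against Euclidean length. -/

section Metric

open Asymptotics Filter Topology

variable {m : ℕ} {R : ℝ} {g : Space m → Matrix (Fin (m + 1)) (Fin (m + 1)) ℝ}

theorem contDiffOn_det {U : Set (Space m)} {n : WithTop ℕ∞} {k : ℕ}
    {A : Space m → Matrix (Fin k) (Fin k) ℝ}
    (hA : ∀ i j, ContDiffOn ℝ n (fun x => A x i j) U) : ContDiffOn ℝ n (fun x => (A x).det) U := by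
  simp only [Matrix.det_apply]
  refine ContDiffOn.sum fun p _ => ?_
  simp only [Units.smul_def, zsmul_eq_mul]
  exact contDiffOn_const.mul (contDiffOn_prod fun i _ => hA _ _)

theorem contDiffOn_adjugate {U : Set (Space m)} {n : WithTop ℕ∞} {k : ℕ}
    {A : Space m → Matrix (Fin k) (Fin k) ℝ}
    (hA : ∀ i j, ContDiffOn ℝ n (fun x => A x i j) U) (i j : Fin k) :
    ContDiffOn ℝ n (fun x => (A x).adjugate i j) U := by
  simp only [Matrix.adjugate_apply]
  refine contDiffOn_det fun k l => ?_
  by_cases hk : k = j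
  · subst hk; simp only [Matrix.updateRow_self]; exact contDiffOn_const
  · simp only [Matrix.updateRow_ne hk]; exact hA _ _

theorem chart_eq : chart m R = Metric.ball 0 R ∩ halfSpace m := by
  ext x; simp [chart, halfSpace]

/-- Near the origin the inverse metric and the volume density are smooth. -/
theorem exists_smooth_inverse (hR : 0 < R) (hg : IsFermiMetric R g) :
    ∃ δ, 0 < δ ∧ δ ≤ R ∧ (∀ i j, ContDiffOn ℝ ∞ (fun x => (g x)⁻¹ i j) (Metric.ball 0 δ)) ∧
      ContDiffOn ℝ ∞ (fun x => √(g x).det) (Metric.ball 0 δ) := by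
  have hdet := contDiffOn_det (U := Metric.ball 0 R) hg.smooth
  have hc : ContinuousAt (fun x => (g x).det) 0 :=
    hdet.continuousOn.continuousAt (Metric.ball_mem_nhds _ hR)
  have h0 : (g 0).det = 1 := by rw [hg.at_origin, Matrix.det_one]
  have hpos : ∀ᶠ x in 𝓝 (0 : Space m), 0 < (g x).det :=
    hc.eventually (lt_mem_nhds (by simp [h0]))
  obtain ⟨ε, hε, hball⟩ := Metric.eventually_nhds_iff_ball.1 hpos
  have hsub : Metric.ball (0 : Space m) (min ε R) ⊆ Metric.ball 0 R :=
    Metric.ball_subset_ball (min_le_right _ _)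
  have hsub' : Metric.ball (0 : Space m) (min ε R) ⊆ Metric.ball 0 ε :=
    Metric.ball_subset_ball (min_le_left _ _)
  refine ⟨min ε R, lt_min hε hR, min_le_right _ _, fun i j => ?_, ?_⟩
  · simp only [Matrix.inv_def, Matrix.smul_apply, smul_eq_mul, Ring.inverse_eq_inv']
    exact ((hdet.mono hsub).inv fun x hx => (hball x (hsub' hx)).ne').mul
      ((contDiffOn_adjugate hg.smooth i j).mono hsub)
  · exact (hdet.mono hsub).sqrt fun x hx => (hball x (hsub' hx)).ne'

theorem IsFermiMetric.inv_symm (hg : IsFermiMetric R g) {x : Space m} (hx : x ∈ chart m R)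
    (i j : Fin (m + 1)) : (g x)⁻¹ i j = (g x)⁻¹ j i := by
  have := (hg.posDef x hx).isHermitian.inv.apply j i
  simpa using this

/-- In Fermi coordinates eₙ is an eigenvector of g with eigenvalue 1, hence also of g⁻¹. -/
theorem IsFermiMetric.inv_normal (hg : IsFermiMetric R g) {x : Space m} (hx : x ∈ chart m R)
    (i : Fin (m + 1)) : (g x)⁻¹ i (Fin.last m) = if i = Fin.last m then 1 else 0 := by
  have hdet : IsUnit (g x).det := (hg.posDef x hx).det_pos.ne'.isUnit
  have h1 : (g x).mulVec (Pi.single (Fin.last m) 1) = Pi.single (Fin.last m) 1 := by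
    ext k
    rw [Matrix.mulVec_single_one]
    by_cases hk : k = Fin.last m
    · subst hk; simpa using hg.normal_normal x hx
    · simpa [hk] using hg.normal_tangent x hx k hk
  have h2 := congrArg (fun v => (g x)⁻¹.mulVec v) h1
  simp only [Matrix.mulVec_mulVec, Matrix.nonsing_inv_mul _ hdet, Matrix.one_mulVec] at h2
  have h3 := congrFun h2 i
  rw [Matrix.mulVec_single_one] at h3
  simp only [Matrix.col_apply] at h3
  rw [← h3, Pi.single_apply]

/-- The metric is a first order perturbation of the Euclidean one. -/
theorem exists_metric_comparison (hR : 0 < R) (hg : IsFermiMetric R g) :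
    ∃ δ C, 0 < δ ∧ δ ≤ R ∧ 0 < C ∧ C * δ ≤ 1 / 2 ∧ ∀ x ∈ Metric.ball (0 : Space m) δ, ∀ v : Space m,
      |∑ i, ∑ j, g x i j * v i * v j - ‖v‖ ^ 2| ≤ C * ‖x‖ * ‖v‖ ^ 2 := by
  have h0 : (0 : Space m) ∈ Metric.ball (0 : Space m) R := Metric.mem_ball_self hR
  have b : (fun x => ∑ i, ∑ j, |g x i j - if i = j then 1 else 0|) =O[𝓝 0]
      fun x : Space m => ‖x‖ ^ 1 :=
    IsBigO.fun_sum fun i _ => IsBigO.fun_sum fun j _ =>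
      (isBigO_norm_of_differentiableAt
        ((differentiableAt_of_contDiffOn Metric.isOpen_ball (hg.smooth i j) h0).sub_const _)
        (by simp [hg.at_origin, Matrix.one_apply])).abs_left
  obtain ⟨K, hK⟩ := exists_bound_of_isBigO fun _ : Unit => b
  obtain ⟨ε, hε, hball⟩ := Metric.eventually_nhds_iff_ball.1 (hK (|K| + 1) (by
    have := le_abs_self K; linarith))
  have hC : 0 < |K| + 1 := by positivity
  refine ⟨min (min ε R) (1 / (2 * (|K| + 1))), |K| + 1, by positivity,
    (min_le_left _ _).trans (min_le_right _ _), hC, ?_, fun x hx v => ?_⟩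
  · calc _ ≤ (|K| + 1) * (1 / (2 * (|K| + 1))) := by gcongr; exact min_le_right _ _
      _ = 1 / 2 := by field_simp
  · have h1 := hball x (Metric.ball_subset_ball ((min_le_left _ _).trans (min_le_left _ _)) hx) ()
    simp only [pow_one, abs_norm] at h1
    have h2 := abs_quadratic_le (fun i j => g x i j - if i = j then 1 else 0) v
    have h3 : ∑ i, ∑ j, (g x i j - if i = j then 1 else 0) * v i * v j =
        (∑ i, ∑ j, g x i j * v i * v j) - ‖v‖ ^ 2 := by
      rw [norm_sq_eq_sum]
      simp only [sub_mul, Finset.sum_sub_distrib, ite_mul, one_mul, zero_mul, Finset.sum_ite_eq,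
        Finset.mem_univ, if_true, pow_two]
    rw [h3, ← norm_sq_eq_sum] at h2
    refine h2.trans ?_
    gcongr
    exact (le_abs_self _).trans h1

theorem continuousOn_speed (hg : IsFermiMetric R g) {γ : ℝ → Space m} (hγ : ContDiff ℝ 1 γ)
    (hγR : ∀ t ∈ Icc (0 : ℝ) 1, γ t ∈ chart m R) :
    ContinuousOn (fun t => √(∑ i, ∑ j, g (γ t) i j * (deriv γ t) i * (deriv γ t) j))
      (Icc 0 1) := by
  apply ContinuousOn.sqrt
  refine continuousOn_finsetSum _ fun i _ => continuousOn_finsetSum _ fun j _ => ?_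
  have hd : Continuous (deriv γ) := hγ.continuous_deriv le_rfl
  have h1 : ContinuousOn (fun t => g (γ t) i j) (Icc 0 1) :=
    (hg.smooth i j).continuousOn.comp hγ.continuous.continuousOn fun t ht => by
      have := (hγR t ht).1
      simpa using this
  have h2 : ∀ i, Continuous fun t => (deriv γ t) i := fun i => by fun_prop
  exact (h1.mul (h2 i).continuousOn).mul (h2 j).continuousOn

theorem curveLength_nonneg (γ : ℝ → Space m) : 0 ≤ curveLength g γ :=
  intervalIntegral.integral_nonneg zero_le_one fun _ _ => Real.sqrt_nonneg _

theorem riemDist_nonneg (x : Space m) : 0 ≤ riemDist g R x := by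
  apply Real.sInf_nonneg
  rintro l ⟨γ, -, -, -, -, rfl⟩
  exact curveLength_nonneg γ

theorem smul_mem_chart {x : Space m} (hx : x ∈ chart m R) {t : ℝ} (ht : t ∈ Icc (0 : ℝ) 1) :
    t • x ∈ chart m R := by
  refine ⟨?_, ?_⟩
  · rw [norm_smul, Real.norm_eq_abs, abs_of_nonneg ht.1]
    calc t * ‖x‖ ≤ 1 * ‖x‖ := by gcongr; exact ht.2
      _ < R := by rw [one_mul]; exact hx.1
  · have := mul_nonneg ht.1 hx.2
    simpa using this

theorem segment_mem_curves {x : Space m} (hx : x ∈ chart m R) :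
    curveLength g (fun t : ℝ => t • x) ∈ {l | ∃ γ : ℝ → Space m, ContDiff ℝ 1 γ ∧ γ 0 = 0 ∧ γ 1 = x ∧
      (∀ t ∈ Icc (0 : ℝ) 1, γ t ∈ chart m R) ∧ l = curveLength g γ} :=
  ⟨fun t => t • x, by fun_prop, by simp, by simp, fun _ ht => smul_mem_chart hx ht, rfl⟩

/-- The straight segment stays in the half ball, and the metric along it differs from the Euclidean
one by at most C‖x‖. -/
theorem riemDist_le {δ C : ℝ} (hg : IsFermiMetric R g)
    (hcmp : ∀ x ∈ Metric.ball (0 : Space m) δ, ∀ v : Space m,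
      |∑ i, ∑ j, g x i j * v i * v j - ‖v‖ ^ 2| ≤ C * ‖x‖ * ‖v‖ ^ 2) (hC : 0 < C)
    {x : Space m} (hx : x ∈ chart m R) (hxδ : ‖x‖ < δ) :
    riemDist g R x ≤ √(1 + C * ‖x‖) * ‖x‖ := by
  have hbdd : BddBelow {l | ∃ γ : ℝ → Space m, ContDiff ℝ 1 γ ∧ γ 0 = 0 ∧ γ 1 = x ∧
      (∀ t ∈ Icc (0 : ℝ) 1, γ t ∈ chart m R) ∧ l = curveLength g γ} :=
    ⟨0, by rintro l ⟨γ, -, -, -, -, rfl⟩; exact curveLength_nonneg γ⟩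
  refine (csInf_le hbdd (segment_mem_curves hx)).trans ?_
  have hd : ∀ t : ℝ, deriv (fun t : ℝ => t • x) t = x := fun t => by
    have := (hasDerivAt_id t).smul_const x
    simpa using this.deriv
  have hi : IntervalIntegrable (fun t : ℝ => √(∑ i, ∑ j, g (t • x) i j *
      (deriv (fun t : ℝ => t • x) t) i * (deriv (fun t : ℝ => t • x) t) j)) volume 0 1 := by
    apply ContinuousOn.intervalIntegrable
    rw [uIcc_of_le zero_le_one]
    exact continuousOn_speed (γ := fun t : ℝ => t • x) hg (by fun_prop)
      fun t ht => smul_mem_chart hx ht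
  have := intervalIntegral.integral_mono_on zero_le_one hi
    (intervalIntegrable_const (c := √(1 + C * ‖x‖) * ‖x‖)) fun t ht => by
      rw [hd]
      have hn : ‖t • x‖ ≤ ‖x‖ := by
        rw [norm_smul, Real.norm_eq_abs, abs_of_nonneg ht.1]
        calc t * ‖x‖ ≤ 1 * ‖x‖ := by gcongr; exact ht.2
          _ = ‖x‖ := one_mul _
      have h1 := (abs_le.1 (hcmp (t • x) (by simpa using hn.trans_lt hxδ) x)).2
      have h2 : C * ‖t • x‖ * ‖x‖ ^ 2 ≤ C * ‖x‖ * ‖x‖ ^ 2 := by gcongr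
      calc √(∑ i, ∑ j, g (t • x) i j * x i * x j) ≤ √((1 + C * ‖x‖) * ‖x‖ ^ 2) := by
            apply Real.sqrt_le_sqrt; linarith
        _ = _ := by rw [Real.sqrt_mul (by positivity), Real.sqrt_sq (norm_nonneg _)]
  simpa [curveLength] using this

/-- A competing curve may leave the region where the metrics are comparable, so it is cut at the
first time it reaches Euclidean norm ρ. Up to then the comparison holds and its Euclidean length is
already at least ρ. -/
theorem le_riemDist {δ C : ℝ} (hg : IsFermiMetric R g)
    (hcmp : ∀ x ∈ Metric.ball (0 : Space m) δ, ∀ v : Space m,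
      |∑ i, ∑ j, g x i j * v i * v j - ‖v‖ ^ 2| ≤ C * ‖x‖ * ‖v‖ ^ 2) (hC : 0 < C)
    {ρ : ℝ} (hρδ : ρ ≤ δ) (hCρ : C * ρ ≤ 1)
    {x : Space m} (hx : x ∈ chart m R) (hxρ : ρ ≤ ‖x‖) :
    √(1 - C * ρ) * ρ ≤ riemDist g R x := by
  refine le_csInf ⟨_, segment_mem_curves hx⟩ ?_
  rintro l ⟨γ, hγ, hγ0, hγ1, hγR, rfl⟩
  set A := {t ∈ Icc (0 : ℝ) 1 | ρ ≤ ‖γ t‖} with hA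
  have hAc : IsCompact A := isCompact_Icc.of_isClosed_subset
    (isClosed_Icc.inter (isClosed_le continuous_const hγ.continuous.norm)) fun t ht => ht.1
  have hAne : A.Nonempty := ⟨1, ⟨zero_le_one, le_rfl⟩, by rw [hγ1]; exact hxρ⟩
  set τ := sInf A
  have hτ : τ ∈ A := hAc.sInf_mem hAne
  have hlt : ∀ t ∈ Ico 0 τ, ‖γ t‖ < ρ := by
    intro t ht
    by_contra! h
    have : τ ≤ t := csInf_le hAc.bddBelow ⟨⟨ht.1, ht.2.le.trans hτ.1.2⟩, h⟩
    exact absurd ht.2 (not_lt.2 this)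
  have hcont := continuousOn_speed hg hγ hγR
  have hint : ∀ a b : ℝ, a ∈ Icc (0 : ℝ) 1 → b ∈ Icc (0 : ℝ) 1 → IntervalIntegrable
      (fun t => √(∑ i, ∑ j, g (γ t) i j * (deriv γ t) i * (deriv γ t) j)) volume a b :=
    fun a b ha hb => (hcont.mono (uIcc_subset_Icc ha hb)).intervalIntegrable
  have hd : Continuous (deriv γ) := hγ.continuous_deriv le_rfl
  have h1 : ∫ t in (0 : ℝ)..τ, √(1 - C * ρ) * ‖deriv γ t‖ ≤
      ∫ t in (0 : ℝ)..τ, √(∑ i, ∑ j, g (γ t) i j * (deriv γ t) i * (deriv γ t) j) := by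
    apply intervalIntegral.integral_mono_on_of_le_Ioo hτ.1.1
    · exact (by fun_prop : Continuous fun t => √(1 - C * ρ) * ‖deriv γ t‖).intervalIntegrable _ _
    · exact hint _ _ ⟨le_rfl, zero_le_one⟩ hτ.1
    · intro t ht
      have hn := hlt t ⟨ht.1.le, ht.2⟩
      have h1 := (abs_le.1 (hcmp (γ t) (by simpa using hn.trans_le hρδ) (deriv γ t))).1
      have h2 : C * ‖γ t‖ * ‖deriv γ t‖ ^ 2 ≤ C * ρ * ‖deriv γ t‖ ^ 2 := by gcongr
      calc √(1 - C * ρ) * ‖deriv γ t‖ = √((1 - C * ρ) * ‖deriv γ t‖ ^ 2) := by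
            rw [Real.sqrt_mul (by linarith), Real.sqrt_sq (norm_nonneg _)]
        _ ≤ _ := by apply Real.sqrt_le_sqrt; linarith
  have h2 : ρ ≤ ∫ t in (0 : ℝ)..τ, ‖deriv γ t‖ := by
    have h3 : ∫ t in (0 : ℝ)..τ, deriv γ t = γ τ - γ 0 :=
      intervalIntegral.integral_deriv_eq_sub
        (fun t _ => (hγ.differentiable (by simp)).differentiableAt) (hd.intervalIntegrable _ _)
    have h4 := intervalIntegral.norm_integral_le_integral_norm (f := deriv γ) (μ := volume) hτ.1.1
    rw [h3, hγ0, sub_zero] at h4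
    exact hτ.2.trans h4
  have h3 : ∫ t in (0 : ℝ)..τ, √(∑ i, ∑ j, g (γ t) i j * (deriv γ t) i * (deriv γ t) j) ≤
      curveLength g γ := by
    rw [curveLength, ← intervalIntegral.integral_add_adjacent_intervals
      (hint 0 τ ⟨le_rfl, zero_le_one⟩ hτ.1) (hint τ 1 hτ.1 ⟨zero_le_one, le_rfl⟩)]
    have := intervalIntegral.integral_nonneg (μ := volume) hτ.1.2
      (f := fun t => √(∑ i, ∑ j, g (γ t) i j * (deriv γ t) i * (deriv γ t) j))
      fun t _ => Real.sqrt_nonneg _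
    linarith
  rw [intervalIntegral.integral_const_mul] at h1
  calc √(1 - C * ρ) * ρ ≤ √(1 - C * ρ) * ∫ t in (0 : ℝ)..τ, ‖deriv γ t‖ := by gcongr
    _ ≤ _ := h1.trans h3

end Metric

/-! ### The Taylor expansion of the squared distance. -/

section SquaredDistance

open Asymptotics Filter Topology

variable {m : ℕ} {R : ℝ} {g : Space m → Matrix (Fin (m + 1)) (Fin (m + 1)) ℝ}

/-- A coefficient of order k bounded by a higher power along a ray must vanish. Only s > 0 is
available, because rays start at the boundary point and enter the half ball. -/
theorem eq_zero_of_scaling {c C : ℝ} {k : ℕ}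
    (h : ∀ᶠ s in 𝓝[>] (0 : ℝ), |c| * s ^ k ≤ C * s ^ (k + 1)) : c = 0 := by
  have h1 : ∀ᶠ s in 𝓝[>] (0 : ℝ), |c| ≤ C * s := by
    filter_upwards [h, self_mem_nhdsWithin] with s hs hs0
    have hs0' : 0 < s ^ k := pow_pos hs0 _
    rw [pow_succ, mul_comm (s ^ k), ← mul_assoc] at hs
    exact le_of_mul_le_mul_right hs hs0'
  have h2 : Tendsto (fun s : ℝ => C * s) (𝓝[>] 0) (𝓝 0) := by
    have : Tendsto (fun s : ℝ => C * s) (𝓝 0) (𝓝 (C * 0)) := (by fun_prop :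
      Continuous fun s : ℝ => C * s).tendsto 0
    rw [mul_zero] at this
    exact this.mono_left nhdsWithin_le_nhds
  have h3 := ge_of_tendsto h2 h1
  exact abs_eq_zero.1 (le_antisymm h3 (abs_nonneg _))

/-- A bound that holds in a half ball, restricted to a ray. -/
theorem eventually_ray {P : Space m → Prop} {δ : ℝ} (hδ : 0 < δ)
    (h : ∀ x ∈ Metric.ball (0 : Space m) δ ∩ halfSpace m, P x) {y : Space m} (hy : y ∈ halfSpace m) :
    ∀ᶠ s in 𝓝[>] (0 : ℝ), P (s • y) := by
  have hc : Tendsto (fun s : ℝ => s • y) (𝓝[>] 0) (𝓝 0) := by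
    have : Tendsto (fun s : ℝ => s • y) (𝓝 0) (𝓝 ((0 : ℝ) • y)) :=
      (by fun_prop : Continuous fun s : ℝ => s • y).tendsto 0
    rw [zero_smul] at this
    exact this.mono_left nhdsWithin_le_nhds
  filter_upwards [hc.eventually (Metric.ball_mem_nhds _ hδ), self_mem_nhdsWithin] with s hs hs0
  refine h _ ⟨hs, ?_⟩
  have hs0' : 0 < s := hs0
  have hy' : 0 ≤ y (Fin.last m) := hy
  have := mul_nonneg hs0'.le hy'
  simpa [halfSpace] using this

/-- A smooth function which agrees with `|x|²` up to third order in a half ball has the Taylor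
coefficients of `|x|²` at the origin. -/
theorem taylor_of_half_ball {σ : Space m → ℝ} {δ C : ℝ} (hδ : 0 < δ)
    (hσ : ContDiffOn ℝ ∞ σ (Metric.ball 0 δ))
    (hb : ∀ x ∈ Metric.ball (0 : Space m) δ ∩ halfSpace m, |σ x - ‖x‖ ^ 2| ≤ C * ‖x‖ ^ 3) :
    σ 0 = 0 ∧ (∀ i, pd i σ 0 = 0) ∧ ∀ i j, pd i (pd j σ) 0 = if i = j then 2 else 0 := by
  have h0 : (0 : Space m) ∈ Metric.ball (0 : Space m) δ := Metric.mem_ball_self hδ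
  have hσ0 : σ 0 = 0 := by
    have := hb 0 ⟨h0, by simp [halfSpace]⟩
    simpa using this
  have hd : ∀ i, ContDiffOn ℝ ∞ (pd i σ) (Metric.ball 0 δ) := fun i =>
    contDiffOn_pd hσ Metric.isOpen_ball i
  have hdd : ∀ i j, ContDiffOn ℝ ∞ (pd i (pd j σ)) (Metric.ball 0 δ) := fun i j =>
    contDiffOn_pd (hd j) Metric.isOpen_ball i
  set b : Fin (m + 1) → ℝ := fun i => pd i σ 0
  set H : Fin (m + 1) → Fin (m + 1) → ℝ := fun i j => pd i (pd j σ) 0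
  have hHs : ∀ i j, H i j = H j i := fun i j =>
    pd_comm ((hσ.contDiffAt (Metric.ball_mem_nhds _ hδ)).of_le (WithTop.coe_le_coe.2 (le_top (a := (2 : ℕ∞))))) i j
  have hT1 : ∀ i, (fun x => pd i σ x - b i - ∑ j, H i j * x j) =O[𝓝 0] fun x => ‖x‖ ^ 2 := by
    intro i
    refine isBigO_of_pd (k := 1) ?_ (by simp [b]) fun k => ?_
    · filter_upwards [eventually_differentiableAt hδ (hd i)] with x hx
      fun_prop
    · refine EventuallyEq.trans_isBigO (f₂ := fun x => pd k (pd i σ) x - H k i) ?_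
        (isBigO_norm_of_differentiableAt
        ((differentiableAt_of_contDiffOn Metric.isOpen_ball (hdd k i) h0).sub_const _) (sub_self _))
      filter_upwards [eventually_differentiableAt hδ (hd i)] with x hx
      rw [pd_sub (by fun_prop) (by fun_prop), pd_sub hx (by fun_prop), pd_const,
        pd_sum _ fun j _ => by fun_prop, Finset.sum_eq_single k]
      · rw [pd_const_mul _ (by fun_prop), pd_coord, hHs]; simp
      · intro j _ hj
        rw [pd_const_mul _ (by fun_prop), pd_coord]; simp [Ne.symm hj]
      · simp
  have hquad : ∀ (k : Fin (m + 1)) (x : Space m),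
      pd k (fun y : Space m => ∑ i, ∑ j, H i j * (y i * y j)) x = 2 * ∑ j, H k j * x j := by
    intro k x
    rw [pd_sum _ fun i _ => by fun_prop]
    have : ∀ i, pd k (fun y : Space m => ∑ j, H i j * (y i * y j)) x =
        (if k = i then ∑ j, H i j * x j else 0) + H i k * x i := by
      intro i
      rw [pd_sum _ fun i _ => by fun_prop]
      have : ∀ j, pd k (fun y : Space m => H i j * (y i * y j)) x =
          (if k = i then H i j * x j else 0) + if k = j then H i j * x i else 0 := by
        intro j
        rw [pd_const_mul _ (by fun_prop), pd_mul (by fun_prop) (by fun_prop), pd_coord, pd_coord]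
        split_ifs <;> ring
      simp only [this, Finset.sum_add_distrib, Finset.sum_ite_eq, Finset.mem_univ, if_true]
      split_ifs <;> simp
    simp only [this, Finset.sum_add_distrib, Finset.sum_ite_eq, Finset.mem_univ, if_true]
    have h2 : ∑ i, H i k * x i = ∑ j, H k j * x j :=
      Finset.sum_congr rfl fun i _ => by rw [hHs]
    rw [h2]; ring
  have hT : (fun x => σ x - ∑ i, b i * x i - 1 / 2 * ∑ i, ∑ j, H i j * (x i * x j)) =O[𝓝 0]
      fun x : Space m => ‖x‖ ^ 3 := by
    refine isBigO_of_pd (k := 2) ?_ (by simp [hσ0]) fun k => ?_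
    · filter_upwards [eventually_differentiableAt hδ hσ] with x hx
      fun_prop
    · refine EventuallyEq.trans_isBigO ?_ (hT1 k)
      filter_upwards [eventually_differentiableAt hδ hσ] with x hx
      rw [pd_sub (by fun_prop) (by fun_prop), pd_sub hx (by fun_prop),
        pd_const_mul _ (by fun_prop), hquad,
        pd_sum _ fun j _ => by fun_prop, Finset.sum_eq_single k]
      · rw [pd_const_mul _ (by fun_prop), pd_coord]; simp
      · intro j _ hj
        rw [pd_const_mul _ (by fun_prop), pd_coord]; simp [Ne.symm hj]
      · simp
  obtain ⟨K, hK⟩ := exists_bound_of_isBigO fun _ : Unit => hT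
  obtain ⟨ε, hε, hball⟩ := Metric.eventually_nhds_iff_ball.1 (hK _ le_rfl)
  -- the polynomial `b·x + ½ H(x,x) - |x|²` is cubic in a half ball
  have hpoly : ∀ x ∈ Metric.ball (0 : Space m) (min ε δ) ∩ halfSpace m,
      |∑ i, b i * x i + (1 / 2 * ∑ i, ∑ j, H i j * (x i * x j) - ‖x‖ ^ 2)| ≤
        (K + C) * ‖x‖ ^ 3 := by
    intro x hx
    have h1 := hball x (Metric.ball_subset_ball (min_le_left _ _) hx.1) ()
    rw [abs_of_nonneg (by positivity : 0 ≤ ‖x‖ ^ 3)] at h1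
    have h2 := hb x ⟨Metric.ball_subset_ball (min_le_right _ _) hx.1, hx.2⟩
    rw [abs_le] at h1 h2 ⊢
    constructor <;> linarith
  have hray : ∀ y ∈ halfSpace m, ∀ᶠ s in 𝓝[>] (0 : ℝ),
      |s * ∑ i, b i * y i + s ^ 2 * (1 / 2 * ∑ i, ∑ j, H i j * (y i * y j) - ‖y‖ ^ 2)| ≤
        (K + C) * ‖y‖ ^ 3 * s ^ 3 := by
    intro y hy
    filter_upwards [eventually_ray (lt_min hε hδ) hpoly hy, self_mem_nhdsWithin] with s hs hs0
    have e1 : ∑ i, b i * (s • y) i = s * ∑ i, b i * y i := by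
      rw [Finset.mul_sum]
      exact Finset.sum_congr rfl fun i _ => by simp; ring
    have e2 : ∑ i, ∑ j, H i j * ((s • y) i * (s • y) j) = s ^ 2 * ∑ i, ∑ j, H i j * (y i * y j) := by
      rw [Finset.mul_sum]
      refine Finset.sum_congr rfl fun i _ => ?_
      rw [Finset.mul_sum]
      exact Finset.sum_congr rfl fun j _ => by simp; ring
    rw [e1, e2, norm_smul, Real.norm_eq_abs, abs_of_pos (show 0 < s from hs0)] at hs
    convert hs using 1
    · congr 1; ring
    · ring
  have hlin : ∀ y ∈ halfSpace m, ∑ i, b i * y i = 0 := by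
    intro y hy
    refine eq_zero_of_scaling (k := 1) (C := |1 / 2 * ∑ i, ∑ j, H i j * (y i * y j) - ‖y‖ ^ 2|
      + |(K + C) * ‖y‖ ^ 3|) ?_
    filter_upwards [hray y hy, self_mem_nhdsWithin,
      nhdsWithin_le_nhds (Iio_mem_nhds one_pos)] with s hs hs0 hs1
    have hs0' : 0 < s := hs0
    have hs1' : s < 1 := hs1
    set q := 1 / 2 * ∑ i, ∑ j, H i j * (y i * y j) - ‖y‖ ^ 2
    set l := ∑ i, b i * y i
    have h1 : |s * l| ≤ |s * l + s ^ 2 * q| + |s ^ 2 * q| := by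
      have := abs_sub (s * l + s ^ 2 * q) (s ^ 2 * q)
      simpa using this
    rw [abs_mul, abs_of_pos hs0', abs_mul (s ^ 2), abs_of_pos (pow_pos hs0' 2)] at h1
    have h2 : (K + C) * ‖y‖ ^ 3 * s ^ 3 ≤ |(K + C) * ‖y‖ ^ 3| * s ^ 2 := by
      calc (K + C) * ‖y‖ ^ 3 * s ^ 3 ≤ |(K + C) * ‖y‖ ^ 3| * s ^ 3 := by
            gcongr; exact le_abs_self _
        _ ≤ _ := by
          gcongr ?_ * ?_
          exact pow_le_pow_of_le_one hs0'.le hs1'.le (by norm_num)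
    calc |l| * s ^ 1 = s * |l| := by ring
      _ ≤ (|q| + |(K + C) * ‖y‖ ^ 3|) * s ^ 2 := by linarith
  have hqd : ∀ y ∈ halfSpace m, 1 / 2 * ∑ i, ∑ j, H i j * (y i * y j) - ‖y‖ ^ 2 = 0 := by
    intro y hy
    refine eq_zero_of_scaling (k := 2) (C := (K + C) * ‖y‖ ^ 3) ?_
    filter_upwards [hray y hy, self_mem_nhdsWithin] with s hs hs0
    have hs0' : 0 < s := hs0
    rw [hlin y hy, mul_zero, zero_add, abs_mul, abs_of_pos (pow_pos hs0' 2)] at hs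
    linarith
  -- The basis vectors and their pairwise sums lie in the closed half space. They suffice to read
  -- off all linear and quadratic coefficients by polarization.
  have he : ∀ i : Fin (m + 1), EuclideanSpace.single i (1 : ℝ) ∈ halfSpace m := by
    intro i
    simp only [halfSpace, mem_ofPred_eq, PiLp.single_apply]
    split_ifs <;> simp
  have hdiag : ∀ i, H i i = 2 := by
    intro i
    have h1 := hqd _ (he i)
    simp at h1
    linarith
  refine ⟨hσ0, fun i => ?_, fun i j => ?_⟩
  · have h1 := hlin _ (he i)
    simpa [Pi.single_apply] using h1
  · rcases eq_or_ne i j with rfl | hij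
    · simpa using hdiag i
    · have hsum : EuclideanSpace.single i (1 : ℝ) + EuclideanSpace.single j (1 : ℝ) ∈ halfSpace m := by
        have h1 : 0 ≤ (EuclideanSpace.single i (1 : ℝ) : Space m) (Fin.last m) := he i
        have h2 : 0 ≤ (EuclideanSpace.single j (1 : ℝ) : Space m) (Fin.last m) := he j
        have := add_nonneg h1 h2
        simpa [halfSpace] using this
      have h1 := hqd _ hsum
      rw [norm_sq_eq_sum] at h1
      have e1 : ∀ k, (EuclideanSpace.single i (1 : ℝ) + EuclideanSpace.single j (1 : ℝ) : Space m) k =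
          (if k = i then 1 else 0) + if k = j then 1 else 0 := fun k => by
        simp
      simp only [e1, add_mul, mul_add, Finset.sum_add_distrib, pow_two] at h1
      simp [hij, Ne.symm hij] at h1
      have h2 := hdiag i
      have h3 := hdiag j
      have h4 := hHs i j
      rw [if_neg hij]
      show H i j = 0
      linarith

/-- Both admissible radial functions have a smooth square with the Taylor expansion of `|x|²`. -/
theorem exists_squaredRadius (hR : 0 < R) (hg : IsFermiMetric R g) {r : Space m → ℝ}
    (hr : (r = riemDist g R ∧ HasPolarHalfBall g R) ∨ r = fun x => ‖x‖) :
    ∃ σ, IsSquaredRadius R σ ∧ (∀ x ∈ chart m R, r x = √(σ x)) ∧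
      ∀ δ > 0, ∃ s > 0, halfBallFlat R r s ⊆ Metric.ball 0 δ := by
  rcases hr with ⟨rfl, σ, hσ, hrσ, hσn⟩ | rfl
  · obtain ⟨δ, C, hδ, hδR, hC, hCδ, hcmp⟩ := exists_metric_comparison hR hg
    have hsub : Metric.ball (0 : Space m) δ ⊆ Metric.ball 0 R := Metric.ball_subset_ball hδR
    -- The upper and lower distance bounds, the latter with ρ = ‖x‖, pinch r² between (1 ±
    -- C‖x‖)‖x‖².
    obtain ⟨t0, t1, t2⟩ := taylor_of_half_ball (C := C) hδ (hσ.mono hsub) (by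
      rintro x ⟨hx, hxH⟩
      have hxδ : ‖x‖ < δ := by simpa using hx
      have hxc : x ∈ chart m R := by rw [chart_eq]; exact ⟨hsub hx, hxH⟩
      have hCx : C * ‖x‖ ≤ 1 / 2 := (by gcongr : C * ‖x‖ ≤ C * δ).trans hCδ
      rw [← hrσ x hxc]
      have h1 := riemDist_le hg hcmp hC hxc hxδ
      have h2 := le_riemDist hg hcmp hC hxδ.le (by linarith) hxc le_rfl
      have h3 : riemDist g R x ^ 2 ≤ (√(1 + C * ‖x‖) * ‖x‖) ^ 2 :=
        pow_le_pow_left₀ (riemDist_nonneg x) h1 2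
      have h4 : (√(1 - C * ‖x‖) * ‖x‖) ^ 2 ≤ riemDist g R x ^ 2 :=
        pow_le_pow_left₀ (by positivity) h2 2
      rw [mul_pow, Real.sq_sqrt (by positivity)] at h3
      rw [mul_pow, Real.sq_sqrt (by linarith)] at h4
      rw [abs_le]
      constructor <;> nlinarith)
    refine ⟨σ, ⟨hσ, t0, t1, t2, hσn⟩, fun x hx => ?_, fun δ' hδ' => ?_⟩
    · rw [← hrσ x hx, Real.sqrt_sq (riemDist_nonneg x)]
    -- A point with ‖x‖ ≥ ρ has distance at least √(1 - Cρ) ρ, so a smaller r forces x into the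
    -- Euclidean ball.
    · set ρ := min δ δ'
      have hρ : 0 < ρ := lt_min hδ hδ'
      have hCρ : C * ρ ≤ 1 / 2 := (by gcongr; exact min_le_left _ _ : C * ρ ≤ C * δ).trans hCδ
      have hpos : 0 < √(1 - C * ρ) * ρ := mul_pos (Real.sqrt_pos.2 (by linarith)) hρ
      refine ⟨_, hpos, fun x hx => ?_⟩
      have hx1 : x ∈ chart m R := hx.1
      have hx2 : riemDist g R x < √(1 - C * ρ) * ρ := hx.2
      by_contra hxδ
      have h1 : ρ ≤ ‖x‖ := by
        have : δ' ≤ ‖x‖ := by simpa using hxδ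
        exact (min_le_right _ _).trans this
      exact absurd (le_riemDist hg hcmp hC (min_le_left _ _) (by linarith) hx1 h1) (not_le.2 hx2)
  · have hpd : ∀ i, pd i (fun y : Space m => ‖y‖ ^ 2) = fun y => 2 * y i := fun i => by
      funext x; exact pd_norm_sq i x
    refine ⟨fun x => ‖x‖ ^ 2, ⟨(contDiff_norm_sq ℝ).contDiffOn, by simp, fun i => by simp [hpd],
      fun i j => ?_, fun x _ hx => by simp [hpd, hx]⟩, fun x _ => ?_, fun δ hδ => ⟨δ, hδ, ?_⟩⟩
    · rw [hpd, pd_const_mul _ (by fun_prop), pd_coord]; simp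
    · rw [Real.sqrt_sq (norm_nonneg _)]
    · intro x hx
      simpa using hx.2

end SquaredDistance

/-! ### Conjugation of the divergence form operator by a function of ln r. -/

section Conjugation

open Filter Topology

variable {m : ℕ}

theorem alongField_mul {X : Fin (m + 1) → Space m → ℝ} {f g : Space m → ℝ} {x : Space m}
    (hf : DifferentiableAt ℝ f x) (hg : DifferentiableAt ℝ g x) :
    alongField X (fun y => f y * g y) x = alongField X f x * g x + f x * alongField X g x := by
  simp only [alongField, Finset.mul_sum, Finset.sum_mul, ← Finset.sum_add_distrib]
  refine Finset.sum_congr rfl fun i _ => ?_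
  rw [pd_mul hf hg]; ring

theorem alongField_add {X : Fin (m + 1) → Space m → ℝ} {f g : Space m → ℝ} {x : Space m}
    (hf : DifferentiableAt ℝ f x) (hg : DifferentiableAt ℝ g x) :
    alongField X (fun y => f y + g y) x = alongField X f x + alongField X g x := by
  simp only [alongField, ← Finset.sum_add_distrib]
  refine Finset.sum_congr rfl fun i _ => ?_
  rw [pd_add hf hg]; ring

theorem alongField_comp {X : Fin (m + 1) → Space m → ℝ} {f : Space m → ℝ} {x : Space m}
    {φ : ℝ → ℝ} {φ' : ℝ} (hφ : HasDerivAt φ φ' (f x)) (hf : DifferentiableAt ℝ f x) :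
    alongField X (fun y => φ (f y)) x = φ' * alongField X f x := by
  simp only [alongField, Finset.mul_sum]
  refine Finset.sum_congr rfl fun i _ => ?_
  rw [pd_comp hφ hf]; ring

theorem gradForm_comp {a : Fin (m + 1) → Fin (m + 1) → Space m → ℝ} {f u : Space m → ℝ}
    {x : Space m} {φ : ℝ → ℝ} {φ' : ℝ} (hφ : HasDerivAt φ φ' (f x))
    (hf : DifferentiableAt ℝ f x) :
    gradForm a (fun y => φ (f y)) u x = φ' * gradForm a f u x := by
  simp only [gradForm, Finset.mul_sum]
  refine Finset.sum_congr rfl fun i _ => ?_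
  rw [pd_comp hφ hf]; ring

variable {gi : Fin (m + 1) → Fin (m + 1) → Space m → ℝ} {J σ : Space m → ℝ} {x : Space m}

theorem exp_two_logRadius (hσ : 0 < σ x) : Real.exp (2 * logRadius σ x) = σ x := by
  rw [logRadius, ← mul_assoc]; norm_num; exact Real.exp_log hσ

theorem exp_logRadius (hσ : 0 < σ x) : Real.exp (logRadius σ x) = √(σ x) := by
  rw [Real.sqrt_eq_rpow, Real.rpow_def_of_pos hσ, logRadius, mul_comm]

theorem differentiableAt_logRadius (hσ : 0 < σ x) (hd : DifferentiableAt ℝ σ x) :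
    DifferentiableAt ℝ (logRadius σ) x :=
  (hd.log hσ.ne').const_mul _

theorem pd_logRadius (hσ : 0 < σ x) (hd : DifferentiableAt ℝ σ x) (i : Fin (m + 1)) :
    pd i (logRadius σ) x = pd i σ x / (2 * σ x) := by
  have : pd i (logRadius σ) x = 1 / 2 * pd i (fun y => Real.log (σ y)) x :=
    pd_const_mul _ (hd.log hσ.ne')
  rw [this, pd_comp (Real.hasDerivAt_log hσ.ne') hd]
  field_simp

theorem alongField_logRadius (hσ : 0 < σ x) (hd : DifferentiableAt ℝ σ x) :
    alongField (radialField gi σ) (logRadius σ) x = radialSpeed gi σ x := by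
  simp only [radialSpeed, alongField, pd_logRadius hσ hd, Finset.sum_div]
  refine Finset.sum_congr rfl fun i _ => ?_
  ring

/-- Since ∇ ln r = ∇σ/(2σ), the flux of ln r is r⁻²JX. Derivatives against radial functions thus
become derivatives along X. -/
theorem fluxField_logRadius (hσ : 0 < σ x) (hd : DifferentiableAt ℝ σ x) (i : Fin (m + 1)) :
    fluxField (densityCoeff gi J) (logRadius σ) i x =
      Real.exp (-2 * logRadius σ x) * (J x * radialField gi σ i x) := by
  have : Real.exp (-2 * logRadius σ x) = (σ x)⁻¹ := by
    rw [show -2 * logRadius σ x = -(2 * logRadius σ x) by ring, Real.exp_neg, exp_two_logRadius hσ]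
  rw [this]
  simp only [fluxField, radialField, densityCoeff, pd_logRadius hσ hd, Finset.mul_sum]
  refine Finset.sum_congr rfl fun j _ => ?_
  field_simp

theorem gradForm_comm {a : Fin (m + 1) → Fin (m + 1) → Space m → ℝ}
    (hs : ∀ i j, a i j x = a j i x) (f u : Space m → ℝ) : gradForm a f u x = gradForm a u f x := by
  simp only [gradForm, fluxField, Finset.mul_sum]
  rw [Finset.sum_comm]
  refine Finset.sum_congr rfl fun i _ => Finset.sum_congr rfl fun j _ => ?_
  rw [hs j i]; ring

theorem gradForm_logRadius (hs : ∀ i j, gi i j x = gi j i x) (hσ : 0 < σ x)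
    (hd : DifferentiableAt ℝ σ x) (u : Space m → ℝ) :
    gradForm (densityCoeff gi J) (logRadius σ) u x =
      Real.exp (-2 * logRadius σ x) * (J x * alongField (radialField gi σ) u x) := by
  rw [gradForm_comm (fun i j => by simp [densityCoeff, hs i j])]
  simp only [gradForm, fluxField_logRadius hσ hd, alongField, Finset.mul_sum]
  refine Finset.sum_congr rfl fun i _ => ?_
  ring

/-- Conjugation of the operator `div(a∇·)` by a function of the logarithm of the radius. -/
theorem divField_fluxField_conj {Ω p : ℝ → ℝ} {p' : ℝ} {U : Set (Space m)} (hU : IsOpen U)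
    (hx : x ∈ U) (hσ : ∀ y ∈ U, 0 < σ y)
    (hΩ : ∀ y ∈ U, HasDerivAt Ω (-(p (logRadius σ y)) * Ω (logRadius σ y)) (logRadius σ y))
    (hp : HasDerivAt p p' (logRadius σ x))
    (hs : ∀ i j, gi i j x = gi j i x)
    (hgi : ∀ i j, ContDiffOn ℝ ∞ (gi i j) U) (hJ : ContDiffOn ℝ ∞ J U)
    (hσs : ContDiffOn ℝ ∞ σ U) {v : Space m → ℝ} (hv : ContDiffOn ℝ ∞ v U)
    {u : Space m → ℝ} (hu : u = fun y => Ω (logRadius σ y) * v y) :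
    divField (fluxField (densityCoeff gi J) u) x =
      Ω (logRadius σ x) * divField (fluxField (densityCoeff gi J) v) x
      + Real.exp (-2 * logRadius σ x) * (
        - J x * p (logRadius σ x) * (alongField (radialField gi σ) u x
          + p (logRadius σ x) * radialSpeed gi σ x * u x)
        - p (logRadius σ x) * u x * divField (fun i y => J y * radialField gi σ i y) x
        + J x * (-p' * radialSpeed gi σ x * u x
          - p (logRadius σ x) * alongField (radialField gi σ) u x
          + 2 * p (logRadius σ x) * radialSpeed gi σ x * u x)) := by
  set a := densityCoeff gi J
  set X := radialField gi σ with hX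
  set t := logRadius σ with ht
  have hσd : ∀ y ∈ U, DifferentiableAt ℝ σ y := fun y hy =>
    differentiableAt_of_contDiffOn hU hσs hy
  have htd : ∀ y ∈ U, DifferentiableAt ℝ t y := fun y hy =>
    differentiableAt_logRadius (hσ y hy) (hσd y hy)
  have hvd : ∀ y ∈ U, DifferentiableAt ℝ v y := fun y hy =>
    differentiableAt_of_contDiffOn hU hv hy
  have hΩd : ∀ y ∈ U, DifferentiableAt ℝ (fun z => Ω (t z)) y := fun y hy =>
    (hΩ y hy).differentiableAt.comp y (htd y hy)
  have hXs : ∀ i, ContDiffOn ℝ ∞ (X i) U := contDiffOn_radialField hU hgi hσs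
  have hJX : ∀ i, DifferentiableAt ℝ (fun y => J y * X i y) x := fun i =>
    differentiableAt_of_contDiffOn hU (hJ.mul (hXs i)) hx
  have hud : DifferentiableAt ℝ u x := by rw [hu]; exact (hΩd x hx).mul (hvd x hx)
  have hpd_u : ∀ y ∈ U, ∀ j, pd j u y = Ω (t y) * pd j v y - p (t y) * u y * pd j t y := by
    intro y hy j
    rw [hu, pd_mul (hΩd y hy) (hvd y hy), pd_comp (hΩ y hy) (htd y hy)]; ring
  -- The derivative of Ω contributes -p u ∇τ to ∇u, and the flux of τ is r⁻²JX; the divergence is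
  -- then taken of each of the two summands.
  have hflux : ∀ i, ∀ y ∈ U, fluxField a u i y =
      Ω (t y) * fluxField a v i y + (-(p (t y) * u y) * Real.exp (-2 * t y)) * (J y * X i y) := by
    intro i y hy
    have := fluxField_logRadius (gi := gi) (J := J) (hσ y hy) (hσd y hy) i
    rw [mul_assoc, ← this]
    simp only [fluxField, hpd_u y hy, Finset.mul_sum, ← Finset.sum_add_distrib]
    refine Finset.sum_congr rfl fun j _ => ?_
    ring
  have hav : ∀ i, DifferentiableAt ℝ (fluxField a v i) x := fun i =>
    differentiableAt_of_contDiffOn hU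
      (contDiffOn_fluxField hU (fun i j => hJ.mul (hgi i j)) hv i) hx
  have hcd : DifferentiableAt ℝ (fun y => -(p (t y) * u y) * Real.exp (-2 * t y)) x :=
    ((hp.differentiableAt.comp x (htd x hx)).fun_mul hud).fun_neg.fun_mul
      ((htd x hx).const_mul (-2)).exp
  have hdiv : divField (fluxField a u) x = divField (fun i y => Ω (t y) * fluxField a v i y +
      (-(p (t y) * u y) * Real.exp (-2 * t y)) * (J y * X i y)) x := by
    refine Finset.sum_congr rfl fun i _ => pd_congr ?_
    filter_upwards [hU.mem_nhds hx] with y hy using hflux i y hy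
  rw [hdiv, divField_add (fun i => (hΩd x hx).fun_mul (hav i)) (fun i => hcd.fun_mul (hJX i)),
    divField_smul (hΩd x hx) hav, divField_smul hcd hJX]
  have e1 : ∑ i, pd i (fun y => Ω (t y)) x * fluxField a v i x =
      -(p (t x)) * Ω (t x) * (Real.exp (-2 * t x) * (J x * alongField X v x)) := by
    have h1 := gradForm_comp (a := a) (u := v) (hΩ x hx) (htd x hx)
    rw [gradForm_logRadius hs (hσ x hx) (hσd x hx)] at h1
    exact h1
  have hexp : HasDerivAt (fun τ : ℝ => Real.exp (-2 * τ)) (Real.exp (-2 * t x) * (-2)) (t x) := by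
    have := ((hasDerivAt_id (t x)).const_mul (-2)).exp
    simpa using this
  have e2 : ∑ i, pd i (fun y => -(p (t y) * u y) * Real.exp (-2 * t y)) x * (J x * X i x) =
      J x * (Real.exp (-2 * t x) * (-p' * radialSpeed gi σ x * u x - p (t x) * alongField X u x
        + 2 * p (t x) * radialSpeed gi σ x * u x)) := by
    have h1 : ∑ i, pd i (fun y => -(p (t y) * u y) * Real.exp (-2 * t y)) x * (J x * X i x) =
        J x * alongField X (fun y => -(p (t y) * u y) * Real.exp (-2 * t y)) x := by
      simp only [alongField, Finset.mul_sum]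
      exact Finset.sum_congr rfl fun i _ => by ring
    have hpt : DifferentiableAt ℝ (fun y => p (t y)) x := hp.differentiableAt.comp x (htd x hx)
    have h2 : alongField X (fun y => -(p (t y) * u y)) x =
        -(p' * radialSpeed gi σ x * u x + p (t x) * alongField X u x) := by
      have h3 : alongField X (fun y => -(p (t y) * u y)) x =
          - alongField X (fun y => p (t y) * u y) x := by
        simp only [alongField, pd_neg, mul_neg, Finset.sum_neg_distrib]
      rw [h3, alongField_mul hpt hud, alongField_comp hp (htd x hx),
        alongField_logRadius (hσ x hx) (hσd x hx)]
    rw [h1, alongField_mul (hpt.fun_mul hud).fun_neg ((htd x hx).const_mul (-2)).exp, h2,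
      alongField_comp hexp (htd x hx), alongField_logRadius (hσ x hx) (hσd x hx)]
    ring
  have e3 : Ω (t x) * alongField X v x =
      alongField X u x + p (t x) * radialSpeed gi σ x * u x := by
    have : alongField X u x = Ω (t x) * alongField X v x
        - p (t x) * radialSpeed gi σ x * u x := by
      rw [← alongField_logRadius (gi := gi) (hσ x hx) (hσd x hx)]
      simp only [alongField, hpd_u x hx, Finset.mul_sum, Finset.sum_mul, ← Finset.sum_sub_distrib]
      refine Finset.sum_congr rfl fun i _ => ?_
      rw [← hX, ← ht]
      ring
    rw [this]; ring
  rw [e1, e2]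
  have e4 : -(p (t x)) * Ω (t x) * (Real.exp (-2 * t x) * (J x * alongField X v x)) =
      -(p (t x)) * Real.exp (-2 * t x) * J x * (Ω (t x) * alongField X v x) := by ring
  rw [e4, e3]
  ring

end Conjugation

/-! ### The one-variable weights and their derivatives. -/

section Weights

/-- The derivative of the conjugated Carleman weight, shifted by the spectral constant. -/
noncomputable def carlemanP (β τ : ℝ) : ℝ := β * (1 + 2 / τ) - 1

/-- The multiplier which compensates the negative gradient term of the Rellich identity. -/
noncomputable def carlemanS (β τ : ℝ) : ℝ := 3 * β / τ ^ 2

/-- The conjugating function `r^{n/2} e^{βψ}` in terms of `τ = ln r`, for `n = m + 1`. -/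
noncomputable def conjWeight (m : ℕ) (β τ : ℝ) : ℝ := Real.exp ((m + 1) / 2 * τ - β * phi τ)

variable {m : ℕ} {β τ : ℝ}

theorem hasDerivAt_carlemanP (hτ : τ ≠ 0) : HasDerivAt (carlemanP β) (-2 * β * (1 / τ ^ 2)) τ := by
  have h1 : HasDerivAt (fun s : ℝ => β * (1 + 2 * s⁻¹) - 1) (β * (2 * -(τ ^ 2)⁻¹)) τ :=
    ((((hasDerivAt_inv hτ).const_mul 2).const_add 1).const_mul β).sub_const 1
  exact h1.congr_deriv (by field_simp)

theorem hasDerivAt_carlemanS (hτ : τ ≠ 0) : HasDerivAt (carlemanS β) (-6 * β / τ ^ 3) τ := by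
  have h1 : HasDerivAt (fun s : ℝ => 3 * β * (s ^ 2)⁻¹) _ τ :=
    ((hasDerivAt_pow 2 τ).fun_inv (pow_ne_zero 2 hτ)).const_mul (3 * β)
  exact h1.congr_deriv (by field_simp; norm_num; ring)

theorem hasDerivAt_exp_mul (c : ℝ) :
    HasDerivAt (fun s : ℝ => Real.exp (c * s)) (c * Real.exp (c * τ)) τ := by
  have h : HasDerivAt (fun s : ℝ => c * s) (c * 1) τ := (hasDerivAt_id τ).const_mul c
  exact h.exp.congr_deriv (by ring)

theorem hasDerivAt_phi (hτ : τ ≠ 0) : HasDerivAt phi (1 + 2 / τ) τ := by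
  have h1 : HasDerivAt (fun s : ℝ => s + Real.log (s ^ 2)) _ τ :=
    (hasDerivAt_id τ).fun_add ((hasDerivAt_pow 2 τ).log (pow_ne_zero 2 hτ))
  exact h1.congr_deriv (by field_simp; norm_num; ring)

/-- The logarithmic derivative of r^{n/2}e^{βψ} is -(P - k) with k = (n - 2)/2 = (m - 1)/2. After
conjugation of r²Δ = ∂τ² + (n - 2)∂τ + … the first order coefficient 2(P - k) + (n - 2) is split as
2P plus the n - 2 kept with Λ, and (P - k)² + (n - 2)(P - k) = P² - k². -/
theorem hasDerivAt_conjWeight (hτ : τ ≠ 0) :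
    HasDerivAt (conjWeight m β) (-(carlemanP β τ - (m - 1) / 2) * conjWeight m β τ) τ := by
  have h0 : HasDerivAt (fun s : ℝ => ((m : ℝ) + 1) / 2 * s) (((m : ℝ) + 1) / 2 * 1) τ :=
    (hasDerivAt_id τ).const_mul _
  have h1 : HasDerivAt (conjWeight m β) _ τ := (h0.fun_sub ((hasDerivAt_phi hτ).const_mul β)).exp
  refine h1.congr_deriv ?_
  simp only [conjWeight, carlemanP]; ring

theorem conjWeight_sq : conjWeight m β τ ^ 2 =
    Real.exp ((m + 1) * τ) * Real.exp (β * -phi τ) ^ 2 := by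
  rw [conjWeight, ← Real.exp_nat_mul, ← Real.exp_nat_mul, ← Real.exp_add]
  congr 1; push_cast; ring

/-- For τ ≤ -10 the factor 1 + 2/τ is at least 4/5, and β ≥ 20 absorbs the -1 in the remaining β/20.
-/
theorem carlemanP_bounds (hτ : τ ≤ -10) (hβ : 20 ≤ β) :
    3 / 4 * β ≤ carlemanP β τ ∧ carlemanP β τ ≤ β := by
  have h1 : -(1 / 5) ≤ 2 / τ := by
    rw [le_div_iff_of_neg (by linarith)]; linarith
  have h2 : 2 / τ ≤ 0 := div_nonpos_of_nonneg_of_nonpos (by norm_num) (by linarith)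
  unfold carlemanP
  constructor <;> nlinarith

end Weights

/-! ### An abstract bound for the boundary correction. -/

section BoundaryTerm

/-- The contribution of the boundary correction is of lower order. -/
theorem abs_boundary_term_le {n K K₂ β z S r u v₁ y ζ Xζ ζn w dX sk η ηn un : ℝ}
    (hK : 1 ≤ K) (hβ : 1 ≤ β) (hz : 0 < z) (hr : 0 < r) (hS : S = r ^ 2) (hn : 1 ≤ n)
    (hK₂ : 0 ≤ K₂) (hy : (r * v₁) ^ 2 ≤ 2 * y)
    (hζ : |ζ| ≤ 2 * K * (z * β ^ 2 * S)) (hζn : |ζn| ≤ K₂ * (z * β ^ 2 * r))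
    (hXζ : |Xζ| ≤ n * K * K₂ * (z * β ^ 2 * S)) (hw : |w| ≤ n * K * r * v₁)
    (hdX : |dX| ≤ n * K) (hsk : |sk| ≤ n * K * v₁) (hη : |η| ≤ K * (z * β ^ 2 * S))
    (hηn : |ηn| ≤ K₂ * (z * β ^ 2 * r)) (hun : |un| ≤ v₁) :
    |2 * u * (Xζ * un - ζn * w + ζ * (dX * un - sk)) + (ηn * u ^ 2 + 2 * η * u * un)| ≤
      (4 * n * K * K₂ + 8 * n * K ^ 2 + 2 * K + K₂) * r * z * (β ^ 3 * u ^ 2 + β * y) := by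
  have hS0 : 0 < S := by rw [hS]; positivity
  have hβ0 : 0 < β := by linarith
  have hA : 0 < z * β ^ 2 * S := by positivity
  have a1 : |Xζ * un| ≤ n * K * K₂ * (z * β ^ 2 * S) * v₁ := by
    rw [abs_mul]; exact mul_le_mul hXζ hun (abs_nonneg _) (by positivity)
  have a2 : |ζn * w| ≤ n * K * K₂ * (z * β ^ 2 * S) * v₁ := by
    rw [abs_mul]
    calc |ζn| * |w| ≤ K₂ * (z * β ^ 2 * r) * (n * K * r * v₁) :=
          mul_le_mul hζn hw (abs_nonneg _) (by positivity)
      _ = _ := by rw [hS]; ring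
  have a3 : |dX * un - sk| ≤ 2 * (n * K * v₁) := by
    calc |dX * un - sk| ≤ |dX * un| + |sk| := abs_sub _ _
      _ ≤ n * K * v₁ + n * K * v₁ := by
          rw [abs_mul]; gcongr
      _ = _ := by ring
  have a4 : |ζ * (dX * un - sk)| ≤ 4 * n * K ^ 2 * (z * β ^ 2 * S) * v₁ := by
    rw [abs_mul]
    calc |ζ| * |dX * un - sk| ≤ 2 * K * (z * β ^ 2 * S) * (2 * (n * K * v₁)) :=
          mul_le_mul hζ a3 (abs_nonneg _) (by positivity)
      _ = _ := by ring
  have a5 : |2 * u * (Xζ * un - ζn * w + ζ * (dX * un - sk))| ≤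
      (4 * n * K * K₂ + 8 * n * K ^ 2) * (z * β ^ 2 * S) * (|u| * v₁) := by
    rw [abs_mul, abs_mul, abs_two]
    have : |Xζ * un - ζn * w + ζ * (dX * un - sk)| ≤
        (2 * n * K * K₂ + 4 * n * K ^ 2) * (z * β ^ 2 * S) * v₁ := by
      calc _ ≤ |Xζ * un - ζn * w| + |ζ * (dX * un - sk)| := abs_add_le _ _
        _ ≤ |Xζ * un| + |ζn * w| + |ζ * (dX * un - sk)| := by gcongr; exact abs_sub _ _
        _ ≤ _ := by linarith
    calc 2 * |u| * _ ≤ 2 * |u| * ((2 * n * K * K₂ + 4 * n * K ^ 2) * (z * β ^ 2 * S) * v₁) := by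
          gcongr
      _ = _ := by ring
  have a6 : |ηn * u ^ 2| ≤ K₂ * (z * β ^ 2 * r) * u ^ 2 := by
    rw [abs_mul, abs_of_nonneg (sq_nonneg u)]; gcongr
  have a7 : |2 * η * u * un| ≤ 2 * K * (z * β ^ 2 * S) * (|u| * v₁) := by
    rw [abs_mul, abs_mul, abs_mul, abs_two]
    calc 2 * |η| * |u| * |un| ≤ 2 * (K * (z * β ^ 2 * S)) * |u| * v₁ := by gcongr
      _ = _ := by ring
  -- Young's inequality balanced by β, so that multiplication by β² produces r times the terms β³u²
  -- + βy that the estimate controls.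
  have b1 : S * (|u| * v₁) ≤ r * (β * u ^ 2 + y / β) := by
    have h1 : 2 * (|u| * (r * v₁)) ≤ β * u ^ 2 + (r * v₁) ^ 2 / β := by
      have := sq_nonneg (β * |u| - r * v₁)
      rw [← sub_nonneg]
      have e : β * u ^ 2 + (r * v₁) ^ 2 / β - 2 * (|u| * (r * v₁)) =
          (β * |u| - r * v₁) ^ 2 / β := by
        rw [← sq_abs u]; field_simp; ring
      rw [e]; positivity
    have h2 : (r * v₁) ^ 2 / β ≤ 2 * y / β := by gcongr
    have h3 : 0 ≤ β * u ^ 2 := by positivity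
    calc S * (|u| * v₁) = r * (|u| * (r * v₁)) := by rw [hS]; ring
      _ ≤ r * (β * u ^ 2 + y / β) := by
          gcongr
          have : 2 * y / β = 2 * (y / β) := by ring
          linarith
  have hy0 : 0 ≤ y := by nlinarith [sq_nonneg (r * v₁)]
  have b2 : u ^ 2 ≤ β * u ^ 2 + y / β := by
    have : 0 ≤ y / β := by positivity
    nlinarith [sq_nonneg u]
  have e0 : β ^ 3 * u ^ 2 + β * y = β ^ 2 * (β * u ^ 2 + y / β) := by field_simp
  set Y := β * u ^ 2 + y / β
  have c1 : (z * β ^ 2 * S) * (|u| * v₁) ≤ z * β ^ 2 * (r * Y) := by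
    calc (z * β ^ 2 * S) * (|u| * v₁) = z * β ^ 2 * (S * (|u| * v₁)) := by ring
      _ ≤ _ := by gcongr
  rw [e0]
  calc _ ≤ |2 * u * (Xζ * un - ζn * w + ζ * (dX * un - sk))|
        + (|ηn * u ^ 2| + |2 * η * u * un|) :=
        (abs_add_le _ _).trans (by gcongr; exact abs_add_le _ _)
    _ ≤ (4 * n * K * K₂ + 8 * n * K ^ 2) * ((z * β ^ 2 * S) * (|u| * v₁))
        + (K₂ * (z * β ^ 2 * r) * u ^ 2 + 2 * K * ((z * β ^ 2 * S) * (|u| * v₁))) := by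
        linarith
    _ ≤ (4 * n * K * K₂ + 8 * n * K ^ 2) * (z * β ^ 2 * (r * Y))
        + (K₂ * (z * β ^ 2 * r) * Y + 2 * K * (z * β ^ 2 * (r * Y))) := by gcongr
    _ = _ := by ring

end BoundaryTerm

/-! ### The coefficients of the Carleman field and the algebra of its divergence. -/

section PointwiseEstimate

open Filter Topology

variable {m : ℕ}

/-- The coefficient of the Rellich field. -/
noncomputable def rellichCoeff (m : ℕ) (β τ : ℝ) : ℝ :=
  2 * carlemanP β τ * Real.exp ((1 - m) * τ)

/-- The coefficient of the field `u a∇u`. -/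
noncomputable def gradCoeff (m : ℕ) (β τ : ℝ) : ℝ :=
  2 * carlemanS β τ * Real.exp ((1 - m) * τ)

/-- The zeroth order coefficient of the conjugated operator. -/
noncomputable def potential (gi : Fin (m + 1) → Fin (m + 1) → Space m → ℝ) (σ : Space m → ℝ)
    (β : ℝ) (E : Space m → ℝ) (y : Space m) : ℝ :=
  (carlemanP β (logRadius σ y) ^ 2 - ((m - 1) / 2) ^ 2) * radialSpeed gi σ y
    + Real.exp (2 * logRadius σ y) * E y

/-- The coefficient of the field `u² X`. -/
noncomputable def zerothCoeff (gi : Fin (m + 1) → Fin (m + 1) → Space m → ℝ) (σ : Space m → ℝ)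
    (β ρ : ℝ) (E : Space m → ℝ) (y : Space m) : ℝ :=
  (2 * (carlemanP β (logRadius σ y) * potential gi σ β E y)
    + 1 / 2 * β ^ 2 * ρ * Real.exp (-1 * logRadius σ y)) * Real.exp (-(m + 1) * logRadius σ y)

/-- The conjugated function. -/
noncomputable def conjFun (σ : Space m → ℝ) (β : ℝ) (v : Space m → ℝ) (y : Space m) : ℝ :=
  conjWeight m β (logRadius σ y) * v y

/-- The field of the Carleman estimate for the weight of parameter `β`. -/
noncomputable def weightedField (gi : Fin (m + 1) → Fin (m + 1) → Space m → ℝ)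
    (J σ : Space m → ℝ) (β ρ : ℝ) (E h v : Space m → ℝ) : Fin (m + 1) → Space m → ℝ :=
  carlemanField (densityCoeff gi J) (radialField gi σ) J (conjFun σ β v)
    (fun y => rellichCoeff m β (logRadius σ y)) (zerothCoeff gi σ β ρ E)
    (fun y => gradCoeff m β (logRadius σ y))
    (fun y => rellichCoeff m β (logRadius σ y) * J y * h y)
    (fun y => gradCoeff m β (logRadius σ y) * J y * h y)

theorem hasDerivAt_rellichCoeff {β τ : ℝ} (hτ : τ ≠ 0) : HasDerivAt (rellichCoeff m β)
    ((2 * (-2 * β * (1 / τ ^ 2)) + (1 - m) * (2 * carlemanP β τ)) * Real.exp ((1 - m) * τ)) τ := by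
  have h : HasDerivAt (rellichCoeff m β) _ τ :=
    ((hasDerivAt_carlemanP (β := β) hτ).const_mul 2).fun_mul (hasDerivAt_exp_mul (1 - m))
  exact h.congr_deriv (by ring)

theorem hasDerivAt_gradCoeff {β τ : ℝ} (hτ : τ ≠ 0) : HasDerivAt (gradCoeff m β)
    ((2 * (-6 * β / τ ^ 3) + (1 - m) * (2 * carlemanS β τ)) * Real.exp ((1 - m) * τ)) τ := by
  have h : HasDerivAt (gradCoeff m β) _ τ :=
    ((hasDerivAt_carlemanS (β := β) hτ).const_mul 2).fun_mul (hasDerivAt_exp_mul (1 - m))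
  exact h.congr_deriv (by ring)

theorem abs_pd_mul_mul_le {f J h : Space m → ℝ} {x : Space m} {i : Fin (m + 1)} {A A' B B' D D' : ℝ}
    (hf : DifferentiableAt ℝ f x) (hJ : DifferentiableAt ℝ J x) (hh : DifferentiableAt ℝ h x)
    (h1 : |f x| ≤ A) (h1' : |pd i f x| ≤ A') (h2 : |J x| ≤ B) (h2' : |pd i J x| ≤ B')
    (h3 : |h x| ≤ D) (h3' : |pd i h x| ≤ D') :
    |pd i (fun y => f y * J y * h y) x| ≤ A' * B * D + A * B' * D + A * B * D' := by
  have hA : 0 ≤ A := (abs_nonneg _).trans h1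
  have hA' : 0 ≤ A' := (abs_nonneg _).trans h1'
  have hB : 0 ≤ B := (abs_nonneg _).trans h2
  have hB' : 0 ≤ B' := (abs_nonneg _).trans h2'
  rw [pd_mul (hf.fun_mul hJ) hh, pd_mul hf hJ]
  have e : (pd i f x * J x + f x * pd i J x) * h x + f x * J x * pd i h x =
      pd i f x * J x * h x + f x * pd i J x * h x + f x * J x * pd i h x := by ring
  rw [e]
  refine (abs_add_le _ _).trans (add_le_add ((abs_add_le _ _).trans (add_le_add ?_ ?_)) ?_)
  all_goals
    rw [abs_mul, abs_mul]
    gcongr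

/-- The algebra behind the pointwise estimate: the divergence of the Carleman field in terms of
normalized quantities. -/
theorem carleman_divergence_algebra {J S z n P P' s s' q d w u L GF D f₁ φ₁ f₂ Xf₂ f₃ φ₃ XPB B Λ y T
    corr κ : ℝ} (hJ : J ≠ 0) (hS : S ≠ 0) (hz : z ≠ 0)
    (hf₁ : f₁ = 2 * P * (z * S)) (hφ₁ : φ₁ = (2 * P' + (2 - n) * (2 * P)) * (z * S))
    (hf₂ : f₂ = (2 * (P * B) + κ) * z)
    (hXf₂ : Xf₂ = (2 * XPB - κ * q) * z + (2 * (P * B) + κ) * (-n * q * z))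
    (hf₃ : f₃ = 2 * s * (z * S)) (hφ₃ : φ₃ = (2 * s' + (2 - n) * (2 * s)) * (z * S))
    (hΛ : Λ = S / J * L - (n - 2) * w) (hy : GF = J / S * y)
    (hT : D = (2 - n) * GF + J / S * T) :
    f₁ * (2 * w * L + D) + (2 * w * (φ₁ * (S⁻¹ * (J * w))) - GF * (φ₁ * q))
      + f₂ * u ^ 2 * (J * (d + n * q)) + J * (Xf₂ * u ^ 2 + 2 * f₂ * u * w)
      - (f₃ * u * L + f₃ * GF + u * (φ₃ * (S⁻¹ * (J * w)))) + corr =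
    z * J * (2 * (Λ + B * u) * (2 * P * w - s * u) + 2 * s * B * u ^ 2 + 4 * P' * w ^ 2 + 2 * P * T
      + 2 * P * (2 - n) * (1 - q) * y - 2 * P' * q * y + 2 * XPB * u ^ 2 + 2 * P * B * d * u ^ 2
      - 2 * s * y - 2 * s' * u * w + corr / (z * J)
      + κ * ((d - q) * u ^ 2 + 2 * u * w)) := by
  subst hΛ hT hy hf₁ hφ₁ hf₂ hXf₂ hf₃ hφ₃
  field_simp
  ring

end PointwiseEstimate

/-! ### Size of the coefficients and their derivatives for τ ≤ -10. -/

section CoefficientBounds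

variable {m : ℕ} {β τ : ℝ}

theorem abs_carlemanP_deriv_le (hβ : 0 < β) (hτ : τ ≤ -10) :
    |(-2 * β * (1 / τ ^ 2) : ℝ)| ≤ β / 50 := by
  have h1 : 1 / τ ^ 2 ≤ 1 / 100 := one_div_le_one_div_of_le (by norm_num) (by nlinarith)
  have h0 : 0 ≤ 1 / τ ^ 2 := by positivity
  rw [show (-2 * β * (1 / τ ^ 2) : ℝ) = -(2 * β * (1 / τ ^ 2)) by ring, abs_neg,
    abs_of_nonneg (by positivity)]
  nlinarith

theorem abs_carlemanS_le (hβ : 0 < β) (hτ : τ ≤ -10) : |carlemanS β τ| ≤ β / 2 := by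
  have h1 : 1 / τ ^ 2 ≤ 1 / 100 := one_div_le_one_div_of_le (by norm_num) (by nlinarith)
  have h0 : 0 ≤ 1 / τ ^ 2 := by positivity
  rw [carlemanS, show 3 * β / τ ^ 2 = 3 * β * (1 / τ ^ 2) by ring, abs_of_nonneg (by positivity)]
  nlinarith

theorem sq_carlemanS_deriv (hτ : τ ≠ 0) :
    (-6 * β / τ ^ 3) ^ 2 = 36 * β ^ 2 * (1 / τ ^ 2) ^ 2 * (1 / τ ^ 2) := by
  field_simp; norm_num; ring

theorem abs_carlemanS_deriv_le (hβ : 0 < β) (hτ : τ ≤ -10) : |(-6 * β / τ ^ 3 : ℝ)| ≤ β := by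
  have h1 : 1 / τ ^ 2 ≤ 1 / 100 := one_div_le_one_div_of_le (by norm_num) (by nlinarith)
  have h0 : 0 ≤ 1 / τ ^ 2 := by positivity
  refine abs_le_of_sq_le_sq ?_ hβ.le
  rw [sq_carlemanS_deriv (by linarith)]
  have h2 : (1 / τ ^ 2) ^ 2 * (1 / τ ^ 2) ≤ 1 / 100 ^ 2 * (1 / 100) := by
    have : (1 / τ ^ 2) ^ 2 ≤ (1 / 100) ^ 2 := by gcongr
    calc _ ≤ (1 / 100 : ℝ) ^ 2 * (1 / 100) := by gcongr
      _ = _ := by norm_num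
  nlinarith [sq_nonneg β]

theorem abs_rellichCoeff_le (hβ : 20 ≤ β) (hτ : τ ≤ -10) :
    |rellichCoeff m β τ| ≤ 2 * β * Real.exp ((1 - m) * τ) := by
  obtain ⟨h1, h2⟩ := carlemanP_bounds hτ hβ
  rw [rellichCoeff, abs_mul, abs_mul, abs_two, abs_of_pos (Real.exp_pos _)]
  gcongr
  exact abs_le.2 ⟨by linarith, h2⟩

theorem abs_gradCoeff_le (hβ : 0 < β) (hτ : τ ≤ -10) :
    |gradCoeff m β τ| ≤ β * Real.exp ((1 - m) * τ) := by
  rw [gradCoeff, abs_mul, abs_mul, abs_two, abs_of_pos (Real.exp_pos _)]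
  gcongr
  linarith [abs_carlemanS_le hβ hτ]

theorem abs_rellichCoeff_deriv_le (hm : 1 ≤ m) (hβ : 20 ≤ β) (hτ : τ ≤ -10) :
    |(2 * (-2 * β * (1 / τ ^ 2)) + (1 - m) * (2 * carlemanP β τ)) * Real.exp ((1 - m) * τ)| ≤
      2 * (m + 1) * β * Real.exp ((1 - m) * τ) := by
  obtain ⟨h1, h2⟩ := carlemanP_bounds hτ hβ
  have hm0 : (1 : ℝ) ≤ m := by exact_mod_cast hm
  have hP : |carlemanP β τ| ≤ β := abs_le.2 ⟨by linarith, h2⟩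
  have hP' := abs_carlemanP_deriv_le (by linarith : 0 < β) hτ
  have h1m : |(1 - m : ℝ)| = m - 1 := by rw [abs_sub_comm, abs_of_nonneg (by linarith)]
  rw [abs_mul, abs_of_pos (Real.exp_pos _)]
  refine mul_le_mul_of_nonneg_right ?_ (Real.exp_pos _).le
  refine (abs_add_le _ _).trans ?_
  rw [abs_mul, abs_mul (1 - (m : ℝ)), abs_mul 2 (carlemanP β τ), abs_two, h1m]
  have h3 : ((m : ℝ) - 1) * (2 * |carlemanP β τ|) ≤ (m - 1) * (2 * β) := by
    have : (0 : ℝ) ≤ m - 1 := by linarith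
    gcongr
  linarith

theorem abs_gradCoeff_deriv_le (hm : 1 ≤ m) (hβ : 0 < β) (hτ : τ ≤ -10) :
    |(2 * (-6 * β / τ ^ 3) + (1 - m) * (2 * carlemanS β τ)) * Real.exp ((1 - m) * τ)| ≤
      2 * (m + 1) * β * Real.exp ((1 - m) * τ) := by
  have hm0 : (1 : ℝ) ≤ m := by exact_mod_cast hm
  have hS := abs_carlemanS_le hβ hτ
  have hS' := abs_carlemanS_deriv_le hβ hτ
  have h1m : |(1 - m : ℝ)| = m - 1 := by rw [abs_sub_comm, abs_of_nonneg (by linarith)]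
  rw [abs_mul, abs_of_pos (Real.exp_pos _)]
  refine mul_le_mul_of_nonneg_right ?_ (Real.exp_pos _).le
  refine (abs_add_le _ _).trans ?_
  rw [abs_mul, abs_mul (1 - (m : ℝ)), abs_mul 2 (carlemanS β τ), abs_two, h1m]
  have h3 : ((m : ℝ) - 1) * (2 * |carlemanS β τ|) ≤ (m - 1) * (2 * β) := by
    have : (0 : ℝ) ≤ m - 1 := by linarith
    gcongr
    linarith
  linarith

end CoefficientBounds

/-! ### Regularity and radial derivatives of the coefficients. -/

section Regularity

variable {m : ℕ} {gi : Fin (m + 1) → Fin (m + 1) → Space m → ℝ} {J σ : Space m → ℝ} {β ρ : ℝ}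
  {E : Space m → ℝ} {x : Space m} {O : Set (Space m)}

theorem contDiffOn_logRadius (hσ : ContDiffOn ℝ ∞ σ O) (hpos : ∀ y ∈ O, 0 < σ y) :
    ContDiffOn ℝ ∞ (logRadius σ) O :=
  contDiffOn_const.mul (hσ.log fun y hy => (hpos y hy).ne')

theorem contDiffOn_radialSpeed (hO : IsOpen O) (hgi : ∀ i j, ContDiffOn ℝ ∞ (gi i j) O)
    (hσ : ContDiffOn ℝ ∞ σ O) (hpos : ∀ y ∈ O, 0 < σ y) :
    ContDiffOn ℝ ∞ (radialSpeed gi σ) O :=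
  (contDiffOn_alongField hO (contDiffOn_radialField hO hgi hσ) hσ).div (contDiffOn_const.mul hσ)
    fun y hy => (mul_pos two_pos (hpos y hy)).ne'

theorem contDiffOn_conjFun (ht : ContDiffOn ℝ ∞ (logRadius σ) O)
    (hne : ∀ y ∈ O, logRadius σ y ≠ 0) {v : Space m → ℝ} (hv : ContDiffOn ℝ ∞ v O) :
    ContDiffOn ℝ ∞ (conjFun σ β v) O :=
  ((contDiffOn_const.mul ht).sub (contDiffOn_const.mul
    (ht.add ((ht.pow 2).log fun y hy => pow_ne_zero 2 (hne y hy))))).exp.mul hv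

variable (hσ : 0 < σ x) (hσd : DifferentiableAt ℝ σ x) (hτ : logRadius σ x ≠ 0)

include hσ hσd

theorem differentiableAt_exp_logRadius (c : ℝ) :
    DifferentiableAt ℝ (fun y => Real.exp (c * logRadius σ y)) x :=
  ((differentiableAt_logRadius hσ hσd).const_mul c).exp

include hτ

theorem differentiableAt_carlemanP :
    DifferentiableAt ℝ (fun y => carlemanP β (logRadius σ y)) x :=
  DifferentiableAt.comp (g := carlemanP β) (f := logRadius σ) x
    (hasDerivAt_carlemanP hτ).differentiableAt (differentiableAt_logRadius hσ hσd)

theorem differentiableAt_rellichCoeff :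
    DifferentiableAt ℝ (fun y => rellichCoeff m β (logRadius σ y)) x :=
  DifferentiableAt.comp (g := rellichCoeff m β) (f := logRadius σ) x
    (hasDerivAt_rellichCoeff hτ).differentiableAt (differentiableAt_logRadius hσ hσd)

theorem differentiableAt_gradCoeff :
    DifferentiableAt ℝ (fun y => gradCoeff m β (logRadius σ y)) x :=
  DifferentiableAt.comp (g := gradCoeff m β) (f := logRadius σ) x
    (hasDerivAt_gradCoeff hτ).differentiableAt (differentiableAt_logRadius hσ hσd)

variable (hq : DifferentiableAt ℝ (radialSpeed gi σ) x) (hE : DifferentiableAt ℝ E x)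

include hq hE

theorem differentiableAt_potential : DifferentiableAt ℝ (potential gi σ β E) x :=
  ((((differentiableAt_carlemanP hσ hσd hτ).fun_pow 2).sub_const _).fun_mul hq).fun_add
    ((differentiableAt_exp_logRadius hσ hσd 2).fun_mul hE)

theorem differentiableAt_zerothCoeff : DifferentiableAt ℝ (zerothCoeff gi σ β ρ E) x :=
  ((((differentiableAt_carlemanP hσ hσd hτ).fun_mul
    (differentiableAt_potential hσ hσd hτ hq hE)).const_mul 2).fun_add
      ((differentiableAt_exp_logRadius hσ hσd (-1)).const_mul _)).fun_mul
        (differentiableAt_exp_logRadius hσ hσd _)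

theorem alongField_potential :
    alongField (radialField gi σ) (potential gi σ β E) x =
      2 * carlemanP β (logRadius σ x) * (-2 * β * (1 / logRadius σ x ^ 2) * radialSpeed gi σ x)
        * radialSpeed gi σ x
      + (carlemanP β (logRadius σ x) ^ 2 - ((m - 1) / 2) ^ 2)
        * alongField (radialField gi σ) (radialSpeed gi σ) x
      + (2 * radialSpeed gi σ x * Real.exp (2 * logRadius σ x) * E x
        + Real.exp (2 * logRadius σ x) * alongField (radialField gi σ) E x) := by
  have htd := differentiableAt_logRadius hσ hσd
  have hXt := alongField_logRadius (gi := gi) hσ hσd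
  have dP := (differentiableAt_carlemanP (β := β) hσ hσd hτ)
  have hc : HasDerivAt (fun s => carlemanP β s ^ 2 - (((m : ℝ) - 1) / 2) ^ 2)
      (2 * carlemanP β (logRadius σ x) * (-2 * β * (1 / logRadius σ x ^ 2))) (logRadius σ x) := by
    have := ((hasDerivAt_carlemanP (β := β) hτ).fun_pow 2).sub_const ((((m : ℝ) - 1) / 2) ^ 2)
    exact this.congr_deriv (by norm_num)
  have h0 := alongField_comp (X := radialField gi σ) hc htd
  have h1 : alongField (radialField gi σ) (potential gi σ β E) x =
      alongField (radialField gi σ) (fun y =>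
        (carlemanP β (logRadius σ y) ^ 2 - ((m - 1) / 2) ^ 2) * radialSpeed gi σ y
          + Real.exp (2 * logRadius σ y) * E y) x := rfl
  rw [h1, alongField_add (((dP.fun_pow 2).sub_const _).fun_mul hq)
      ((differentiableAt_exp_logRadius hσ hσd 2).fun_mul hE),
    alongField_mul ((dP.fun_pow 2).sub_const _) hq,
    alongField_mul (differentiableAt_exp_logRadius hσ hσd 2) hE, h0,
    alongField_comp (hasDerivAt_exp_mul 2) htd, hXt]
  ring

theorem alongField_carlemanP_mul_potential :
    alongField (radialField gi σ)
        (fun y => carlemanP β (logRadius σ y) * potential gi σ β E y) x =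
      -2 * β * (1 / logRadius σ x ^ 2) * radialSpeed gi σ x * potential gi σ β E x
        + carlemanP β (logRadius σ x) * alongField (radialField gi σ) (potential gi σ β E) x := by
  rw [alongField_mul (differentiableAt_carlemanP hσ hσd hτ)
      (differentiableAt_potential hσ hσd hτ hq hE),
    alongField_comp (hasDerivAt_carlemanP hτ) (differentiableAt_logRadius hσ hσd),
    alongField_logRadius hσ hσd]

theorem alongField_zerothCoeff :
    alongField (radialField gi σ) (zerothCoeff gi σ β ρ E) x =
      (2 * alongField (radialField gi σ)
          (fun y => carlemanP β (logRadius σ y) * potential gi σ β E y) x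
        - 1 / 2 * β ^ 2 * ρ * Real.exp (-1 * logRadius σ x) * radialSpeed gi σ x)
          * Real.exp (-(m + 1) * logRadius σ x)
      + (2 * (carlemanP β (logRadius σ x) * potential gi σ β E x)
        + 1 / 2 * β ^ 2 * ρ * Real.exp (-1 * logRadius σ x))
          * (-((m : ℝ) + 1) * radialSpeed gi σ x * Real.exp (-(m + 1) * logRadius σ x)) := by
  have htd := differentiableAt_logRadius hσ hσd
  have hXt := alongField_logRadius (gi := gi) hσ hσd
  have dPB := (differentiableAt_carlemanP (β := β) hσ hσd hτ).fun_mul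
    (differentiableAt_potential (β := β) hσ hσd hτ hq hE)
  have de := fun c => differentiableAt_exp_logRadius hσ hσd c
  have h2 : ∀ c (f : Space m → ℝ), DifferentiableAt ℝ f x →
      alongField (radialField gi σ) (fun y => c * f y) x
        = c * alongField (radialField gi σ) f x := by
    intro c f hf
    have := alongField_comp (X := radialField gi σ) ((hasDerivAt_id (f x)).const_mul c) hf
    simpa using this
  have h1 : alongField (radialField gi σ) (zerothCoeff gi σ β ρ E) x =
      alongField (radialField gi σ) (fun y =>
        (2 * (carlemanP β (logRadius σ y) * potential gi σ β E y)
          + 1 / 2 * β ^ 2 * ρ * Real.exp (-1 * logRadius σ y))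
          * Real.exp (-(m + 1) * logRadius σ y)) x := rfl
  rw [h1, alongField_mul ((dPB.const_mul 2).fun_add ((de (-1)).const_mul _)) (de _),
    alongField_add (dPB.const_mul 2) ((de (-1)).const_mul _),
    h2 _ _ dPB, h2 _ _ (de (-1)), alongField_comp (hasDerivAt_exp_mul _) htd,
    alongField_comp (hasDerivAt_exp_mul _) htd, hXt]
  ring

end Regularity

/-! ### Geometric and boundary errors in units of r. -/

section GeometryBounds

variable {m : ℕ} {gi : Fin (m + 1) → Fin (m + 1) → Space m → ℝ} {J σ : Space m → ℝ} {δ K : ℝ}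
  {x : Space m}

/-- The constant controlling all first order errors in terms of the radius. -/
noncomputable def errorConst (m : ℕ) (K : ℝ) : ℝ :=
  2 * (4 * (m + 1) * K * ((m + 1) * K ^ 2 + 4 * K) + 8 * (m + 1) * K ^ 2 + 2 * K
    + ((m + 1) * K ^ 2 + 4 * K)) + 8

/-- One constant then dominates the divergence defect (m + 3)K, the deformation defect 4K and the 4
+ (m + 1)K coming from E. -/
theorem le_errorConst (hK : 1 ≤ K) : (m + 3) * K + 4 * K + 8 ≤ errorConst m K := by
  have hKK : K ≤ K ^ 2 := by nlinarith
  have hmK : m * K ≤ m * K ^ 2 := by gcongr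
  have : 0 ≤ 4 * ((m : ℝ) + 1) * K * ((m + 1) * K ^ 2 + 4 * K) := by positivity
  have : 0 ≤ m * K := by positivity
  rw [errorConst]
  nlinarith

theorem abs_pd_le_sqrt (u : Space m → ℝ) (x : Space m) (i : Fin (m + 1)) :
    |pd i u x| ≤ √(∑ i, pd i u x ^ 2) := by
  rw [← Real.sqrt_sq_eq_abs]
  exact Real.sqrt_le_sqrt (sq_le_sum_sq (fun i => pd i u x) i)

theorem abs_sum_mul_le {c d : Fin (m + 1) → ℝ} {A B : ℝ} (hc : ∀ i, |c i| ≤ A)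
    (hd : ∀ i, |d i| ≤ B) : |∑ i, c i * d i| ≤ (m + 1) * (A * B) := by
  have hA : 0 ≤ A := (abs_nonneg _).trans (hc 0)
  refine (Finset.abs_sum_le_sum_abs _ _).trans ?_
  have : ∀ i ∈ Finset.univ, |c i * d i| ≤ A * B := fun i _ => by
    rw [abs_mul]; exact mul_le_mul (hc i) (hd i) (abs_nonneg _) hA
  refine (Finset.sum_le_sum this).trans (by simp)

theorem exp_two_mul_eq_sq (τ : ℝ) : Real.exp (2 * τ) = Real.exp τ ^ 2 := by
  rw [← Real.exp_nat_mul]; norm_num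

theorem exp_one_sub_mul (m : ℕ) (τ : ℝ) :
    Real.exp ((1 - m) * τ) = Real.exp (-(m + 1) * τ) * Real.exp (2 * τ) := by
  rw [← Real.exp_add]; congr 1; ring

theorem gradForm_densityCoeff (gi : Fin (m + 1) → Fin (m + 1) → Space m → ℝ)
    (J σ u : Space m → ℝ)  (x : Space m) :
    gradForm (densityCoeff gi J) u u x =
    J x / Real.exp (2 * logRadius σ x) * (Real.exp (2 * logRadius σ x)
      * ∑ i, ∑ j, gi i j x * pd i u x * pd j u x) := by
  simp only [gradForm, fluxField, densityCoeff, Finset.mul_sum]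
  refine Finset.sum_congr rfl fun i _ => Finset.sum_congr rfl fun j _ => ?_
  have : Real.exp (2 * logRadius σ x) ≠ 0 := (Real.exp_pos _).ne'
  field_simp

namespace IsCarlemanGeometry

variable (G : IsCarlemanGeometry gi J σ δ K) (hx : x ∈ Metric.ball 0 δ) (hx0 : x ≠ 0)

include G hx

theorem J_pos : 0 < J x := by linarith [G.J_lower x hx]

theorem differentiableAt_σ : DifferentiableAt ℝ σ x :=
  differentiableAt_of_contDiffOn Metric.isOpen_ball G.smooth_σ hx

theorem mul_sum_sq_le (ξ : Fin (m + 1) → ℝ) :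
    Real.exp (2 * logRadius σ x) * ∑ i, ξ i ^ 2 ≤
      2 * (Real.exp (2 * logRadius σ x) * ∑ i, ∑ j, gi i j x * ξ i * ξ j) := by
  have := mul_le_mul_of_nonneg_left (G.elliptic x hx ξ) (Real.exp_pos (2 * logRadius σ x)).le
  linarith

include hx0

theorem sqrt_eq_exp : √(σ x) = Real.exp (logRadius σ x) :=
  (exp_logRadius (G.σ_pos x hx hx0)).symm

theorem abs_pd_logRadius_le (i : Fin (m + 1)) :
    |pd i (logRadius σ) x| ≤ K * Real.exp (logRadius σ x) / (2 * Real.exp (2 * logRadius σ x)) := by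
  have h := G.σ_pos x hx hx0
  rw [pd_logRadius h (G.differentiableAt_σ hx), abs_div, ← exp_two_logRadius h,
    abs_of_pos (by positivity : 0 < 2 * Real.exp (2 * logRadius σ x)), ← G.sqrt_eq_exp hx hx0]
  gcongr
  exact G.pd_σ x hx hx0 i

theorem abs_pd_comp_logRadius_le {f : ℝ → ℝ} {f' c : ℝ}
    (hf : HasDerivAt f f' (logRadius σ x))
    (hc : |f'| ≤ c * Real.exp ((1 - m) * logRadius σ x)) (i : Fin (m + 1)) :
    |pd i (fun y => f (logRadius σ y)) x| ≤
      c / 2 * K * (Real.exp (-(m + 1) * logRadius σ x) * Real.exp (logRadius σ x)) := by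
  have h := G.σ_pos x hx hx0
  rw [pd_comp hf (differentiableAt_logRadius h (G.differentiableAt_σ hx)), abs_mul]
  refine (mul_le_mul hc (G.abs_pd_logRadius_le hx hx0 i) (abs_nonneg _)
    ((abs_nonneg _).trans hc)).trans (le_of_eq ?_)
  rw [exp_one_sub_mul]
  have : Real.exp (2 * logRadius σ x) ≠ 0 := (Real.exp_pos _).ne'
  field_simp

/-- In (m + 3)K, two units come from 1/J ≤ 2 and the other m + 1 from replacing 1 by the speed q. -/
theorem abs_divergence_defect_le :
    |(J x)⁻¹ * divField (fun i y => J y * radialField gi σ i y) x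
      - (m + 1) * radialSpeed gi σ x| ≤ (m + 3) * K * Real.exp (logRadius σ x) := by
  have hJ0 := G.J_pos hx
  have hJ1 := G.J_lower x hx
  have h1 := G.div_field x hx hx0
  have h3 := G.speed x hx hx0
  rw [G.sqrt_eq_exp hx hx0] at h1 h3
  have e : (J x)⁻¹ * divField (fun i y => J y * radialField gi σ i y) x
      - (m + 1) * radialSpeed gi σ x =
      (J x)⁻¹ * (divField (fun i y => J y * radialField gi σ i y) x - (m + 1) * J x)
      + (m + 1) * (1 - radialSpeed gi σ x) := by field_simp; ring
  have h2 : (J x)⁻¹ ≤ 2 := by rw [inv_le_comm₀ hJ0 two_pos]; linarith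
  rw [e]
  refine (abs_add_le _ _).trans ?_
  rw [abs_mul, abs_mul, abs_of_pos (inv_pos.2 hJ0), abs_of_pos (by positivity : (0 : ℝ) < m + 1)]
  have h4 : (J x)⁻¹ * |divField (fun i y => J y * radialField gi σ i y) x - (m + 1) * J x| ≤
      2 * (K * Real.exp (logRadius σ x)) := mul_le_mul h2 h1 (abs_nonneg _) two_pos.le
  have h5 : ((m : ℝ) + 1) * |1 - radialSpeed gi σ x| ≤
      (m + 1) * (K * Real.exp (logRadius σ x)) := by gcongr
  linarith

/-- The factor 4 is 2 from 1/J ≤ 2 times 2 from ellipticity, which turns the Euclidean |∇u|² into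
the metric one. -/
theorem abs_deformation_defect_le (u : Space m → ℝ) :
    |Real.exp (2 * logRadius σ x) / J x *
      (∑ j, ∑ k, deformation (densityCoeff gi J) (radialField gi σ) j k x * pd j u x * pd k u x
        - (1 - m) * gradForm (densityCoeff gi J) u u x)| ≤
      4 * K * Real.exp (logRadius σ x) * (Real.exp (2 * logRadius σ x)
        * ∑ i, ∑ j, gi i j x * pd i u x * pd j u x) := by
  have hJ0 := G.J_pos hx
  have hJ1 := G.J_lower x hx
  have hS : 0 < Real.exp (2 * logRadius σ x) := Real.exp_pos _
  have h1 := G.deform x hx hx0 fun i => pd i u x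
  rw [G.sqrt_eq_exp hx hx0] at h1
  have h2 : ∑ j, ∑ k, (deformation (densityCoeff gi J) (radialField gi σ) j k x
      - (1 - m) * densityCoeff gi J j k x) * pd j u x * pd k u x =
      ∑ j, ∑ k, deformation (densityCoeff gi J) (radialField gi σ) j k x * pd j u x * pd k u x
        - (1 - m) * gradForm (densityCoeff gi J) u u x := by
    simp only [gradForm, fluxField, Finset.mul_sum, ← Finset.sum_sub_distrib]
    refine Finset.sum_congr rfl fun i _ => Finset.sum_congr rfl fun j _ => ?_
    ring
  rw [h2] at h1
  have h3 : Real.exp (2 * logRadius σ x) / J x ≤ 2 * Real.exp (2 * logRadius σ x) := by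
    rw [div_le_iff₀ hJ0]; nlinarith
  have h4 := G.mul_sum_sq_le hx fun i => pd i u x
  rw [abs_mul, abs_of_pos (by positivity : 0 < Real.exp (2 * logRadius σ x) / J x)]
  have hK : 0 < K := by linarith [G.one_le]
  calc _ ≤ 2 * Real.exp (2 * logRadius σ x) *
        (K * Real.exp (logRadius σ x) * ∑ i, pd i u x ^ 2) :=
        mul_le_mul h3 h1 (abs_nonneg _) (by positivity)
    _ = 2 * K * Real.exp (logRadius σ x) *
        (Real.exp (2 * logRadius σ x) * ∑ i, pd i u x ^ 2) := by ring
    _ ≤ 2 * K * Real.exp (logRadius σ x) * _ := mul_le_mul_of_nonneg_left h4 (by positivity)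
    _ = _ := by ring

end IsCarlemanGeometry

/-- The lower order terms produced by the correction of the Carleman field at the boundary. -/
noncomputable def boundaryTerm (X : Fin (m + 1) → Space m → ℝ) (u ζ η : Space m → ℝ)
    (x : Space m) : ℝ :=
  2 * u x * (alongField X ζ x * pd (Fin.last m) u x - pd (Fin.last m) ζ x * alongField X u x
    + ζ x * (divField X x * pd (Fin.last m) u x - ∑ k, pd (Fin.last m) (X k) x * pd k u x))
  + (pd (Fin.last m) η x * u x ^ 2 + 2 * η x * u x * pd (Fin.last m) u x)

/-- Since |h| ≤ β, the coefficients ζ and η are of size β²r^{2-n}; a derivative costs one factor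
1/r, which X or the gradient of u in y gives back. Against the density r^{-n} one factor r remains,
and this makes the correction absorbable. -/
theorem abs_boundaryTerm_le (G : IsCarlemanGeometry gi J σ δ K) (hx : x ∈ Metric.ball 0 δ)
    (hx0 : x ≠ 0) (hm : 1 ≤ m) (hτ : logRadius σ x ≤ -10) {β : ℝ} (hβ : 20 ≤ β)
    {h : Space m → ℝ} (hhd : DifferentiableAt ℝ h x) (hh : |h x| ≤ β)
    (hh' : ∀ i, |pd i h x| ≤ β) (u : Space m → ℝ) :
    |boundaryTerm (radialField gi σ) u (fun y => rellichCoeff m β (logRadius σ y) * J y * h y)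
      (fun y => gradCoeff m β (logRadius σ y) * J y * h y) x| ≤
      (4 * (m + 1) * K * ((m + 1) * K ^ 2 + 4 * K) + 8 * (m + 1) * K ^ 2 + 2 * K
        + ((m + 1) * K ^ 2 + 4 * K)) * Real.exp (logRadius σ x)
        * Real.exp (-(m + 1) * logRadius σ x) * (β ^ 3 * u x ^ 2
          + β * (Real.exp (2 * logRadius σ x) * ∑ i, ∑ j, gi i j x * pd i u x * pd j u x)) := by
  have hσx := G.σ_pos x hx hx0
  have hσd := G.differentiableAt_σ hx
  have hτ0 : logRadius σ x ≠ 0 := by intro h0; linarith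
  have hJd : DifferentiableAt ℝ J x :=
    differentiableAt_of_contDiffOn Metric.isOpen_ball G.smooth_J hx
  have d1d := differentiableAt_rellichCoeff (m := m) (β := β) hσx hσd hτ0
  have d3d := differentiableAt_gradCoeff (m := m) (β := β) hσx hσd hτ0
  have hJabs : |J x| ≤ K := by rw [abs_of_pos (G.J_pos hx)]; exact G.J_upper x hx
  have b1 := abs_rellichCoeff_le (m := m) hβ hτ
  have b3 := abs_gradCoeff_le (m := m) (by linarith : 0 < β) hτ
  have b1' := G.abs_pd_comp_logRadius_le hx hx0 (hasDerivAt_rellichCoeff hτ0)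
    (abs_rellichCoeff_deriv_le hm hβ hτ)
  have b3' := G.abs_pd_comp_logRadius_le hx hx0 (hasDerivAt_gradCoeff hτ0)
    (abs_gradCoeff_deriv_le hm (by linarith : 0 < β) hτ)
  have g_X : ∀ i, |radialField gi σ i x| ≤ K * Real.exp (logRadius σ x) := fun i => by
    rw [← G.sqrt_eq_exp hx hx0]; exact G.field x hx hx0 i
  have g_dX : ∀ i j, |pd i (radialField gi σ j) x| ≤ K := fun i j => G.pd_field x hx i j
  have g_J := G.pd_J x hx
  have hyV := G.mul_sum_sq_le hx fun i => pd i u x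
  have hu' := abs_pd_le_sqrt u x
  have hV0 : 0 ≤ ∑ i, pd i u x ^ 2 := sum_sq_nonneg _
  have hK1 := G.one_le
  rw [exp_one_sub_mul] at b1 b3
  rw [exp_two_mul_eq_sq] at b1 b3 hyV ⊢
  have hr0 : 0 < Real.exp (logRadius σ x) := Real.exp_pos _
  have hr1 : Real.exp (logRadius σ x) ≤ 1 := Real.exp_le_one_iff.2 (by linarith)
  have hz0 : 0 < Real.exp (-(m + 1) * logRadius σ x) := Real.exp_pos _
  have hm0 : (1 : ℝ) ≤ (m : ℝ) + 1 := by have : (0 : ℝ) ≤ m := m.cast_nonneg; linarith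
  set r := Real.exp (logRadius σ x) with hr
  set z := Real.exp (-(m + 1) * logRadius σ x) with hz
  have hS1 : r ^ 2 ≤ r := by nlinarith
  have hβ0 : 0 < β := by linarith
  have hK0 : 0 < K := by linarith
  -- Used with c = 2β for ζ and c = β for η, so that both derivatives have a common bound.
  have c_gen : ∀ c, c ≤ 2 * β → 0 ≤ c → (2 * (m + 1) * β / 2 * K * (z * r)) * K * β
      + c * (z * r ^ 2) * K * β + c * (z * r ^ 2) * K * β ≤
      ((m + 1) * K ^ 2 + 4 * K) * (z * β ^ 2 * r) := by
    intro c hc hc0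
    have h1 : c * (z * r ^ 2) * K * β ≤ 2 * β * (z * r) * K * β := by gcongr
    have h2 : ((m + 1) * K ^ 2 + 4 * K) * (z * β ^ 2 * r) =
      (2 * (m + 1) * β / 2 * K * (z * r)) * K * β
      + 2 * β * (z * r) * K * β + 2 * β * (z * r) * K * β := by ring
    linarith
  have c_ζ' := fun i => (abs_pd_mul_mul_le d1d hJd hhd b1 (b1' i) hJabs (g_J i) hh
    (hh' i)).trans (c_gen _ le_rfl (by positivity))
  have c_η' := fun i => (abs_pd_mul_mul_le d3d hJd hhd b3 (b3' i) hJabs (g_J i) hh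
    (hh' i)).trans (c_gen _ (by linarith) (by positivity))
  refine abs_boundary_term_le hK1 (by linarith) hz0 hr0 (S := r ^ 2) rfl hm0 (by positivity) ?_ ?_
    (c_ζ' (Fin.last m)) ?_ ?_ ?_ ?_ ?_ (c_η' (Fin.last m)) (hu' (Fin.last m))
  · rw [mul_pow, Real.sq_sqrt hV0]; exact hyV
  · rw [abs_mul, abs_mul]
    calc _ ≤ 2 * β * (z * r ^ 2) * K * β := by gcongr
      _ = _ := by ring
  · refine (abs_sum_mul_le g_X c_ζ').trans (le_of_eq (by ring))
  · refine (abs_sum_mul_le g_X hu').trans (le_of_eq (by ring))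
  · have := abs_sum_mul_le (c := fun i => pd i (radialField gi σ i) x) (d := fun _ => 1)
      (fun i => g_dX i i) (fun _ => abs_one.le)
    simpa [divField] using this
  · refine (abs_sum_mul_le (fun k => g_dX (Fin.last m) k) hu').trans (le_of_eq (by ring))
  · rw [abs_mul, abs_mul]
    calc _ ≤ β * (z * r ^ 2) * K * β := by gcongr
      _ = _ := by ring

end GeometryBounds

/-! ### Exact formulas for the divergence and for the conjugated operator. -/

section PointwiseEstimate

variable {m : ℕ} {gi : Fin (m + 1) → Fin (m + 1) → Space m → ℝ} {J σ : Space m → ℝ} {δ K : ℝ}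
  {x : Space m} {O : Set (Space m)} {β ρ : ℝ} {E h v : Space m → ℝ}

/-- The normalized divergence of the radial field, up to its leading part. -/
noncomputable def divergenceDefect (gi : Fin (m + 1) → Fin (m + 1) → Space m → ℝ)
    (J σ : Space m → ℝ) (x : Space m) : ℝ :=
  (J x)⁻¹ * divField (fun i y => J y * radialField gi σ i y) x - (m + 1) * radialSpeed gi σ x

/-- The normalized deformation form of the radial field, up to its leading part. -/
noncomputable def deformationDefect (gi : Fin (m + 1) → Fin (m + 1) → Space m → ℝ)
    (J σ u : Space m → ℝ) (x : Space m) : ℝ :=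
  Real.exp (2 * logRadius σ x) / J x *
    (∑ j, ∑ k, deformation (densityCoeff gi J) (radialField gi σ) j k x * pd j u x * pd k u x
      - (1 - m) * gradForm (densityCoeff gi J) u u x)

/-- The leading part of the conjugated operator. -/
noncomputable def conjPrincipal (gi : Fin (m + 1) → Fin (m + 1) → Space m → ℝ)
    (J σ u : Space m → ℝ) (x : Space m) : ℝ :=
  Real.exp (2 * logRadius σ x) / J x * divField (fluxField (densityCoeff gi J) u) x
    - ((m + 1 : ℝ) - 2) * alongField (radialField gi σ) u x

variable (G : IsCarlemanGeometry gi J σ δ K) (hO : IsOpen O) (hOδ : O ⊆ Metric.ball 0 δ)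
  (hO0 : ∀ y ∈ O, y ≠ 0) (hOt : ∀ y ∈ O, logRadius σ y ≠ 0) (hv : ContDiffOn ℝ ∞ v O)
  (hx : x ∈ O) (hsymm : ∀ i j, gi i j x = gi j i x)

include G hO hOδ hO0 hOt hv hx hsymm

/-- The factors r^{2-n} and r^{-n} in the coefficients are tuned so that their radial derivatives
cancel the leading parts of the deformation form and of div(JX). What remains is the leading
quadratic form plus terms carrying 1 - q or one of the two defects. -/
theorem divField_weightedField (hE : DifferentiableAt ℝ E x) (hh : DifferentiableAt ℝ h x) :
    divField (weightedField gi J σ β ρ E h v) x =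
      Real.exp (-(m + 1) * logRadius σ x) * J x * (
        2 * (conjPrincipal gi J σ (conjFun σ β v) x + potential gi σ β E x * conjFun σ β v x)
          * (2 * carlemanP β (logRadius σ x) * alongField (radialField gi σ) (conjFun σ β v) x
            - carlemanS β (logRadius σ x) * conjFun σ β v x)
        + 2 * carlemanS β (logRadius σ x) * potential gi σ β E x * conjFun σ β v x ^ 2
        + 4 * (-2 * β * (1 / logRadius σ x ^ 2))
          * alongField (radialField gi σ) (conjFun σ β v) x ^ 2
        + 2 * carlemanP β (logRadius σ x) * deformationDefect gi J σ (conjFun σ β v) x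
        + 2 * carlemanP β (logRadius σ x) * (2 - ((m : ℝ) + 1)) * (1 - radialSpeed gi σ x)
          * (Real.exp (2 * logRadius σ x)
            * ∑ i, ∑ j, gi i j x * pd i (conjFun σ β v) x * pd j (conjFun σ β v) x)
        - 2 * (-2 * β * (1 / logRadius σ x ^ 2)) * radialSpeed gi σ x
          * (Real.exp (2 * logRadius σ x)
            * ∑ i, ∑ j, gi i j x * pd i (conjFun σ β v) x * pd j (conjFun σ β v) x)
        + 2 * alongField (radialField gi σ)
            (fun y => carlemanP β (logRadius σ y) * potential gi σ β E y) x * conjFun σ β v x ^ 2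
        + 2 * carlemanP β (logRadius σ x) * potential gi σ β E x * divergenceDefect gi J σ x
          * conjFun σ β v x ^ 2
        - 2 * carlemanS β (logRadius σ x) * (Real.exp (2 * logRadius σ x)
            * ∑ i, ∑ j, gi i j x * pd i (conjFun σ β v) x * pd j (conjFun σ β v) x)
        - 2 * (-6 * β / logRadius σ x ^ 3) * conjFun σ β v x
          * alongField (radialField gi σ) (conjFun σ β v) x
        + boundaryTerm (radialField gi σ) (conjFun σ β v)
            (fun y => rellichCoeff m β (logRadius σ y) * J y * h y)
            (fun y => gradCoeff m β (logRadius σ y) * J y * h y) x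
            / (Real.exp (-(m + 1) * logRadius σ x) * J x)
        + 1 / 2 * β ^ 2 * ρ * Real.exp (-1 * logRadius σ x)
          * ((divergenceDefect gi J σ x - radialSpeed gi σ x) * conjFun σ β v x ^ 2
            + 2 * conjFun σ β v x * alongField (radialField gi σ) (conjFun σ β v) x)) := by
  have hpos : ∀ y ∈ O, 0 < σ y := fun y hy => G.σ_pos y (hOδ hy) (hO0 y hy)
  have hσO := G.smooth_σ.mono hOδ
  have hJO := G.smooth_J.mono hOδ
  have hgiO := fun i j => (G.smooth_gi i j).mono hOδ
  have hσx := hpos x hx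
  have hσd := differentiableAt_of_contDiffOn hO hσO hx
  have hJd := differentiableAt_of_contDiffOn hO hJO hx
  have htd := differentiableAt_logRadius hσx hσd
  have hτ := hOt x hx
  have hXd := fun i => differentiableAt_of_contDiffOn hO (contDiffOn_radialField hO hgiO hσO i) hx
  have had : ∀ i j, DifferentiableAt ℝ (densityCoeff gi J i j) x := fun i j =>
    hJd.fun_mul (differentiableAt_of_contDiffOn hO (hgiO i j) hx)
  have has : ∀ i j, densityCoeff gi J i j x = densityCoeff gi J j i x := fun i j => by
    simp [densityCoeff, hsymm i j]
  have hqd := differentiableAt_of_contDiffOn hO (contDiffOn_radialSpeed hO hgiO hσO hpos) hx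
  have huO : ContDiffOn ℝ ∞ (conjFun σ β v) O :=
    contDiffOn_conjFun (contDiffOn_logRadius hσO hpos) hOt hv
  have huc : ContDiffAt ℝ 2 (conjFun σ β v) x :=
    (huO.contDiffAt (hO.mem_nhds hx)).of_le (WithTop.coe_le_coe.2 (le_top (a := (2 : ℕ∞))))
  have hud' := fun i => differentiableAt_of_contDiffOn hO (contDiffOn_pd huO hO i) hx
  have d1 := hasDerivAt_rellichCoeff (m := m) (β := β) hτ
  have d3 := hasDerivAt_gradCoeff (m := m) (β := β) hτ
  have d1d := differentiableAt_rellichCoeff (m := m) (β := β) hσx hσd hτ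
  have d3d := differentiableAt_gradCoeff (m := m) (β := β) hσx hσd hτ
  have d2d := differentiableAt_zerothCoeff (β := β) (ρ := ρ) hσx hσd hτ hqd hE
  have hSinv : Real.exp (-2 * logRadius σ x) = (Real.exp (2 * logRadius σ x))⁻¹ := by
    rw [← Real.exp_neg]; congr 1; ring
  have hJ0 := (G.J_pos (hOδ hx)).ne'
  have hdiv : divField (fun i y => J y * radialField gi σ i y) x =
      J x * (divergenceDefect gi J σ x + (m + 1) * radialSpeed gi σ x) := by
    rw [divergenceDefect]; field_simp; ring
  have hS0 : Real.exp (2 * logRadius σ x) ≠ 0 := (Real.exp_pos _).ne'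
  have hDT : ∑ j, ∑ k, deformation (densityCoeff gi J) (radialField gi σ) j k x
        * pd j (conjFun σ β v) x * pd k (conjFun σ β v) x =
      (2 - ((m : ℝ) + 1)) * gradForm (densityCoeff gi J) (conjFun σ β v) (conjFun σ β v) x
        + J x / Real.exp (2 * logRadius σ x) * deformationDefect gi J σ (conjFun σ β v) x := by
    rw [deformationDefect]; field_simp; ring
  have e1 := gradForm_comp (a := densityCoeff gi J) (u := conjFun σ β v) d1 htd
  have e3 := gradForm_comp (a := densityCoeff gi J) (u := conjFun σ β v) d3 htd
  have e1' := alongField_comp (X := radialField gi σ) d1 htd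
  rw [gradForm_logRadius hsymm hσx hσd, hSinv] at e1 e3
  rw [alongField_logRadius hσx hσd] at e1'
  have main := divField_carlemanField had has hXd huc hud' hJd d1d d2d d3d
    ((d1d.fun_mul hJd).fun_mul hh) ((d3d.fun_mul hJd).fun_mul hh)
  rw [hdiv, alongField_zerothCoeff hσx hσd hτ hqd hE, e1, e3, e1', exp_one_sub_mul] at main
  have alg := carleman_divergence_algebra (n := (m : ℝ) + 1)
    (f₁ := rellichCoeff m β (logRadius σ x))
    (f₂ := zerothCoeff gi σ β ρ E x) (f₃ := gradCoeff m β (logRadius σ x))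
    (q := radialSpeed gi σ x) (d := divergenceDefect gi J σ x)
    (XPB := alongField (radialField gi σ)
      (fun y => carlemanP β (logRadius σ y) * potential gi σ β E y) x)
    (P' := -2 * β * (1 / logRadius σ x ^ 2)) (s' := -6 * β / logRadius σ x ^ 3)
    (u := conjFun σ β v x) (w := alongField (radialField gi σ) (conjFun σ β v) x)
    (κ := 1 / 2 * β ^ 2 * ρ * Real.exp (-1 * logRadius σ x))
    (L := divField (fluxField (densityCoeff gi J) (conjFun σ β v)) x)
    (corr := boundaryTerm (radialField gi σ) (conjFun σ β v)
            (fun y => rellichCoeff m β (logRadius σ y) * J y * h y)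
            (fun y => gradCoeff m β (logRadius σ y) * J y * h y) x) hJ0 hS0
    (Real.exp_pos (-(m + 1) * logRadius σ x)).ne'
    (by rw [rellichCoeff, exp_one_sub_mul]) rfl (by rw [zerothCoeff]) rfl
    (by rw [gradCoeff, exp_one_sub_mul]) rfl
    (show conjPrincipal gi J σ (conjFun σ β v) x = _ from rfl)
    (gradForm_densityCoeff gi J σ _ x) hDT
  refine Eq.trans ?_ alg
  refine main.trans ?_
  rw [boundaryTerm]
  ring

/-- Here e₁ = P'q + (P - k)d collects what the split into Λ + Bu and 2P Xu leaves over. It is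
O(β/τ²), so its square is small against β³/τ². -/
theorem conjFun_operator : conjWeight m β (logRadius σ x) * Real.exp (2 * logRadius σ x)
      * ((J x)⁻¹ * divField (fluxField (densityCoeff gi J) v) x + E x * v x) =
    conjPrincipal gi J σ (conjFun σ β v) x
      + 2 * carlemanP β (logRadius σ x) * alongField (radialField gi σ) (conjFun σ β v) x
      + (potential gi σ β E x + (-2 * β * (1 / logRadius σ x ^ 2) * radialSpeed gi σ x
        + (carlemanP β (logRadius σ x) - (m - 1) / 2) * divergenceDefect gi J σ x))
        * conjFun σ β v x := by
  have hpos : ∀ y ∈ O, 0 < σ y := fun y hy => G.σ_pos y (hOδ hy) (hO0 y hy)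
  have hJ0 := (G.J_pos (hOδ hx)).ne'
  have hS0 : Real.exp (2 * logRadius σ x) ≠ 0 := (Real.exp_pos _).ne'
  have hSinv : Real.exp (-2 * logRadius σ x) = (Real.exp (2 * logRadius σ x))⁻¹ := by
    rw [← Real.exp_neg]; congr 1; ring
  have hdiv : divField (fun i y => J y * radialField gi σ i y) x =
      J x * (divergenceDefect gi J σ x + (m + 1) * radialSpeed gi σ x) := by
    rw [divergenceDefect]; field_simp; ring
  have hconj := divField_fluxField_conj (Ω := conjWeight m β)
    (p := fun s => carlemanP β s - (m - 1) / 2) (p' := -2 * β * (1 / logRadius σ x ^ 2)) hO hx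
    hpos (fun y hy => hasDerivAt_conjWeight (hOt y hy))
    ((hasDerivAt_carlemanP (hOt x hx)).sub_const _) hsymm (fun i j => (G.smooth_gi i j).mono hOδ)
    (G.smooth_J.mono hOδ) (G.smooth_σ.mono hOδ) hv (u := conjFun σ β v) rfl
  rw [hdiv, hSinv] at hconj
  have hu : conjFun σ β v x = conjWeight m β (logRadius σ x) * v x := rfl
  have h1 : conjWeight m β (logRadius σ x) * Real.exp (2 * logRadius σ x)
      * ((J x)⁻¹ * divField (fluxField (densityCoeff gi J) v) x + E x * v x) =
      Real.exp (2 * logRadius σ x) / J x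
        * (conjWeight m β (logRadius σ x) * divField (fluxField (densityCoeff gi J) v) x)
      + Real.exp (2 * logRadius σ x) * E x * conjFun σ β v x := by
    rw [hu]; field_simp
  rw [h1, conjPrincipal, potential, hconj]
  field_simp
  ring

end PointwiseEstimate

/-! ### The pointwise Carleman inequality. -/

section PointwiseEstimate

variable {m : ℕ} {gi : Fin (m + 1) → Fin (m + 1) → Space m → ℝ} {J σ : Space m → ℝ} {δ K : ℝ}
  {x : Space m} {O : Set (Space m)} {β ρ : ℝ} {E h v : Space m → ℝ}

theorem abs_div_le_of_abs_le {bt c₀ c r z j Y : ℝ} (hr : 0 ≤ r) (hz : 0 < z) (hj : 1 / 2 ≤ j)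
    (hY : 0 ≤ Y) (hc₀ : 0 ≤ c₀) (hc : 2 * c₀ ≤ c) (h : |bt| ≤ c₀ * r * z * Y) :
    |bt / (z * j)| ≤ c * r * Y := by
  have hj0 : 0 < j := by linarith
  rw [abs_div, abs_of_pos (mul_pos hz hj0), div_le_iff₀ (mul_pos hz hj0)]
  refine h.trans ?_
  have h2 : 0 ≤ r * z * Y := by positivity
  have h4 : c₀ ≤ c * j := by
    have h5 := mul_le_mul_of_nonneg_right hc hj0.le
    have h6 := mul_le_mul_of_nonneg_left hj hc₀
    linarith
  calc _ = c₀ * (r * z * Y) := by ring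
    _ ≤ c * j * (r * z * Y) := by gcongr
    _ = _ := by ring

theorem abs_potential_deriv_le {n K r S q e XE β : ℝ} (hS0 : 0 ≤ S) (hSr : S ≤ r) (hS1 : S ≤ 1)
    (hq : |q| ≤ 2) (he : |e| ≤ β ^ 2) (hXE : |XE| ≤ n * (K * r * β ^ 2)) :
    |2 * q * S * e + S * XE| ≤ β ^ 2 * ((4 + n * K) * r) := by
  have hr : 0 ≤ r := hS0.trans hSr
  have h1 : |S * e| ≤ r * β ^ 2 := by
    rw [abs_mul, abs_of_nonneg hS0]; gcongr
  have h2 : |2 * q * S * e| ≤ 2 * 2 * (r * β ^ 2) := by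
    rw [show 2 * q * S * e = 2 * q * (S * e) by ring, abs_mul, abs_mul, abs_two]
    gcongr
  have h3 : |S * XE| ≤ 1 * (n * (K * r * β ^ 2)) := by
    rw [abs_mul, abs_of_nonneg hS0]
    gcongr
  calc _ ≤ |2 * q * S * e| + |S * XE| := abs_add_le _ _
    _ ≤ _ := by linarith

/-- The quadratic inequality in terms of the error constant of the geometry. -/
theorem carleman_quadratic_inequality_of_bounds {m : ℕ} (hm : (1 : ℝ) ≤ m)
    {K c r z j S ri ρ ℓ β P s s' q d Xq e XE B XPB Λ u w y T bt : ℝ}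
    (hK1 : 1 ≤ K) (hc1 : (m + 3) * K + 4 * K + 8 ≤ c)
    (hEC : c = 2 * (4 * (m + 1) * K * ((m + 1) * K ^ 2 + 4 * K)
      + 8 * (m + 1) * K ^ 2 + 2 * K + ((m + 1) * K ^ 2 + 4 * K)) + 8)
    (hr0 : 0 < r) (hS0 : 0 < S) (hSr : S ≤ r) (hS1 : S ≤ 1) (hz0 : 0 < z)
    (hJ2 : 1 / 2 ≤ j) (hβ : 20 + 16 * m ≤ β) (hℓ0 : 0 < ℓ) (hℓ1 : ℓ ≤ 1 / 100)
    (hsmall : c * r ≤ ℓ / 1000) (hP1 : 3 / 4 * β ≤ P) (hP2 : P ≤ β)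
    (hs : s = 3 * β * ℓ) (hs' : s' ^ 2 = 36 * β ^ 2 * ℓ ^ 2 * ℓ)
    (g_q : |1 - q| ≤ K * r) (g_Xq : |Xq| ≤ K * r) (g_d : |d| ≤ (m + 3) * K * r)
    (hE : |e| ≤ β ^ 2) (g_E : |XE| ≤ (m + 1) * (K * r * β ^ 2))
    (g_T : |T| ≤ 4 * K * r * y)
    (g_b : |bt| ≤ (4 * (m + 1) * K * ((m + 1) * K ^ 2 + 4 * K) + 8 * (m + 1) * K ^ 2 + 2 * K
      + ((m + 1) * K ^ 2 + 4 * K)) * r * z * (β ^ 3 * u ^ 2 + β * y))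
    (hy0 : 0 ≤ y) (hθ0 : 0 ≤ ρ * ri) (hθ : ρ * ri ≤ 1)
    (hBdef : B = (P ^ 2 - ((m - 1) / 2) ^ 2) * q + S * e)
    (hXPB : XPB = -2 * β * ℓ * q * B + P * (2 * P * (-2 * β * ℓ * q) * q
      + (P ^ 2 - ((m - 1) / 2) ^ 2) * Xq + (2 * q * S * e + S * XE))) :
    z * j * (2 * (Λ + B * u) * (2 * P * w - s * u) + 2 * s * B * u ^ 2
        + 4 * (-2 * β * ℓ) * w ^ 2 + 2 * P * T + 2 * P * (2 - ((m : ℝ) + 1)) * (1 - q) * y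
        - 2 * (-2 * β * ℓ) * q * y + 2 * XPB * u ^ 2 + 2 * P * B * d * u ^ 2 - 2 * s * y
        - 2 * s' * u * w + bt / (z * j)
        + 1 / 2 * β ^ 2 * ρ * ri * ((d - q) * u ^ 2 + 2 * u * w))
      + j * z * (β ^ 3 * ℓ * u ^ 2 + 1 / 2 * β * ℓ * y + 1 / 5 * β ^ 2 * (ρ * ri) * u ^ 2)
      ≤ j * z * (2 * (Λ + 2 * P * w
        + (B + (-2 * β * ℓ * q + (P - (m - 1) / 2) * d)) * u) ^ 2) := by
  have hK0 : 0 < K := by linarith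
  have hβ20 : 20 ≤ β := by linarith
  have hβ0 : 0 < β := by linarith
  have hJ0 : 0 < j := by linarith
  have hmK0 : 0 ≤ (m : ℝ) * K := by positivity
  have hKm : K ≤ (m + 3) * K + 4 * K + 8 := by linarith
  have hle : ∀ a, a ≤ (m + 3) * K + 4 * K + 8 → a * r ≤ c * r := fun a ha =>
    mul_le_mul_of_nonneg_right (ha.trans hc1) hr0.le
  have hc0 : 0 ≤ c := le_trans (by positivity : (0:ℝ) ≤ (m + 3) * K + 4 * K + 8) hc1
  have hε0 : 0 ≤ c * r := by positivity
  have hq2 : |q| ≤ 2 := by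
    have h2 := abs_le.1 (g_q.trans (hle K hKm))
    rw [abs_le]; constructor <;> linarith only [h2.1, h2.2, hsmall, hℓ1]
  -- This accounts for the 16m in the lower bound on β: 32k ≤ β gives k² ≤ β²/1024.
  have hk1 : 32 * (((m : ℝ) - 1) / 2) ≤ β := by linarith
  have hk0 : 0 ≤ ((m : ℝ) - 1) / 2 := by linarith
  have hk2 : (((m : ℝ) - 1) / 2) ^ 2 ≤ β ^ 2 / 1000 := by
    have h1 := pow_le_pow_left₀ (mul_nonneg (by norm_num) hk0) hk1 2
    rw [mul_pow] at h1
    linarith only [h1, sq_nonneg β]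
  have hYb : |bt / (z * j)| ≤ c * r * (β ^ 3 * u ^ 2 + β * y) :=
    abs_div_le_of_abs_le hr0.le hz0 hJ2 (by positivity) (by positivity) (by linarith only [hEC])
      g_b
  have hSe : |S * e| ≤ r * β ^ 2 := by
    rw [abs_mul, abs_of_pos hS0]; gcongr
  have he' : |2 * q * S * e + S * XE| ≤ β ^ 2 * (c * r) :=
    (abs_potential_deriv_le hS0.le hSr hS1 hq2 hE g_E).trans
      (mul_le_mul_of_nonneg_left (hle _ (by linarith only [hmK0, hK0])) (sq_nonneg β))
  have key := carleman_quadratic_inequality (β := β) (ℓ := ℓ) (ε := c * r) (n := (m : ℝ) + 1)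
    (k := (m - 1) / 2) (P := P) (p := P - (m - 1) / 2) (P' := -2 * β * ℓ) (s := s) (s' := s')
    (q := q) (d := d) (Xq := Xq) (e := S * e) (e' := 2 * q * S * e + S * XE) (B := B) (XPB := XPB)
    (e₁ := -2 * β * ℓ * q + (P - (m - 1) / 2) * d) (Λ := Λ) (u := u) (w := w) (y := y) (T := T)
    (Yb := bt / (z * j)) (θ := ρ * ri) hβ20 hℓ0 hℓ1 hε0 hsmall hk0 hk2
    (by linarith only [hk1, hk0]) hP1 hP2 rfl rfl hs
    (by
      rw [hs']
      exact mul_le_of_le_one_right (by positivity) (by linarith only [hℓ1]))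
    (g_q.trans (hle K hKm))
    (by
      rw [abs_mul, show ((m : ℝ) + 1 - 2) = m - 1 by ring, abs_of_nonneg (by linarith only [hm])]
      calc ((m : ℝ) - 1) * |1 - q| ≤ m * (K * r) := by gcongr; linarith
        _ = m * K * r := by ring
        _ ≤ c * r := hle _ (by linarith only [hmK0, hK0]))
    (g_d.trans (hle _ (by linarith only [hK0])))
    (g_Xq.trans (hle K hKm))
    (by
      have h1 : 1 * r ≤ c * r := hle 1 (by linarith only [hmK0, hK0])
      have h2 := mul_le_mul_of_nonneg_left h1 (sq_nonneg β)
      linarith only [h2, hSe])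
    he' hBdef hXPB rfl hy0
    (g_T.trans (by
      have := hle (4 * K) (by linarith only [hmK0, hK0])
      gcongr))
    hYb hθ0 hθ
  have fin : ∀ A C D : ℝ, A + C ≤ D → z * j * A + j * z * C ≤ j * z * D := fun A C D h => by
    have := mul_le_mul_of_nonneg_left h (mul_pos hz0 hJ0).le
    linarith only [this]
  rw [show 1 / 2 * β ^ 2 * ρ * ri = 1 / 2 * β ^ 2 * (ρ * ri) by ring]
  exact fin _ _ _ key

/-- The pointwise Carleman estimate with a divergence term. -/
theorem carleman_pointwise (G : IsCarlemanGeometry gi J σ δ K) (hm : 1 ≤ m) (hO : IsOpen O)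
    (hOδ : O ⊆ Metric.ball 0 δ) (hO0 : ∀ y ∈ O, y ≠ 0) (hOt : ∀ y ∈ O, logRadius σ y ≠ 0)
    (hv : ContDiffOn ℝ ∞ v O) (hx : x ∈ O) (hxn : 0 ≤ x (Fin.last m))
    (hτ : logRadius σ x ≤ -10)
    (hsmall : errorConst m K * Real.exp (logRadius σ x) ≤ 1 / logRadius σ x ^ 2 / 1000)
    (hβ : 20 + 16 * m ≤ β) (hρ0 : 0 ≤ ρ) (hρ : ρ ≤ Real.exp (logRadius σ x))
    (hEd : DifferentiableAt ℝ E x) (hhd : DifferentiableAt ℝ h x)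
    (hE : |E x| ≤ β ^ 2) (hE' : ∀ i, |pd i E x| ≤ β ^ 2)
    (hh : |h x| ≤ β) (hh' : ∀ i, |pd i h x| ≤ β) :
    divField (weightedField gi J σ β ρ E h v) x
      + J x * Real.exp (-(m + 1) * logRadius σ x) * (
        β ^ 3 * (1 / logRadius σ x ^ 2) * conjFun σ β v x ^ 2
        + 1 / 2 * β * (1 / logRadius σ x ^ 2) * (Real.exp (2 * logRadius σ x)
          * ∑ i, ∑ j, gi i j x * pd i (conjFun σ β v) x * pd j (conjFun σ β v) x)
        + 1 / 5 * β ^ 2 * (ρ * Real.exp (-1 * logRadius σ x)) * conjFun σ β v x ^ 2)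
      ≤ J x * Real.exp (-(m + 1) * logRadius σ x) * (2 * (conjWeight m β (logRadius σ x)
        * Real.exp (2 * logRadius σ x)
        * ((J x)⁻¹ * divField (fluxField (densityCoeff gi J) v) x + E x * v x)) ^ 2) := by
  have hxδ := hOδ hx
  have hx0 := hO0 x hx
  have hsymm : ∀ i j, gi i j x = gi j i x := G.symm x ⟨hxδ, hxn⟩
  have hpos : ∀ y ∈ O, 0 < σ y := fun y hy => G.σ_pos y (hOδ hy) (hO0 y hy)
  have hσd := G.differentiableAt_σ hxδ
  have hqd := differentiableAt_of_contDiffOn hO (contDiffOn_radialSpeed hO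
    (fun i j => (G.smooth_gi i j).mono hOδ) (G.smooth_σ.mono hOδ) hpos) hx
  have hτ0 := hOt x hx
  have hm0 : (1 : ℝ) ≤ m := by exact_mod_cast hm
  have hβ20 : 20 ≤ β := by linarith
  have hβ0 : 0 < β := by linarith
  have hK1 := G.one_le
  have hτ2 : 100 ≤ logRadius σ x ^ 2 := by nlinarith
  obtain ⟨hP1, hP2⟩ := carlemanP_bounds hτ hβ20
  have hXPB := alongField_carlemanP_mul_potential (β := β) (G.σ_pos x hxδ hx0) hσd hτ0 hqd hEd
  rw [alongField_potential (β := β) (G.σ_pos x hxδ hx0) hσd hτ0 hqd hEd] at hXPB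
  have g_q := G.speed x hxδ hx0
  have g_Xq := G.along_speed x hxδ hx0
  have g_X := G.field x hxδ hx0
  rw [G.sqrt_eq_exp hxδ hx0] at g_q g_Xq
  simp only [G.sqrt_eq_exp hxδ hx0] at g_X
  have g_E := abs_sum_mul_le g_X hE'
  have g_d : |divergenceDefect gi J σ x| ≤ _ := G.abs_divergence_defect_le hxδ hx0
  have g_T : |deformationDefect gi J σ (conjFun σ β v) x| ≤ _ :=
    G.abs_deformation_defect_le hxδ hx0 (conjFun σ β v)
  have g_b := abs_boundaryTerm_le G hxδ hx0 hm hτ hβ20 hhd hh hh' (conjFun σ β v)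
  have hy0 : 0 ≤ Real.exp (2 * logRadius σ x)
      * ∑ i, ∑ j, gi i j x * pd i (conjFun σ β v) x * pd j (conjFun σ β v) x := by
    have h1 := G.mul_sum_sq_le hxδ fun i => pd i (conjFun σ β v) x
    have h2 : 0 ≤ Real.exp (2 * logRadius σ x) * ∑ i, pd i (conjFun σ β v) x ^ 2 :=
      mul_nonneg (Real.exp_pos _).le (sum_sq_nonneg _)
    linarith
  have hc1 := le_errorConst (m := m) hK1
  have hr0 : 0 < Real.exp (logRadius σ x) := Real.exp_pos _
  have hr1 : Real.exp (logRadius σ x) ≤ 1 := Real.exp_le_one_iff.2 (by linarith)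
  have hS0 : 0 < Real.exp (2 * logRadius σ x) := Real.exp_pos _
  have hSr : Real.exp (2 * logRadius σ x) ≤ Real.exp (logRadius σ x) :=
    Real.exp_le_exp.2 (by linarith)
  have hz0 : 0 < Real.exp (-(m + 1) * logRadius σ x) := Real.exp_pos _
  have hθ : ρ * Real.exp (-1 * logRadius σ x) ≤ 1 := by
    rw [neg_one_mul, Real.exp_neg, ← div_eq_mul_inv, div_le_one hr0]; exact hρ
  have hθ0 : 0 ≤ ρ * Real.exp (-1 * logRadius σ x) := by positivity
  rw [conjFun_operator G hO hOδ hO0 hOt hv hx hsymm,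
    divField_weightedField G hO hOδ hO0 hOt hv hx hsymm hEd hhd]
  have hBdef : potential gi σ β E x = (carlemanP β (logRadius σ x) ^ 2 - ((m - 1) / 2) ^ 2)
      * radialSpeed gi σ x + Real.exp (2 * logRadius σ x) * E x := rfl
  have hs : carlemanS β (logRadius σ x) = 3 * β * (1 / logRadius σ x ^ 2) := by
    rw [carlemanS]; ring
  have hs' := sq_carlemanS_deriv (β := β) hτ0
  have hEC : errorConst m K = 2 * (4 * (m + 1) * K * ((m + 1) * K ^ 2 + 4 * K)
    + 8 * (m + 1) * K ^ 2 + 2 * K + ((m + 1) * K ^ 2 + 4 * K)) + 8 := rfl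
  have hℓ0 : 0 < 1 / logRadius σ x ^ 2 := by positivity
  have hℓ1 : 1 / logRadius σ x ^ 2 ≤ 1 / 100 := one_div_le_one_div_of_le (by norm_num) hτ2
  exact carleman_quadratic_inequality_of_bounds hm0 hK1 hc1 hEC hr0 hS0 hSr (hSr.trans hr1) hz0
    (G.J_lower x hxδ) hβ hℓ0 hℓ1 hsmall hP1 hP2 hs hs' g_q g_Xq g_d hE g_E g_T g_b hy0 hθ0 hθ
    hBdef hXPB

end PointwiseEstimate

/-! ### Regularity of the Carleman field and its flux through the flat boundary. -/

section WeightedField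

open Filter Topology

variable {m : ℕ} {gi : Fin (m + 1) → Fin (m + 1) → Space m → ℝ} {J σ : Space m → ℝ} {δ K : ℝ}
  {x : Space m} {O : Set (Space m)} {β ρ : ℝ} {E h v : Space m → ℝ}

theorem contDiffOn_gradForm (hO : IsOpen O) {a : Fin (m + 1) → Fin (m + 1) → Space m → ℝ}
    {f u : Space m → ℝ} (ha : ∀ i j, ContDiffOn ℝ ∞ (a i j) O) (hf : ContDiffOn ℝ ∞ f O)
    (hu : ContDiffOn ℝ ∞ u O) : ContDiffOn ℝ ∞ (gradForm a f u) O := by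
  unfold gradForm
  exact ContDiffOn.sum fun i _ => (contDiffOn_pd hf hO i).mul (contDiffOn_fluxField hO ha hu i)

theorem contDiffOn_rellichField (hO : IsOpen O) {a : Fin (m + 1) → Fin (m + 1) → Space m → ℝ}
    {X : Fin (m + 1) → Space m → ℝ} {u : Space m → ℝ} (ha : ∀ i j, ContDiffOn ℝ ∞ (a i j) O)
    (hX : ∀ i, ContDiffOn ℝ ∞ (X i) O) (hu : ContDiffOn ℝ ∞ u O) (i : Fin (m + 1)) :
    ContDiffOn ℝ ∞ (rellichField a X u i) O :=
  ((contDiffOn_const.mul (contDiffOn_alongField hO hX hu)).mul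
    (contDiffOn_fluxField hO ha hu i)).sub ((contDiffOn_gradForm hO ha hu hu).mul (hX i))

theorem contDiffOn_carlemanField (hO : IsOpen O) {s : Set (Space m)} (hs : s ⊆ O)
    {a : Fin (m + 1) → Fin (m + 1) → Space m → ℝ} {X : Fin (m + 1) → Space m → ℝ}
    {u f₁ f₂ f₃ ζ η : Space m → ℝ} (ha : ∀ i j, ContDiffOn ℝ ∞ (a i j) O)
    (hX : ∀ i, ContDiffOn ℝ ∞ (X i) O) (hu : ContDiffOn ℝ ∞ u O) (hJ : ContDiffOn ℝ ∞ J O)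
    (hf₁ : ContDiffOn ℝ 1 f₁ s) (hf₂ : ContDiffOn ℝ 1 f₂ s) (hf₃ : ContDiffOn ℝ 1 f₃ s)
    (hζ : ContDiffOn ℝ 1 ζ s) (hη : ContDiffOn ℝ 1 η s) (i : Fin (m + 1)) :
    ContDiffOn ℝ 1 (carlemanField a X J u f₁ f₂ f₃ ζ η i) s := by
  have r : ∀ {f : Space m → ℝ}, ContDiffOn ℝ ∞ f O → ContDiffOn ℝ 1 f s := fun hf =>
    (hf.of_le (WithTop.coe_le_coe.2 (le_top (a := (1 : ℕ∞))))).mono hs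
  have hu1 := r hu
  have hun := r (contDiffOn_pd hu hO (Fin.last m))
  have h1 := ((hf₁.mul (r (contDiffOn_rellichField hO ha hX hu i))).add
    ((hf₂.mul (hu1.pow 2)).mul ((r hJ).mul (r (hX i))))).sub
    ((hf₃.mul hu1).mul (r (contDiffOn_fluxField hO ha hu i)))
  have h2 : ContDiffOn ℝ 1 (fun x => (2 * (ζ x * u x * pd (Fin.last m) u x)) * X i x) s :=
    (contDiffOn_const.mul ((hζ.mul hu1).mul hun)).mul (r (hX i))
  have h3 : ContDiffOn ℝ 1 (fun x => if i = Fin.last m then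
      η x * u x ^ 2 - 2 * (ζ x * u x * alongField X u x) else 0) s := by
    by_cases hi : i = Fin.last m
    · simp only [hi, if_true]
      exact (hη.mul (hu1.pow 2)).sub (contDiffOn_const.mul ((hζ.mul hu1).mul
        (r (contDiffOn_alongField hO hX hu))))
    · simp only [hi, if_false]
      exact contDiffOn_const
  exact (h1.add h2).add h3

theorem carlemanField_eq_zero {a : Fin (m + 1) → Fin (m + 1) → Space m → ℝ}
    {X : Fin (m + 1) → Space m → ℝ} {u f₁ f₂ f₃ ζ η : Space m → ℝ} (hu : u x = 0)
    (hu' : ∀ i, pd i u x = 0) (i : Fin (m + 1)) :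
    carlemanField a X J u f₁ f₂ f₃ ζ η i x = 0 := by
  simp [carlemanField, rellichField, alongField, fluxField, gradForm, hu, hu']

/-- This factorization dictates ζ = f₁Jh and η = f₃Jh: the Robin condition kills the first bracket,
and the Dirichlet condition kills the second. -/
theorem carlemanField_normal {a : Fin (m + 1) → Fin (m + 1) → Space m → ℝ}
    {X : Fin (m + 1) → Space m → ℝ} {u f₁ f₂ f₃ : Space m → ℝ} {h : Space m → ℝ}
    (ha : ∀ j, a (Fin.last m) j x = if j = Fin.last m then J x else 0)
    (hX : X (Fin.last m) x = 0) :
    carlemanField a X J u f₁ f₂ f₃ (fun y => f₁ y * J y * h y) (fun y => f₃ y * J y * h y)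
      (Fin.last m) x =
      J x * (pd (Fin.last m) u x - h x * u x) * (2 * f₁ x * alongField X u x - f₃ x * u x) := by
  have h1 : fluxField a u (Fin.last m) x = J x * pd (Fin.last m) u x := by
    simp [fluxField, ha]
  simp only [carlemanField, rellichField, h1, hX, if_true]
  ring

theorem contDiffOn_weightedField (G : IsCarlemanGeometry gi J σ δ K) (hO : IsOpen O)
    (hOδ : O ⊆ Metric.ball 0 δ) (hO0 : ∀ y ∈ O, y ≠ 0) (hOt : ∀ y ∈ O, logRadius σ y ≠ 0)
    (hv : ContDiffOn ℝ ∞ v O) {s : Set (Space m)} (hs : s ⊆ O) (hE : ContDiffOn ℝ 1 E s)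
    (hh : ContDiffOn ℝ 1 h s) (i : Fin (m + 1)) :
    ContDiffOn ℝ 1 (weightedField gi J σ β ρ E h v i) s := by
  have hpos : ∀ y ∈ O, 0 < σ y := fun y hy => G.σ_pos y (hOδ hy) (hO0 y hy)
  have hσO := G.smooth_σ.mono hOδ
  have hJO := G.smooth_J.mono hOδ
  have hgiO := fun i j => (G.smooth_gi i j).mono hOδ
  have htO := contDiffOn_logRadius hσO hpos
  have r : ∀ {f : Space m → ℝ}, ContDiffOn ℝ ∞ f O → ContDiffOn ℝ 1 f s := fun hf =>
    (hf.of_le (WithTop.coe_le_coe.2 (le_top (a := (1 : ℕ∞))))).mono hs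
  have he : ∀ c : ℝ, ContDiffOn ℝ ∞ (fun y => Real.exp (c * logRadius σ y)) O := fun c =>
    (contDiffOn_const.mul htO).exp
  have hP : ContDiffOn ℝ ∞ (fun y => carlemanP β (logRadius σ y)) O :=
    (contDiffOn_const.mul (contDiffOn_const.add (contDiffOn_const.div htO hOt))).sub
      contDiffOn_const
  have hS : ContDiffOn ℝ ∞ (fun y => carlemanS β (logRadius σ y)) O :=
    contDiffOn_const.div (htO.pow 2) fun y hy => pow_ne_zero 2 (hOt y hy)
  have h1 : ContDiffOn ℝ ∞ (fun y => rellichCoeff m β (logRadius σ y)) O :=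
    (contDiffOn_const.mul hP).mul (he _)
  have h3 : ContDiffOn ℝ ∞ (fun y => gradCoeff m β (logRadius σ y)) O :=
    (contDiffOn_const.mul hS).mul (he _)
  have hB : ContDiffOn ℝ 1 (potential gi σ β E) s :=
    (r (((hP.pow 2).sub contDiffOn_const).mul (contDiffOn_radialSpeed hO hgiO hσO hpos))).add
      ((r (he 2)).mul hE)
  have h2 : ContDiffOn ℝ 1 (zerothCoeff gi σ β ρ E) s :=
    ((contDiffOn_const.mul ((r hP).mul hB)).add (contDiffOn_const.mul (r (he (-1))))).mul
      (r (he _))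
  exact contDiffOn_carlemanField hO hs (fun i j => hJO.mul (hgiO i j))
    (contDiffOn_radialField hO hgiO hσO) (contDiffOn_conjFun htO hOt hv) hJO (r h1) h2 (r h3)
    (((r h1).mul (r hJO)).mul hh) (((r h3).mul (r hJO)).mul hh) i

/-- In Fermi coordinates the normal component of g⁻¹∇σ is ∂ₙσ, which vanishes on the boundary. The
radial field is therefore tangential there. -/
theorem radialField_normal (G : IsCarlemanGeometry gi J σ δ K) (hx : x ∈ Metric.ball 0 δ)
    (hxn : x (Fin.last m) = 0) : radialField gi σ (Fin.last m) x = 0 := by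
  have hxH : x ∈ Metric.ball 0 δ ∩ halfSpace m := ⟨hx, hxn.ge⟩
  have h1 : ∀ j, gi (Fin.last m) j x = if j = Fin.last m then 1 else 0 := fun j => by
    rw [G.symm x hxH, G.normal x hxH]
  simp [radialField, fluxField, h1, G.σ_normal x hx hxn]

/-- A line in a tangential direction stays in {xₙ = 0}, where v vanishes. Together with the tangency
of X this gives Xu = 0 under the Dirichlet condition. -/
theorem pd_tangential_eq_zero (hO : IsOpen O) (hx : x ∈ O) (hxn : x (Fin.last m) = 0)
    (h0 : ∀ y ∈ O, y (Fin.last m) = 0 → v y = 0) (hv : DifferentiableAt ℝ v x)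
    {i : Fin (m + 1)} (hi : i ≠ Fin.last m) : pd i v x = 0 := by
  set c : ℝ → Space m := fun s => x + s • EuclideanSpace.single i (1 : ℝ) with hc
  have hcd : HasDerivAt c (EuclideanSpace.single i (1 : ℝ)) 0 := by
    have : HasDerivAt c ((1 : ℝ) • EuclideanSpace.single i (1 : ℝ)) 0 :=
      ((hasDerivAt_id (0 : ℝ)).smul_const (EuclideanSpace.single i (1 : ℝ))).const_add x
    rwa [one_smul] at this
  have hc0 : c 0 = x := by simp [hc]
  have h1 : HasDerivAt (fun s => v (c s)) (pd i v x) 0 := by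
    have hv' : HasFDerivAt v (fderiv ℝ v x) (c 0) := by rw [hc0]; exact hv.hasFDerivAt
    exact hv'.comp_hasDerivAt 0 hcd
  have h2 : (fun s => v (c s)) =ᶠ[𝓝 0] fun _ => 0 := by
    have : ∀ᶠ s in 𝓝 (0 : ℝ), c s ∈ O :=
      hcd.continuousAt.eventually (by rw [hc0]; exact hO.mem_nhds hx)
    filter_upwards [this] with s hs
    refine h0 _ hs ?_
    simp [hc, hxn, hi.symm]
  exact h1.unique ((hasDerivAt_const (0 : ℝ) (0 : ℝ)).congr_of_eventuallyEq h2)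

theorem pd_conjFun (hσ : 0 < σ x) (hσd : DifferentiableAt ℝ σ x) (hτ : logRadius σ x ≠ 0)
    (hv : DifferentiableAt ℝ v x) (i : Fin (m + 1)) :
    pd i (conjFun σ β v) x = conjWeight m β (logRadius σ x) * pd i v x
      - (carlemanP β (logRadius σ x) - (m - 1) / 2) * pd i (logRadius σ) x
        * conjFun σ β v x := by
  have htd := differentiableAt_logRadius hσ hσd
  have hw := hasDerivAt_conjWeight (m := m) (β := β) hτ
  have hwd : DifferentiableAt ℝ (fun y => conjWeight m β (logRadius σ y)) x :=
    DifferentiableAt.comp (g := conjWeight m β) (f := logRadius σ) x hw.differentiableAt htd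
  have : pd i (conjFun σ β v) x = pd i (fun y => conjWeight m β (logRadius σ y) * v y) x := rfl
  rw [this, pd_mul hwd hv, pd_comp hw htd, conjFun]
  ring

/-- The Carleman field does not flow through the flat boundary, under the Dirichlet condition or
the Robin condition. -/
theorem weightedField_normal_eq_zero (G : IsCarlemanGeometry gi J σ δ K) (hO : IsOpen O)
    (hOδ : O ⊆ Metric.ball 0 δ) (hO0 : ∀ y ∈ O, y ≠ 0) (hOt : ∀ y ∈ O, logRadius σ y ≠ 0)
    (hv : ContDiffOn ℝ ∞ v O)
    (hbd : (∀ y ∈ O, y (Fin.last m) = 0 → v y = 0) ∨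
      ∀ y ∈ O, y (Fin.last m) = 0 → pd (Fin.last m) v y = h y * v y)
    (hx : x ∈ O) (hxn : x (Fin.last m) = 0) :
    weightedField gi J σ β ρ E h v (Fin.last m) x = 0 := by
  have hxH : x ∈ Metric.ball 0 δ ∩ halfSpace m := ⟨hOδ hx, hxn.ge⟩
  have hσ := G.σ_pos x (hOδ hx) (hO0 x hx)
  have hσd := G.differentiableAt_σ (hOδ hx)
  have hvd := differentiableAt_of_contDiffOn hO hv hx
  have hX := radialField_normal G (hOδ hx) hxn
  rw [weightedField, carlemanField_normal (fun j => by
    simp [densityCoeff, G.symm x hxH (Fin.last m) j, G.normal x hxH]) hX]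
  have hpd := pd_conjFun (m := m) (β := β) hσ hσd (hOt x hx) hvd
  have htn : pd (Fin.last m) (logRadius σ) x = 0 := by
    rw [pd_logRadius hσ hσd, G.σ_normal x (hOδ hx) hxn, zero_div]
  rcases hbd with hD | hR
  · have hu0 : conjFun σ β v x = 0 := by rw [conjFun, hD x hx hxn, mul_zero]
    have hXu : alongField (radialField gi σ) (conjFun σ β v) x = 0 := by
      refine Finset.sum_eq_zero fun k _ => ?_
      by_cases hk : k = Fin.last m
      · rw [hk, hX, zero_mul]
      · rw [hpd, hu0, pd_tangential_eq_zero hO hx hxn hD hvd hk]; ring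
    rw [hu0, hXu]; ring
  · have : pd (Fin.last m) (conjFun σ β v) x - h x * conjFun σ β v x = 0 := by
      rw [hpd, htn, hR x hx hxn, conjFun]; ring
    rw [this]; ring

end WeightedField

/-! ### Returning from the conjugated function to the original one. -/

section IntegralEstimate

open Filter Topology

variable {m : ℕ} {gi : Fin (m + 1) → Fin (m + 1) → Space m → ℝ} {J σ : Space m → ℝ} {δ K : ℝ}
  {x : Space m} {O : Set (Space m)} {β ρ : ℝ} {E h v : Space m → ℝ}

/-- The density bounded from below in the Carleman estimate. -/
noncomputable def carlemanDensity (gi : Fin (m + 1) → Fin (m + 1) → Space m → ℝ)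
    (J σ : Space m → ℝ) (β ρ : ℝ) (v : Space m → ℝ) (x : Space m) : ℝ :=
  J x * Real.exp (β * -phi (logRadius σ x)) ^ 2 * (
    1 / 2 * β ^ 3 * (1 / logRadius σ x ^ 2) * v x ^ 2
    + 1 / 8 * β * (1 / logRadius σ x ^ 2) * (Real.exp (2 * logRadius σ x)
      * ∑ i, ∑ j, gi i j x * pd i v x * pd j v x)
    + 1 / 5 * β ^ 2 * (ρ * Real.exp (-1 * logRadius σ x)) * v x ^ 2)

/-- The density of the right-hand side of the Carleman estimate. -/
noncomputable def sourceDensity (gi : Fin (m + 1) → Fin (m + 1) → Space m → ℝ)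
    (J σ : Space m → ℝ) (β : ℝ) (E v : Space m → ℝ) (x : Space m) : ℝ :=
  2 * J x * (Real.exp (β * -phi (logRadius σ x)) * Real.exp (2 * logRadius σ x)
    * ((J x)⁻¹ * divField (fluxField (densityCoeff gi J) v) x + E x * v x)) ^ 2

/-- The parallelogram identity for a nonnegative form; no symmetry of A is needed. -/
theorem quadratic_add_le {A : Fin (m + 1) → Fin (m + 1) → ℝ}
    (hA : ∀ ξ : Fin (m + 1) → ℝ, 0 ≤ ∑ i, ∑ j, A i j * ξ i * ξ j) (a b : Fin (m + 1) → ℝ) :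
    ∑ i, ∑ j, A i j * (a i + b i) * (a j + b j) ≤
      2 * ∑ i, ∑ j, A i j * a i * a j + 2 * ∑ i, ∑ j, A i j * b i * b j := by
  have h := hA fun i => a i - b i
  have e : ∑ i, ∑ j, A i j * (a i + b i) * (a j + b j)
      + ∑ i, ∑ j, A i j * (a i - b i) * (a j - b j) =
      2 * ∑ i, ∑ j, A i j * a i * a j + 2 * ∑ i, ∑ j, A i j * b i * b j := by
    simp only [Finset.mul_sum, ← Finset.sum_add_distrib]
    exact Finset.sum_congr rfl fun i _ => Finset.sum_congr rfl fun j _ => by ring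
  linarith

theorem quadratic_mul (A : Fin (m + 1) → Fin (m + 1) → ℝ) (a : Fin (m + 1) → ℝ) (c : ℝ) :
    ∑ i, ∑ j, A i j * (c * a i) * (c * a j) = c ^ 2 * ∑ i, ∑ j, A i j * a i * a j := by
  simp only [Finset.mul_sum]
  exact Finset.sum_congr rfl fun i _ => Finset.sum_congr rfl fun j _ => by ring

theorem IsCarlemanGeometry.quadratic_nonneg (G : IsCarlemanGeometry gi J σ δ K)
    (hx : x ∈ Metric.ball 0 δ) (ξ : Fin (m + 1) → ℝ) :
    0 ≤ ∑ i, ∑ j, gi i j x * ξ i * ξ j :=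
  le_trans (mul_nonneg (by norm_num) (sum_sq_nonneg _)) (G.elliptic x hx ξ)

theorem quadratic_logRadius (G : IsCarlemanGeometry gi J σ δ K) (hx : x ∈ Metric.ball 0 δ)
    (hx0 : x ≠ 0) (hsymm : ∀ i j, gi i j x = gi j i x) :
    Real.exp (2 * logRadius σ x)
      * ∑ i, ∑ j, gi i j x * pd i (logRadius σ) x * pd j (logRadius σ) x
      = radialSpeed gi σ x := by
  have hσ := G.σ_pos x hx hx0
  have hσd := G.differentiableAt_σ hx
  have h1 := gradForm_logRadius (J := J) hsymm hσ hσd (logRadius σ)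
  rw [gradForm_densityCoeff gi J σ, alongField_logRadius hσ hσd] at h1
  have hJ := (G.J_pos hx).ne'
  have hS : Real.exp (2 * logRadius σ x) ≠ 0 := (Real.exp_pos _).ne'
  rw [show -2 * logRadius σ x = -(2 * logRadius σ x) by ring, Real.exp_neg] at h1
  field_simp at h1
  linarith

/-- Ω∇v differs from ∇u by (P - k)u∇τ, and r²|∇τ|² is the speed q. -/
theorem conjWeight_mul_quadratic_le (G : IsCarlemanGeometry gi J σ δ K)
    (hx : x ∈ Metric.ball 0 δ) (hx0 : x ≠ 0) (hsymm : ∀ i j, gi i j x = gi j i x)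
    (hτ : logRadius σ x ≠ 0) (hv : DifferentiableAt ℝ v x) :
    conjWeight m β (logRadius σ x) ^ 2 * (Real.exp (2 * logRadius σ x)
      * ∑ i, ∑ j, gi i j x * pd i v x * pd j v x) ≤
      2 * (Real.exp (2 * logRadius σ x)
        * ∑ i, ∑ j, gi i j x * pd i (conjFun σ β v) x * pd j (conjFun σ β v) x)
      + 2 * ((carlemanP β (logRadius σ x) - (m - 1) / 2) ^ 2 * radialSpeed gi σ x
        * conjFun σ β v x ^ 2) := by
  have hσ := G.σ_pos x hx hx0
  have hσd := G.differentiableAt_σ hx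
  set c := conjWeight m β (logRadius σ x)
  set p := carlemanP β (logRadius σ x) - (m - 1) / 2
  have h1 : ∀ i, c * pd i v x = pd i (conjFun σ β v) x
      + p * conjFun σ β v x * pd i (logRadius σ) x := fun i => by
    rw [pd_conjFun hσ hσd hτ hv]; ring
  have h2 := quadratic_add_le (G.quadratic_nonneg hx) (fun i => pd i (conjFun σ β v) x)
    (fun i => p * conjFun σ β v x * pd i (logRadius σ) x)
  simp only [← h1, quadratic_mul] at h2
  have h3 := mul_le_mul_of_nonneg_left h2 (Real.exp_pos (2 * logRadius σ x)).le
  rw [← quadratic_logRadius G hx hx0 hsymm]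
  linarith

/-- The density r^{-n} times the squared conjugating weight is e^{2βψ}, so the powers of r
disappear. Passing from ∇u to ∇v costs part of the u² term. -/
theorem carleman_density_pointwise (G : IsCarlemanGeometry gi J σ δ K) (hm : 1 ≤ m)
    (hO : IsOpen O) (hOδ : O ⊆ Metric.ball 0 δ) (hO0 : ∀ y ∈ O, y ≠ 0)
    (hOt : ∀ y ∈ O, logRadius σ y ≤ -10)
    (hsmall : ∀ y ∈ O, errorConst m K * Real.exp (logRadius σ y) ≤ 1 / logRadius σ y ^ 2 / 1000)
    (hv : ContDiffOn ℝ ∞ v O) (hx : x ∈ O) (hxn : 0 ≤ x (Fin.last m))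
    (hβ : 20 + 16 * m ≤ β) (hρ0 : 0 ≤ ρ) (hρ : ρ ≤ Real.exp (logRadius σ x))
    (hEd : DifferentiableAt ℝ E x) (hhd : DifferentiableAt ℝ h x)
    (hE : |E x| ≤ β ^ 2) (hE' : ∀ i, |pd i E x| ≤ β ^ 2)
    (hh : |h x| ≤ β) (hh' : ∀ i, |pd i h x| ≤ β) :
    divField (weightedField gi J σ β ρ E h v) x + carlemanDensity gi J σ β ρ v x ≤
      sourceDensity gi J σ β E v x := by
  have hOt' : ∀ y ∈ O, logRadius σ y ≠ 0 := fun y hy h0 => by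
    have := hOt y hy
    linarith
  have hxδ := hOδ hx
  have hx0 := hO0 x hx
  have key := carleman_pointwise G hm hO hOδ hO0 hOt' hv hx hxn (hOt x hx) (hsmall x hx) hβ hρ0 hρ
    hEd hhd hE hE' hh hh'
  have hsymm : ∀ i j, gi i j x = gi j i x := G.symm x ⟨hxδ, hxn⟩
  have hquad := conjWeight_mul_quadratic_le (β := β) G hxδ hx0 hsymm (hOt' x hx)
    (differentiableAt_of_contDiffOn hO hv hx)
  have hm0 : (1 : ℝ) ≤ m := by exact_mod_cast hm
  have hm' : (0 : ℝ) ≤ ((m : ℝ) - 1) / 2 := by linarith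
  obtain ⟨hP1, hP2⟩ := carlemanP_bounds (hOt x hx) (by linarith : 20 ≤ β)
  have hz : Real.exp (-(m + 1) * logRadius σ x) * conjWeight m β (logRadius σ x) ^ 2 =
      Real.exp (β * -phi (logRadius σ x)) ^ 2 := by
    rw [conjWeight_sq, ← mul_assoc, ← Real.exp_add]
    rw [show -((m : ℝ) + 1) * logRadius σ x + (m + 1) * logRadius σ x = 0 by ring, Real.exp_zero,
      one_mul]
  have hq2 : radialSpeed gi σ x ≤ 2 := by
    have h1 := G.speed x hxδ hx0
    rw [G.sqrt_eq_exp hxδ hx0] at h1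
    have h2 : K * Real.exp (logRadius σ x) ≤ errorConst m K * Real.exp (logRadius σ x) := by
      refine mul_le_mul_of_nonneg_right ?_ (Real.exp_pos _).le
      have h3 := le_errorConst (m := m) G.one_le
      have h4 : 0 ≤ (m : ℝ) * K := mul_nonneg (by linarith) (by linarith [G.one_le])
      linarith [G.one_le]
    have h3 := hsmall x hx
    have h4 : 1 / logRadius σ x ^ 2 ≤ 1 / 100 :=
      one_div_le_one_div_of_le (by norm_num) (by nlinarith [hOt x hx])
    have h5 := (abs_le.1 h1).1
    linarith
  have hp : (carlemanP β (logRadius σ x) - (m - 1) / 2) ^ 2 ≤ β ^ 2 := by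
    refine sq_le_sq' ?_ ?_ <;> linarith
  have hJ0 := G.J_pos hxδ
  have hℓ : 0 < 1 / logRadius σ x ^ 2 := by
    have := pow_ne_zero 2 (hOt' x hx)
    positivity
  have hq0 : 0 ≤ radialSpeed gi σ x := by
    rw [← quadratic_logRadius G hxδ hx0 hsymm]
    exact mul_nonneg (Real.exp_pos _).le (G.quadratic_nonneg hxδ _)
  have hy0 : 0 ≤ Real.exp (2 * logRadius σ x)
      * ∑ i, ∑ j, gi i j x * pd i (conjFun σ β v) x * pd j (conjFun σ β v) x :=
    mul_nonneg (Real.exp_pos _).le (G.quadratic_nonneg hxδ _)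
  have hu : conjFun σ β v x = conjWeight m β (logRadius σ x) * v x := rfl
  have hz0 : 0 < Real.exp (-(m + 1) * logRadius σ x) := Real.exp_pos _
  have hβ0 : 0 < β := by linarith
  unfold carlemanDensity sourceDensity
  generalize divField (weightedField gi J σ β ρ E h v) x = W at *
  generalize hY : Real.exp (2 * logRadius σ x)
      * ∑ i, ∑ j, gi i j x * pd i (conjFun σ β v) x * pd j (conjFun σ β v) x = y at *
  generalize Real.exp (2 * logRadius σ x)
      * ∑ i, ∑ j, gi i j x * pd i v x * pd j v x = yv at *
  generalize (J x)⁻¹ * divField (fluxField (densityCoeff gi J) v) x + E x * v x = Z at *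
  generalize carlemanP β (logRadius σ x) - (m - 1) / 2 = p at *
  generalize radialSpeed gi σ x = q at *
  rw [hu] at key hquad
  rw [← hz]
  have hB : 2 * J x * (Real.exp (β * -phi (logRadius σ x)) * Real.exp (2 * logRadius σ x) * Z) ^ 2
      = J x * Real.exp (-(m + 1) * logRadius σ x)
        * (2 * (conjWeight m β (logRadius σ x) * Real.exp (2 * logRadius σ x) * Z) ^ 2) := by
    rw [mul_pow, mul_pow, ← hz]; ring
  rw [hB]
  refine le_trans (add_le_add_right ?_ W) key
  rw [← mul_assoc (J x), mul_assoc (J x * _) (conjWeight m β (logRadius σ x) ^ 2)]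
  refine mul_le_mul_of_nonneg_left ?_ (mul_pos hJ0 hz0).le
  generalize conjWeight m β (logRadius σ x) = c at *
  generalize ρ * Real.exp (-1 * logRadius σ x) = θ at *
  generalize 1 / logRadius σ x ^ 2 = ℓ at *
  -- With p² ≤ β² and q ≤ 2, the coefficient βℓ/8 of the gradient of v costs βℓy/4 + β³ℓu²/2. This
  -- fits into the available βℓy/2 and leaves half of β³ℓu².
  have h1 : p ^ 2 * q * (c * v x) ^ 2 ≤ β ^ 2 * 2 * (c * v x) ^ 2 := by gcongr
  have h2 := mul_le_mul_of_nonneg_left (hquad.trans (add_le_add_right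
    (mul_le_mul_of_nonneg_left h1 two_pos.le) _)) (by positivity : 0 ≤ 1 / 8 * β * ℓ)
  have h3 : 0 ≤ β * ℓ * y := by positivity
  linarith

end IntegralEstimate

/-! ### Integration for a single component. -/

section IntegralEstimate

open Filter Topology

variable {m : ℕ} {gi : Fin (m + 1) → Fin (m + 1) → Space m → ℝ} {J σ : Space m → ℝ} {δ K : ℝ}
  {x : Space m} {O k : Set (Space m)} {β ρ : ℝ} {E h v : Space m → ℝ}

theorem continuousOn_carlemanDensity (G : IsCarlemanGeometry gi J σ δ K) (hO : IsOpen O)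
    (hOδ : O ⊆ Metric.ball 0 δ) (hO0 : ∀ y ∈ O, y ≠ 0) (hOt : ∀ y ∈ O, logRadius σ y ≠ 0)
    (hv : ContDiffOn ℝ ∞ v O) : ContinuousOn (carlemanDensity gi J σ β ρ v) O := by
  have ht : ContinuousOn (logRadius σ) O := (contDiffOn_logRadius (G.smooth_σ.mono hOδ)
    fun y hy => G.σ_pos y (hOδ hy) (hO0 y hy)).continuousOn
  have hJ := (G.smooth_J.mono hOδ).continuousOn
  have hphi : ContinuousOn (fun y => phi (logRadius σ y)) O :=
    ht.add ((ht.pow 2).log fun y hy => pow_ne_zero 2 (hOt y hy))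
  have hq : ContinuousOn (fun y => ∑ i, ∑ j, gi i j y * pd i v y * pd j v y) O :=
    continuousOn_finsetSum _ fun i _ => continuousOn_finsetSum _ fun j _ =>
      (((G.smooth_gi i j).mono hOδ).continuousOn.mul (contDiffOn_pd hv hO i).continuousOn).mul
        (contDiffOn_pd hv hO j).continuousOn
  have he : ∀ c : ℝ, ContinuousOn (fun y => Real.exp (c * logRadius σ y)) O := fun c =>
    (continuousOn_const.mul ht).rexp
  have hv2 := hv.continuousOn.pow 2
  have hl : ContinuousOn (fun y => 1 / logRadius σ y ^ 2) O :=
    continuousOn_const.div (ht.pow 2) fun y hy => pow_ne_zero 2 (hOt y hy)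
  exact (hJ.mul (((continuousOn_const.mul hphi.neg).rexp).pow 2)).mul
    ((((continuousOn_const.mul hl).mul hv2).add
      ((continuousOn_const.mul hl).mul ((he 2).mul hq))).add
      ((continuousOn_const.mul (continuousOn_const.mul (he (-1)))).mul hv2))

theorem continuousOn_sourceDensity (G : IsCarlemanGeometry gi J σ δ K) (hO : IsOpen O)
    (hOδ : O ⊆ Metric.ball 0 δ) (hO0 : ∀ y ∈ O, y ≠ 0) (hOt : ∀ y ∈ O, logRadius σ y ≠ 0)
    (hv : ContDiffOn ℝ ∞ v O) {s : Set (Space m)} (hs : s ⊆ O) (hE : ContinuousOn E s) :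
    ContinuousOn (sourceDensity gi J σ β E v) s := by
  have ht : ContinuousOn (logRadius σ) O := (contDiffOn_logRadius (G.smooth_σ.mono hOδ)
    fun y hy => G.σ_pos y (hOδ hy) (hO0 y hy)).continuousOn
  have hJ := (G.smooth_J.mono hOδ).continuousOn
  have hphi : ContinuousOn (fun y => phi (logRadius σ y)) O :=
    ht.add ((ht.pow 2).log fun y hy => pow_ne_zero 2 (hOt y hy))
  have he : ∀ c : ℝ, ContinuousOn (fun y => Real.exp (c * logRadius σ y)) O := fun c =>
    (continuousOn_const.mul ht).rexp
  have hL : ContinuousOn (fun y => (J y)⁻¹ * divField (fluxField (densityCoeff gi J) v) y) O :=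
    (hJ.inv₀ fun y hy => (G.J_pos (hOδ hy)).ne').mul (contDiffOn_divField hO
      (contDiffOn_fluxField hO (fun i j => (G.smooth_J.mono hOδ).mul
        ((G.smooth_gi i j).mono hOδ)) hv)).continuousOn
  have hw : ContinuousOn (fun y => Real.exp (β * -phi (logRadius σ y))
      * Real.exp (2 * logRadius σ y)) O := ((continuousOn_const.mul hphi.neg).rexp).mul (he 2)
  exact (continuousOn_const.mul (hJ.mono hs)).mul
    (((hw.mono hs).mul ((hL.mono hs).add (hE.mul (hv.continuousOn.mono hs)))).pow 2)

/-- The integrated Carleman estimate for one component. -/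
theorem integral_carlemanDensity_le (G : IsCarlemanGeometry gi J σ δ K) (hm : 1 ≤ m)
    (hO : IsOpen O) (hOδ : O ⊆ Metric.ball 0 δ) (hO0 : ∀ y ∈ O, y ≠ 0)
    (hOt : ∀ y ∈ O, logRadius σ y ≤ -10)
    (hsmall : ∀ y ∈ O, errorConst m K * Real.exp (logRadius σ y) ≤ 1 / logRadius σ y ^ 2 / 1000)
    (hv : ContDiffOn ℝ ∞ v O) (hk : IsCompact k) (hkO : k ⊆ O) (hkH : k ⊆ halfSpace m)
    (hvk : ∀ y ∈ O, 0 < y (Fin.last m) → y ∉ k → v y = 0)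
    (hβ : 20 + 16 * m ≤ β) (hρ0 : 0 ≤ ρ) (hρ : ∀ y ∈ k, ρ ≤ Real.exp (logRadius σ y))
    (hEd : ContDiffOn ℝ 1 E (O ∩ halfSpace m)) (hhd : ContDiffOn ℝ 1 h (O ∩ halfSpace m))
    (hE : ∀ y ∈ O ∩ openHalfSpace m, |E y| ≤ β ^ 2 ∧ ∀ i, |pd i E y| ≤ β ^ 2)
    (hh : ∀ y ∈ O ∩ openHalfSpace m, |h y| ≤ β ∧ ∀ i, |pd i h y| ≤ β)
    (hbd : (∀ y ∈ O, y (Fin.last m) = 0 → v y = 0) ∨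
      ∀ y ∈ O, y (Fin.last m) = 0 → pd (Fin.last m) v y = h y * v y) :
    IntegrableOn (carlemanDensity gi J σ β ρ v) (O ∩ openHalfSpace m) ∧
    IntegrableOn (sourceDensity gi J σ β E v) (O ∩ openHalfSpace m) ∧
    ∫ y in O ∩ openHalfSpace m, carlemanDensity gi J σ β ρ v y ≤
      ∫ y in O ∩ openHalfSpace m, sourceDensity gi J σ β E v y := by
  have hOt' : ∀ y ∈ O, logRadius σ y ≠ 0 := fun y hy h0 => by
    have := hOt y hy
    linarith
  have hvnear : ∀ y ∈ O, 0 < y (Fin.last m) → y ∉ k → v =ᶠ[𝓝 y] fun _ => 0 := by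
    intro y hy hyn hyk
    filter_upwards [hO.mem_nhds hy, isOpen_openHalfSpace.mem_nhds hyn,
      hk.isClosed.isOpen_compl.mem_nhds hyk] with w h1 h2 h3
    exact hvk w h1 h2 h3
  have hunear : ∀ y ∈ O, 0 < y (Fin.last m) → y ∉ k → conjFun σ β v =ᶠ[𝓝 y] fun _ => 0 := by
    intro y hy hyn hyk
    filter_upwards [hvnear y hy hyn hyk] with w hw
    rw [conjFun, hw, mul_zero]
  have hWzero : ∀ i, ∀ y ∈ O, 0 < y (Fin.last m) → y ∉ k →
      weightedField gi J σ β ρ E h v i y = 0 := by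
    intro i y hy hyn hyk
    have h1 := hunear y hy hyn hyk
    exact carlemanField_eq_zero h1.self_of_nhds (fun j => (pd_congr h1).trans (pd_const 0)) i
  have hdzero : ∀ y ∈ O, 0 < y (Fin.last m) → y ∉ k → carlemanDensity gi J σ β ρ v y = 0 := by
    intro y hy hyn hyk
    have h1 := hvnear y hy hyn hyk
    have h2 : ∀ j, pd j v y = 0 := fun j => (pd_congr h1).trans (pd_const 0)
    simp [carlemanDensity, h1.self_of_nhds, h2]
  have hszero : ∀ y ∈ O, 0 < y (Fin.last m) → y ∉ k → sourceDensity gi J σ β E v y = 0 := by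
    intro y hy hyn hyk
    have h1 := hvnear y hy hyn hyk
    have h2 : ∀ i, fluxField (densityCoeff gi J) v i =ᶠ[𝓝 y] fun _ => 0 := fun i => by
      filter_upwards [h1.eventuallyEq_nhds] with w hw
      exact Finset.sum_eq_zero fun j _ => by rw [pd_congr hw, pd_const, mul_zero]
    have h3 : divField (fluxField (densityCoeff gi J) v) y = 0 :=
      Finset.sum_eq_zero fun i _ => (pd_congr (h2 i)).trans (pd_const 0)
    simp [sourceDensity, h1.self_of_nhds, h3]
  have hW := contDiffOn_weightedField (β := β) (ρ := ρ) G hO hOδ hO0 hOt' hv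
    (inter_subset_left (s := O) (t := halfSpace m)) hEd hhd
  obtain ⟨hdiv, hdiv0⟩ := integral_divergence_halfSpace hO hk hkO _ hW hWzero
    fun y hy hyn => weightedField_normal_eq_zero G hO hOδ hO0 hOt' hv hbd hy hyn
  have hint1 := integrableOn_halfSpace hO hk hkO hkH
    ((continuousOn_carlemanDensity (β := β) (ρ := ρ) G hO hOδ hO0 hOt' hv).mono
      inter_subset_left) hdzero
  have hint2 := integrableOn_halfSpace hO hk hkO hkH
    (continuousOn_sourceDensity (β := β) G hO hOδ hO0 hOt' hv inter_subset_left
      hEd.continuousOn) hszero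
  refine ⟨hint1, hint2, ?_⟩
  -- The integral of the divergence is zero, so it can be added to the left side before comparing
  -- pointwise.
  rw [← zero_add (∫ y in O ∩ openHalfSpace m, carlemanDensity gi J σ β ρ v y), ← hdiv0,
    ← integral_add hdiv hint1]
  have hopen : IsOpen (O ∩ openHalfSpace m) := hO.inter isOpen_openHalfSpace
  refine setIntegral_mono_on (hdiv.add hint1) hint2 hopen.measurableSet ?_
  intro y hy
  have hyn : 0 < y (Fin.last m) := hy.2
  by_cases hyk : y ∈ k
  · have hsub : O ∩ openHalfSpace m ⊆ O ∩ halfSpace m :=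
      inter_subset_inter_right _ openHalfSpace_subset
    have hd : ∀ {f : Space m → ℝ}, ContDiffOn ℝ 1 f (O ∩ halfSpace m) → DifferentiableAt ℝ f y :=
      fun hf => ((hf.mono hsub).contDiffAt (hopen.mem_nhds hy)).differentiableAt (by simp)
    exact carleman_density_pointwise G hm hO hOδ hO0 hOt hsmall hv hy.1 hyn.le hβ hρ0 (hρ y hyk)
      (hd hEd) (hd hhd) (hE y hy).1 (hE y hy).2 (hh y hy).1 (hh y hy).2
  · have h1 : ∀ i, pd i (weightedField gi J σ β ρ E h v i) y = 0 := fun i => by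
      have : weightedField gi J σ β ρ E h v i =ᶠ[𝓝 y] fun _ => 0 := by
        filter_upwards [hO.mem_nhds hy.1, isOpen_openHalfSpace.mem_nhds hyn,
          hk.isClosed.isOpen_compl.mem_nhds hyk] with w h1 h2 h3
        exact hWzero i w h1 h2 h3
      exact (pd_congr this).trans (pd_const 0)
    simp only [h1, Finset.sum_const_zero, zero_add, hdzero y hy.1 hyn hyk,
      hszero y hy.1 hyn hyk, le_refl]

end IntegralEstimate

/-! ### From integral inequalities to weighted L² norms. -/

section WeightedNorms

variable {m : ℕ} {g : Space m → Matrix (Fin (m + 1)) (Fin (m + 1)) ℝ} {s : Set (Space m)}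
  {G H : Type*} [NormedAddCommGroup G] [NormedAddCommGroup H]

theorem sq_const_mul_l2Norm (hg : AEMeasurable (fun x => √(g x).det) (volume.restrict s))
    {c : ℝ} (hc : 0 ≤ c) (f : Space m → G) :
    (ENNReal.ofReal c * l2Norm g s f) ^ 2 =
      ∫⁻ x in s, ENNReal.ofReal (c ^ 2 * ‖f x‖ ^ 2 * √(g x).det) := by
  have h1 : l2Norm g s f ^ 2 = ∫⁻ x in s, ENNReal.ofReal (√(g x).det) * ‖f x‖ₑ ^ 2 := by
    rw [l2Norm, eLpNorm_eq_lintegral_rpow_enorm_toReal (by norm_num) (by norm_num),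
      lintegral_withDensity_eq_lintegral_mul_non_measurable₀ _ hg.ennreal_ofReal (by simp),
      ← ENNReal.rpow_natCast, ← ENNReal.rpow_mul]
    norm_num
  rw [mul_pow, h1, ← lintegral_const_mul' _ _ (by finiteness)]
  congr 1
  ext x
  rw [← ofReal_norm, ← ENNReal.ofReal_pow (norm_nonneg _), ← ENNReal.ofReal_pow hc,
    ← ENNReal.ofReal_mul (Real.sqrt_nonneg _), ← ENNReal.ofReal_mul (by positivity)]
  congr 1
  ring

/-- A comparison of weighted norms follows from an inequality between integrals. -/
theorem const_mul_l2Norm_le (hs : MeasurableSet s)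
    (hg : AEMeasurable (fun x => √(g x).det) (volume.restrict s))
    {A B : Space m → ℝ} (hA : IntegrableOn A s) (hB : IntegrableOn B s)
    (hAB : ∫ x in s, A x ≤ ∫ x in s, B x) {a c C : ℝ} (ha : 0 < a) (hc : 0 ≤ c) (hC : 0 ≤ C)
    {f : Space m → G} {F : Space m → H}
    (hf : ∀ x ∈ s, c ^ 2 * ‖f x‖ ^ 2 * √(g x).det ≤ a * A x)
    (hB0 : ∀ x ∈ s, 0 ≤ B x)
    (hF : ∀ x ∈ s, a * B x ≤ C ^ 2 * ‖F x‖ ^ 2 * √(g x).det) :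
    ENNReal.ofReal c * l2Norm g s f ≤ ENNReal.ofReal C * l2Norm g s F := by
  rw [← ENNReal.pow_le_pow_left_iff two_ne_zero, sq_const_mul_l2Norm hg hc,
    sq_const_mul_l2Norm hg hC]
  have hA0 : ∀ x ∈ s, 0 ≤ a * A x := fun x hx => le_trans (by positivity) (hf x hx)
  calc _ ≤ ∫⁻ x in s, ENNReal.ofReal (a * A x) :=
        setLIntegral_mono' hs fun x hx => ENNReal.ofReal_le_ofReal (hf x hx)
    _ = ENNReal.ofReal (∫ x in s, a * A x) := (ofReal_integral_eq_lintegral_ofReal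
        (hA.const_mul a) ((ae_restrict_iff' hs).2 (ae_of_all _ hA0))).symm
    _ ≤ ENNReal.ofReal (∫ x in s, a * B x) := by
        rw [integral_const_mul, integral_const_mul]
        exact ENNReal.ofReal_le_ofReal (mul_le_mul_of_nonneg_left hAB ha.le)
    _ = ∫⁻ x in s, ENNReal.ofReal (a * B x) := ofReal_integral_eq_lintegral_ofReal
        (hB.const_mul a) ((ae_restrict_iff' hs).2
          (ae_of_all _ fun x hx => mul_nonneg ha.le (hB0 x hx)))
    _ ≤ _ := setLIntegral_mono' hs fun x hx => ENNReal.ofReal_le_ofReal (hF x hx)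

end WeightedNorms

/-! ### The Laplace–Beltrami operator, the C¹ norm, and smallness of r(ln r)². -/

section OperatorsInCoordinates

variable {m : ℕ} {g : Space m → Matrix (Fin (m + 1)) (Fin (m + 1)) ℝ} {O : Set (Space m)}

theorem laplaceBeltrami_eq (hO : IsOpen O)
    (hgi : ∀ i j, ContDiffOn ℝ ∞ (fun x => (g x)⁻¹ i j) O)
    (hJ : ContDiffOn ℝ ∞ (fun x => √(g x).det) O) {v : Space m → ℝ} (hv : ContDiffOn ℝ ∞ v O)
    {x : Space m} (hx : x ∈ O) :
    laplaceBeltrami g v x = (√(g x).det)⁻¹ * divField (fluxField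
      (densityCoeff (fun i j x => (g x)⁻¹ i j) fun x => √(g x).det) v) x := by
  rw [laplaceBeltrami, divField]
  congr 1
  refine Finset.sum_congr rfl fun i _ => (pd_sum Finset.univ fun j _ => ?_).symm
  exact differentiableAt_of_contDiffOn hO ((hJ.mul (hgi i j)).mul (contDiffOn_pd hv hO j)) hx

/-- At interior points the derivative within the set is the ordinary one, so the norm up to the
boundary controls the partial derivatives there. -/
theorem abs_le_of_cOneNorm_le {s : Set (Space m)} {f : Space m → ℝ} {M : ℝ} (hM : 0 ≤ M)
    (hf : cOneNorm s f ≤ ENNReal.ofReal M) {x : Space m} (hx : s ∈ nhds x) :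
    |f x| ≤ M ∧ ∀ i, |pd i f x| ≤ M := by
  have hxs := mem_of_mem_nhds hx
  have h1 : ‖f x‖ₑ ≤ ENNReal.ofReal M :=
    (le_iSup₂ (f := fun x (_ : x ∈ s) => ‖f x‖ₑ) x hxs).trans (le_self_add.trans hf)
  have h2 : ‖fderivWithin ℝ f s x‖ₑ ≤ ENNReal.ofReal M :=
    (le_iSup₂ (f := fun x (_ : x ∈ s) => ‖fderivWithin ℝ f s x‖ₑ) x hxs).trans
      (le_add_self.trans hf)
  rw [fderivWithin_of_mem_nhds hx] at h2
  rw [← ofReal_norm, ENNReal.ofReal_le_ofReal_iff hM] at h1 h2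
  exact ⟨h1, fun i => norm_pd_le.trans h2⟩

/-- Since r(ln r)² → 0, errors of relative size r are absorbed by gains of relative size 1/(ln r)².
This fixes how small r₀ must be. -/
theorem exists_small_log (c : ℝ) : ∃ T : ℝ, 10 ≤ T ∧ ∀ τ ≤ -T,
    c * Real.exp τ ≤ 1 / τ ^ 2 / 1000 := by
  have h1 := (Real.tendsto_pow_mul_exp_neg_atTop_nhds_zero 2).const_mul c
  rw [mul_zero] at h1
  obtain ⟨T, hT⟩ := Filter.eventually_atTop.1
    (h1.eventually (gt_mem_nhds (by norm_num : (0 : ℝ) < 1 / 1000)))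
  refine ⟨max T 10, le_max_right _ _, fun τ hτ => ?_⟩
  have h10 : τ ≤ -10 := hτ.trans (neg_le_neg (le_max_right _ _))
  have h2 := hT (-τ) ((le_max_left T 10).trans (by linarith))
  have h3 : 0 < τ ^ 2 := by nlinarith
  rw [neg_neg, neg_sq] at h2
  rw [div_div, le_div_iff₀ (by positivity)]
  linarith

end OperatorsInCoordinates

/-! ### The estimate for the system. -/

section VectorEstimate

variable {m : ℕ} {g : Space m → Matrix (Fin (m + 1)) (Fin (m + 1)) ℝ} {σ : Space m → ℝ} {δ K : ℝ}
  {O k : Set (Space m)} {β ρ : ℝ} {r E h : Space m → ℝ} {V F : Space m → Space m}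

theorem sum_carlemanDensity (x : Space m) :
    ∑ i, carlemanDensity (fun i j x => (g x)⁻¹ i j) (fun x => √(g x).det) σ β ρ
      (fun y => V y i) x =
    √(g x).det * Real.exp (β * -phi (logRadius σ x)) ^ 2 * (
      1 / 2 * β ^ 3 * (1 / logRadius σ x ^ 2) * ‖V x‖ ^ 2
      + 1 / 8 * β * (1 / logRadius σ x ^ 2) * (Real.exp (2 * logRadius σ x)
        * ∑ k, ∑ i, ∑ j, (g x)⁻¹ i j * pd i (fun y => V y k) x * pd j (fun y => V y k) x)
      + 1 / 5 * β ^ 2 * (ρ * Real.exp (-1 * logRadius σ x)) * ‖V x‖ ^ 2) := by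
  simp only [carlemanDensity, norm_sq_eq_sum]
  rw [← Finset.mul_sum, Finset.sum_add_distrib, Finset.sum_add_distrib, ← Finset.mul_sum,
    ← Finset.mul_sum, ← Finset.mul_sum, ← Finset.mul_sum]

/-- The Carleman estimate near the origin, for solutions of the system supported in `k`. -/
theorem carleman_l2Norm_le
    (G : IsCarlemanGeometry (fun i j x => (g x)⁻¹ i j) (fun x => √(g x).det) σ δ K) (hm : 1 ≤ m)
    (hO : IsOpen O) (hOδ : O ⊆ Metric.ball 0 δ) (hO0 : ∀ y ∈ O, y ≠ 0)
    (hOt : ∀ y ∈ O, logRadius σ y ≤ -10)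
    (hsmall : ∀ y ∈ O, errorConst m K * Real.exp (logRadius σ y) ≤ 1 / logRadius σ y ^ 2 / 1000)
    (hr : ∀ y ∈ O ∩ openHalfSpace m, r y = Real.exp (logRadius σ y))
    (hV : ContDiff ℝ ∞ V) (hk : IsCompact k) (hkO : k ⊆ O) (hkH : k ⊆ halfSpace m)
    (hVk : ∀ y ∈ O, 0 < y (Fin.last m) → y ∉ k → V y = 0)
    (hβ : 20 + 16 * m ≤ β) (hρ0 : 0 ≤ ρ) (hρ : ∀ y ∈ k, ρ ≤ Real.exp (logRadius σ y))
    (hEd : ContDiffOn ℝ 1 E (O ∩ halfSpace m)) (hhd : ContDiffOn ℝ 1 h (O ∩ halfSpace m))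
    (hE : ∀ y ∈ O ∩ openHalfSpace m, |E y| ≤ β ^ 2 ∧ ∀ i, |pd i E y| ≤ β ^ 2)
    (hh : ∀ y ∈ O ∩ openHalfSpace m, |h y| ≤ β ∧ ∀ i, |pd i h y| ≤ β)
    (heq : ∀ y ∈ O ∩ openHalfSpace m, ∀ i,
      laplaceBeltrami g (fun z => V z i) y + E y * V y i = F y i)
    (hbd : ∀ y ∈ O, y (Fin.last m) = 0 → (∀ i, i ≠ Fin.last m → V y i = 0) ∧
      pd (Fin.last m) (fun z => V z (Fin.last m)) y = h y * V y (Fin.last m)) :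
    ENNReal.ofReal (β ^ (3 / 2 : ℝ)) *
        l2Norm g (O ∩ openHalfSpace m) (fun x => (weight r β x * (Real.log (r x))⁻¹) • V x)
      + ENNReal.ofReal (β * ρ ^ (1 / 2 : ℝ)) *
        l2Norm g (O ∩ openHalfSpace m) (fun x => (r x ^ (-(1 / 2) : ℝ) * weight r β x) • V x)
      + ENNReal.ofReal (β ^ (1 / 2 : ℝ)) *
        l2Norm g (O ∩ openHalfSpace m)
          (fun x => r x * weight r β x * (Real.log (r x))⁻¹ * gradNorm g V x)
      ≤ ENNReal.ofReal 10 *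
        l2Norm g (O ∩ openHalfSpace m) (fun x => (r x ^ 2 * weight r β x) • F x) := by
  have hVi : ∀ i, ContDiff ℝ ∞ fun y => V y i := fun i =>
    (EuclideanSpace.proj (𝕜 := ℝ) i : Space m →L[ℝ] ℝ).contDiff.comp hV
  have hs : MeasurableSet (O ∩ openHalfSpace m) := (hO.inter isOpen_openHalfSpace).measurableSet
  have hg : AEMeasurable (fun x => √(g x).det) (volume.restrict (O ∩ openHalfSpace m)) :=
    (((G.smooth_J.mono hOδ).continuousOn).mono inter_subset_left).aemeasurable hs
  have hint := fun i => integral_carlemanDensity_le (v := fun y => V y i) G hm hO hOδ hO0 hOt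
    hsmall (hVi i).contDiffOn hk hkO hkH (fun y hy hyn hyk => by simp [hVk y hy hyn hyk]) hβ hρ0
    hρ hEd hhd hE hh (by
      -- The same h enters the field for every component; it does no harm for the tangential ones,
      -- whose flux vanishes by the Dirichlet condition.
      by_cases hi : i = Fin.last m
      · subst hi
        exact Or.inr fun y hy hyn => (hbd y hy hyn).2
      · exact Or.inl fun y hy hyn => (hbd y hy hyn).1 i hi)
  have hA := integrable_finsetSum Finset.univ fun i _ => (hint i).1
  have hB := integrable_finsetSum Finset.univ fun i _ => (hint i).2.1
  have hAB := Finset.sum_le_sum fun i (_ : i ∈ Finset.univ) => (hint i).2.2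
  rw [← integral_finsetSum _ fun i _ => (hint i).1,
    ← integral_finsetSum _ fun i _ => (hint i).2.1] at hAB
  have hlog : ∀ y ∈ O ∩ openHalfSpace m, Real.log (r y) = logRadius σ y := fun y hy => by
    rw [hr y hy, Real.log_exp]
  have hsource : ∀ y ∈ O ∩ openHalfSpace m, ∑ i, sourceDensity (fun i j x => (g x)⁻¹ i j)
      (fun x => √(g x).det) σ β E (fun y => V y i) y =
      2 * (‖(r y ^ 2 * weight r β y) • F y‖ ^ 2 * √(g y).det) := by
    intro y hy
    have e1 : ∀ i, (√(g y).det)⁻¹ * divField (fluxField (densityCoeff (fun i j x => (g x)⁻¹ i j)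
        fun x => √(g x).det) fun y => V y i) y + E y * V y i = F y i := fun i => by
      rw [← heq y hy i, laplaceBeltrami_eq hO (fun i j => (G.smooth_gi i j).mono hOδ)
        (G.smooth_J.mono hOδ) (hVi i).contDiffOn hy.1]
    simp only [sourceDensity, e1]
    rw [norm_smul, mul_pow, Real.norm_eq_abs, sq_abs, norm_sq_eq_sum, weight, hlog y hy, hr y hy,
      ← exp_two_mul_eq_sq, Finset.mul_sum, Finset.sum_mul, Finset.mul_sum]
    exact Finset.sum_congr rfl fun i _ => by ring
  have hB0 : ∀ y ∈ O ∩ openHalfSpace m, 0 ≤ ∑ i, sourceDensity (fun i j x => (g x)⁻¹ i j)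
      (fun x => √(g x).det) σ β E (fun y => V y i) y := fun y hy => by
    rw [hsource y hy]; positivity
  have hF : ∀ a C : ℝ, 2 * a ≤ C ^ 2 → ∀ y ∈ O ∩ openHalfSpace m,
      a * ∑ i, sourceDensity (fun i j x => (g x)⁻¹ i j)
        (fun x => √(g x).det) σ β E (fun y => V y i) y ≤
      C ^ 2 * ‖(r y ^ 2 * weight r β y) • F y‖ ^ 2 * √(g y).det := fun a C haC y hy => by
    rw [hsource y hy]
    have : 0 ≤ ‖(r y ^ 2 * weight r β y) • F y‖ ^ 2 * √(g y).det := by positivity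
    nlinarith
  have hβ0 : 0 < β := by
    have : (0 : ℝ) ≤ m := m.cast_nonneg
    linarith
  have hgrad : ∀ y ∈ O ∩ openHalfSpace m, gradNorm g V y ^ 2 = ∑ k, ∑ i, ∑ j,
      (g y)⁻¹ i j * pd i (fun y => V y k) y * pd j (fun y => V y k) y := fun y hy =>
    Real.sq_sqrt (Finset.sum_nonneg fun k _ => G.quadratic_nonneg (hOδ hy.1) _)
  have c1 : (β ^ (3 / 2 : ℝ)) ^ 2 = β ^ 3 := by
    rw [← Real.rpow_natCast, ← Real.rpow_mul hβ0.le, ← Real.rpow_natCast]; norm_num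
  have chalf : ∀ a : ℝ, 0 ≤ a → (a ^ (1 / 2 : ℝ)) ^ 2 = a := fun a ha => by
    rw [← Real.rpow_natCast, ← Real.rpow_mul ha]; norm_num
  -- Each norm is estimated separately by dropping the other two terms of the density. The factors a
  -- = 2, 5, 8 undo its coefficients 1/2, 1/5, 1/8. As the source carries a factor 2, C² ≥ 2a is
  -- needed, and C = 2, 4, 4 adds up to 10.
  have t1 := const_mul_l2Norm_le (a := 2) (c := β ^ (3 / 2 : ℝ)) (C := 2)
    (f := fun x => (weight r β x * (Real.log (r x))⁻¹) • V x)
    (F := fun x => (r x ^ 2 * weight r β x) • F x) hs hg hA hB hAB two_pos (by positivity)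
    two_pos.le (fun y hy => by
      rw [sum_carlemanDensity, ← hgrad y hy, norm_smul, mul_pow, Real.norm_eq_abs, sq_abs, c1,
        weight, hlog y hy]
      have h1 : 0 ≤ √(g y).det * Real.exp (β * -phi (logRadius σ y)) ^ 2 * (
          1 / 8 * β * (1 / logRadius σ y ^ 2) * (Real.exp (2 * logRadius σ y) * gradNorm g V y ^ 2)
          + 1 / 5 * β ^ 2 * (ρ * Real.exp (-1 * logRadius σ y)) * ‖V y‖ ^ 2) := by positivity
      rw [mul_pow, inv_pow, ← one_div]
      linarith) hB0 (hF 2 2 (by norm_num))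
  have t2 := const_mul_l2Norm_le (a := 5) (c := β * ρ ^ (1 / 2 : ℝ)) (C := 4)
    (f := fun x => (r x ^ (-(1 / 2) : ℝ) * weight r β x) • V x)
    (F := fun x => (r x ^ 2 * weight r β x) • F x) hs hg hA hB hAB (by norm_num) (by positivity)
    (by norm_num) (fun y hy => by
      rw [sum_carlemanDensity, ← hgrad y hy, norm_smul, mul_pow β, Real.norm_eq_abs,
        mul_pow |_|, sq_abs, chalf ρ hρ0, weight, hlog y hy, hr y hy, ← Real.exp_mul]
      have h1 : 0 ≤ √(g y).det * Real.exp (β * -phi (logRadius σ y)) ^ 2 * (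
          1 / 2 * β ^ 3 * (1 / logRadius σ y ^ 2) * ‖V y‖ ^ 2 +
          1 / 8 * β * (1 / logRadius σ y ^ 2)
            * (Real.exp (2 * logRadius σ y) * gradNorm g V y ^ 2)) := by positivity
      have h2 : Real.exp (logRadius σ y * -(1 / 2)) ^ 2 = Real.exp (-1 * logRadius σ y) := by
        rw [← Real.exp_nat_mul]; congr 1; push_cast; ring
      rw [mul_pow (Real.exp _), h2]
      linarith) hB0 (hF 5 4 (by norm_num))
  have t3 := const_mul_l2Norm_le (a := 8) (c := β ^ (1 / 2 : ℝ)) (C := 4)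
    (f := fun x => r x * weight r β x * (Real.log (r x))⁻¹ * gradNorm g V x)
    (F := fun x => (r x ^ 2 * weight r β x) • F x) hs hg hA hB hAB (by norm_num) (by positivity)
    (by norm_num) (fun y hy => by
      rw [sum_carlemanDensity, ← hgrad y hy, Real.norm_eq_abs, sq_abs, chalf β hβ0.le, weight,
        hlog y hy, hr y hy]
      have h1 : 0 ≤ √(g y).det * Real.exp (β * -phi (logRadius σ y)) ^ 2 * (
          1 / 2 * β ^ 3 * (1 / logRadius σ y ^ 2) * ‖V y‖ ^ 2 +
          1 / 5 * β ^ 2 * (ρ * Real.exp (-1 * logRadius σ y)) * ‖V y‖ ^ 2) := by positivity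
      rw [mul_pow, mul_pow, mul_pow, inv_pow, ← one_div, ← exp_two_mul_eq_sq]
      linarith) hB0 (hF 8 4 (by norm_num))
  refine (add_le_add (add_le_add t1 t2) t3).trans (le_of_eq ?_)
  rw [← add_mul, ← add_mul, ← ENNReal.ofReal_add (by norm_num) (by norm_num),
    ← ENNReal.ofReal_add (by norm_num) (by norm_num)]
  norm_num

end VectorEstimate

theorem IsSquaredRadius.mono {m : ℕ} {R δ : ℝ} {σ : Space m → ℝ} (h : IsSquaredRadius R σ)
    (hδ : δ ≤ R) : IsSquaredRadius δ σ where
  smooth := h.smooth.mono (Metric.ball_subset_ball hδ)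
  zero := h.zero
  pd_zero := h.pd_zero
  hessian_zero := h.hessian_zero
  normal := fun x hx => h.normal x ⟨hx.1.trans_le hδ, hx.2⟩

end HalfBallCarleman

/-! ### The choice of constants and the conclusion. -/

theorem proposition3p2 (m : ℕ) (hm : 1 ≤ m) (R : ℝ) (hR : 0 < R)
    (g : Space m → Matrix (Fin (m + 1)) (Fin (m + 1)) ℝ) (hg : IsFermiMetric R g)
    (r : Space m → ℝ)
    (hr : (r = riemDist g R ∧ HasPolarHalfBall g R) ∨ r = fun x => ‖x‖) :
    ∃ C₁ C₀ r₀ : ℝ, 0 < C₁ ∧ 0 < C₀ ∧ 0 < r₀ ∧ r₀ < 1 ∧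
      ∀ (V F : Space m → Space m) (E h : Space m → ℝ) (β : ℝ),
        ContDiff ℝ ∞ V →
        halfSupport V ⊆ halfBallFlat R r r₀ \ {0} →
        ContDiffOn ℝ 1 E (halfBallFlat R r r₀) →
        ContDiffOn ℝ 1 h (halfBallFlat R r r₀) →
        ENNReal.ofReal C₀ * (1 + cOneNorm (halfBallFlat R r r₀) E ^ (1 / 2 : ℝ)
          + cOneNorm (halfBallFlat R r r₀) h) < ENNReal.ofReal β →
        (∀ x ∈ halfBall R r r₀, ∀ i,
          laplaceBeltrami g (fun y => V y i) x + E x * V x i = F x i) →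
        (∀ x ∈ halfBallFlat R r r₀, x (Fin.last m) = 0 →
          (∀ i, i ≠ Fin.last m → V x i = 0) ∧
          pd (Fin.last m) (fun y => V y (Fin.last m)) x = h x * V x (Fin.last m)) →
        (ENNReal.ofReal (β ^ (3 / 2 : ℝ)) *
              l2Norm g (halfBall R r r₀)
                (fun x => (weight r β x * (Real.log (r x))⁻¹) • V x)
            + ENNReal.ofReal (β ^ (1 / 2 : ℝ)) *
              l2Norm g (halfBall R r r₀)
                (fun x => r x * weight r β x * (Real.log (r x))⁻¹ * gradNorm g V x)
          ≤ ENNReal.ofReal C₁ *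
              l2Norm g (halfBall R r r₀) (fun x => (r x ^ 2 * weight r β x) • F x)) ∧
        ∀ ρ : ℝ, 0 < ρ → (∀ x ∈ halfSupport V, ρ ≤ r x) →
          ENNReal.ofReal (β ^ (3 / 2 : ℝ)) *
              l2Norm g (halfBall R r r₀)
                (fun x => (weight r β x * (Real.log (r x))⁻¹) • V x)
            + ENNReal.ofReal (β * ρ ^ (1 / 2 : ℝ)) *
              l2Norm g (halfBall R r r₀)
                (fun x => (r x ^ (-(1 / 2) : ℝ) * weight r β x) • V x)
            + ENNReal.ofReal (β ^ (1 / 2 : ℝ)) *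
              l2Norm g (halfBall R r r₀)
                (fun x => r x * weight r β x * (Real.log (r x))⁻¹ * gradNorm g V x)
          ≤ ENNReal.ofReal C₁ *
              l2Norm g (halfBall R r r₀) (fun x => (r x ^ 2 * weight r β x) • F x) := by
  obtain ⟨σ, hσ, hrσ, hball⟩ := exists_squaredRadius hR hg hr
  obtain ⟨δ, hδ, hδR, hgi, hJ⟩ := exists_smooth_inverse hR hg
  have hsubR : Metric.ball (0 : Space m) δ ⊆ Metric.ball 0 R := Metric.ball_subset_ball hδR
  have hchart : Metric.ball (0 : Space m) δ ∩ halfSpace m ⊆ chart m R := by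
    rw [chart_eq]
    exact inter_subset_inter_left _ hsubR
  obtain ⟨δ', K, hδ', hδδ', G⟩ := exists_carlemanGeometry (gi := fun i j x => (g x)⁻¹ i j)
    (J := fun x => √(g x).det) hδ hgi (fun i j => by simp [hg.at_origin, Matrix.one_apply])
    (hσ.mono hδR) hJ (by simp [hg.at_origin]) (fun x hx => hg.inv_symm (hchart hx))
    (fun x hx => hg.inv_normal (hchart hx))
  obtain ⟨s, hs, hsball⟩ := hball δ' hδ'
  obtain ⟨T, hT, hsmall⟩ := exists_small_log (errorConst m K)
  -- The first bound keeps the half ball inside the neighbourhood with controlled geometry; the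
  -- second ensures τ ≤ -T, hence τ ≤ -10 and the smallness of the errors.
  set r₀ := min s (Real.exp (-T)) with hr₀
  have hr₀0 : 0 < r₀ := lt_min hs (Real.exp_pos _)
  have hr₀1 : r₀ < 1 := (min_le_right _ _).trans_lt (Real.exp_lt_one_iff.2 (by linarith))
  have hsubδ : halfBallFlat R r r₀ ⊆ Metric.ball 0 δ' := fun x hx =>
    hsball ⟨hx.1, hx.2.trans_le (min_le_left _ _)⟩
  have hδ'R : Metric.ball (0 : Space m) δ' ⊆ Metric.ball 0 R :=
    Metric.ball_subset_ball (hδδ'.trans hδR)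
  -- An open set on both sides of the flat boundary, cut out by the smooth extension σ rather than
  -- by r. The origin, where ln r is singular, is removed; the support of V avoids it.
  set O : Set (Space m) := (Metric.ball 0 δ' ∩ σ ⁻¹' Iio (r₀ ^ 2)) ∩ {0}ᶜ with hOdef
  have hO : IsOpen O := (G.smooth_σ.continuousOn.isOpen_inter_preimage Metric.isOpen_ball
    isOpen_Iio).inter isOpen_compl_singleton
  have hOδ : O ⊆ Metric.ball 0 δ' := fun x hx => hx.1.1
  have hO0 : ∀ y ∈ O, y ≠ 0 := fun y hy => hy.2
  have hOr : ∀ y ∈ O, Real.exp (logRadius σ y) < r₀ := fun y hy => by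
    rw [← G.sqrt_eq_exp (hOδ hy) (hO0 y hy)]
    exact (Real.sqrt_lt' hr₀0).2 hy.1.2
  have hOT : ∀ y ∈ O, logRadius σ y ≤ -T := fun y hy =>
    Real.exp_le_exp.1 ((hOr y hy).le.trans (min_le_right _ _))
  have hflat : O ∩ halfSpace m = halfBallFlat R r r₀ \ {0} := by
    ext x
    constructor
    · rintro ⟨hx, hxn⟩
      have hxc : x ∈ chart m R := by rw [chart_eq]; exact ⟨hδ'R (hOδ hx), hxn⟩
      refine ⟨⟨hxc, ?_⟩, hx.2⟩
      rw [hrσ x hxc, G.sqrt_eq_exp (hOδ hx) hx.2]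
      exact hOr x hx
    · rintro ⟨hx, hx0⟩
      have hxr := hx.2
      rw [hrσ x hx.1, Real.sqrt_lt' hr₀0] at hxr
      exact ⟨⟨⟨hsubδ hx, hxr⟩, hx0⟩, hx.1.2⟩
  have hopen : O ∩ openHalfSpace m = halfBall R r r₀ := by
    ext x
    constructor
    · rintro ⟨hx, hxn⟩
      have h1 : x ∈ halfBallFlat R r r₀ \ {0} := hflat ▸ ⟨hx, openHalfSpace_subset hxn⟩
      exact ⟨h1.1.1, hxn, h1.1.2⟩
    · rintro ⟨hx, hxn, hxr⟩
      have hx0 : x ≠ 0 := by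
        rintro rfl
        simp at hxn
      have h1 : x ∈ O ∩ halfSpace m := hflat ▸ ⟨⟨hx, hxr⟩, hx0⟩
      exact ⟨h1.1, hxn⟩
  have hrexp : ∀ y ∈ O ∩ halfSpace m, r y = Real.exp (logRadius σ y) := fun y hy => by
    have h1 : y ∈ halfBallFlat R r r₀ \ {0} := hflat ▸ hy
    rw [hrσ y h1.1.1, G.sqrt_eq_exp (hOδ hy.1) (hO0 y hy.1)]
  have hm0 : (1 : ℝ) ≤ m := by exact_mod_cast hm
  refine ⟨10, 20 + 16 * m, r₀, by norm_num, by positivity, hr₀0, hr₀1, ?_⟩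
  intro V F E h β hV hsupp hE hh hβ heq hbd
  -- As C₀ ≥ 1, the bound on β controls each summand. In particular both C¹ norms are finite.
  have hle : ∀ a : ℝ≥0∞, a ≤ 1 + cOneNorm (halfBallFlat R r r₀) E ^ (1 / 2 : ℝ)
      + cOneNorm (halfBallFlat R r r₀) h → a ≤ ENNReal.ofReal β := fun a ha => by
    refine (ha.trans ?_).trans hβ.le
    refine le_mul_of_one_le_left zero_le ?_
    rw [ENNReal.one_le_ofReal]
    linarith
  have hβC : 20 + 16 * m ≤ β := by
    have h1 : ENNReal.ofReal (20 + 16 * m) < ENNReal.ofReal β := by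
      refine lt_of_le_of_lt (le_mul_of_one_le_right zero_le ?_) hβ
      rw [add_assoc]
      exact le_self_add
    exact (ENNReal.ofReal_lt_ofReal_iff_of_nonneg (by positivity)).1 h1 |>.le
  have hβ0 : 0 ≤ β := by linarith
  have hhβ : cOneNorm (halfBallFlat R r r₀) h ≤ ENNReal.ofReal β := hle _ le_add_self
  have hEβ : cOneNorm (halfBallFlat R r r₀) E ≤ ENNReal.ofReal (β ^ 2) := by
    have h1 := hle (cOneNorm (halfBallFlat R r r₀) E ^ (1 / 2 : ℝ))
      (le_add_self.trans le_self_add)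
    rw [ENNReal.ofReal_pow hβ0]
    calc _ = (cOneNorm (halfBallFlat R r r₀) E ^ (1 / 2 : ℝ)) ^ 2 := by
          rw [← ENNReal.rpow_natCast, ← ENNReal.rpow_mul]; norm_num
      _ ≤ _ := by gcongr
  have hnhds : ∀ y ∈ O ∩ openHalfSpace m, halfBallFlat R r r₀ ∈ nhds y := fun y hy =>
    Filter.mem_of_superset ((hO.inter isOpen_openHalfSpace).mem_nhds hy)
      ((inter_subset_inter_right _ openHalfSpace_subset).trans (hflat.trans_subset sdiff_subset))
  have hk : IsCompact (halfSupport V) := by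
    refine Metric.isCompact_of_isClosed_isBounded isClosed_closure
      (Metric.isBounded_ball.subset (hsupp.trans (sdiff_subset.trans hsubδ)))
  have hkO : halfSupport V ⊆ O ∩ halfSpace m := hsupp.trans_eq hflat.symm
  have main : ∀ ρ : ℝ, 0 ≤ ρ → (∀ x ∈ halfSupport V, ρ ≤ r x) → _ := fun ρ hρ0 hρ =>
    carleman_l2Norm_le (r := r) (V := V) (F := F) (E := E) (h := h) (β := β) (ρ := ρ) G hm hO hOδ
      hO0 (fun y hy => (hOT y hy).trans (by linarith)) (fun y hy => hsmall _ (hOT y hy))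
      (fun y hy => hrexp y ⟨hy.1, openHalfSpace_subset hy.2⟩) hV hk
      (hkO.trans inter_subset_left) (hkO.trans inter_subset_right)
      (fun y _ hyn hyk => by
        by_contra hne
        exact hyk (subset_closure ⟨hyn.le, hne⟩))
      hβC hρ0 (fun y hy => (hρ y hy).trans_eq (hrexp y (hkO hy)))
      (hE.mono (hflat.trans_subset sdiff_subset)) (hh.mono (hflat.trans_subset sdiff_subset))
      (fun y hy => abs_le_of_cOneNorm_le (by positivity) hEβ (hnhds y hy))
      (fun y hy => abs_le_of_cOneNorm_le hβ0 hhβ (hnhds y hy))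
      (fun y hy => heq y (hopen ▸ hy))
      (fun y hy hyn => hbd y (hflat.subset ⟨hy, hyn.ge⟩).1 hyn)
  rw [hopen] at main
  refine ⟨?_, fun ρ hρ0 hρ => main ρ hρ0.le hρ⟩
  -- The first inequality is the case ρ = 0 of the second: the middle term vanishes and no distance
  -- from the origin has to be prescribed.
  have h0 := main 0 le_rfl fun x hx => by
    rw [hrexp x (hkO hx)]
    exact (Real.exp_pos _).le
  rwa [Real.zero_rpow (by norm_num), mul_zero, ENNReal.ofReal_zero, zero_mul, add_zero] at h0
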